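/- **Setting.** Let $n\ge 1$, and let $\pi:X\to Z$ be a principal $\mathbb R^n/\mathbb Z^n$-bundle, where $X$ and $Z$ are second countable locally compact Hausdorff spaces (for instance a $C^\infty$ principal bundle over a Riemannian manifold); $\mathbb R^n$ acts on $X$ through $\mathbb R^n/\mathbb Z^n$. The triple $(X,\mathcal U,s)$ is *in the standard setup* if $\mathcal U=\{U_\lambda\}$ is a good open cover of $X$ (all non-empty finite intersections are contractible) such that $\mathcal W:=\pi(\mathcal U)=\{\pi(U_\lambda)\}$ is a good open cover of $Z$, and if there are fixed continuous sections $\sigma_\lambda:\pi(U_\lambda)\to U_\lambda$ of $\pi$ such that the Čech cochain $s\in\check C^1(\mathcal W,\mathbb R^n)$ of continuous functions satisfies $s_{\lambda_0\lambda_1}(z)\cdot\sigma_{\lambda_1}(z)=\sigma_{\lambda_0}(z)$ and $s_{\lambda\lambda}=0$. Put $F:=\check\partial s$, i.e. $F_{\lambda_0\lambda_1\lambda_2}=s_{\lambda_1\lambda_2}-s_{\lambda_0\lambda_2}+s_{\lambda_0\lambda_1}$; it is a $\mathbb Z^n$-valued Čech 2-cocycle. **Dimensionally reduced Čech cohomology.**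 Let $A$ be $\mathbb Z$, $\mathbb R$ or $\mathbb R/\mathbb Z$, and let $M_n^u(A)$ be the group of strictly upper triangular matrices. For $k\ge2$ let $C^k_F(\mathcal W,A)$ be the group of triples $(\phi^{k0},\phi^{(k-1)1},\phi^{(k-2)2})$ of Čech cochains of degrees $k,k-1,k-2$ with values in continuous functions to $A$, $A^n$, $M_n^u(A)$, and let $C^1_F(\mathcal W,A)$ be the group of pairs $(\phi^{10},\phi^{01})$. The differential is $$D_F\phi=\big(\check\partial\phi^{k0}+(-1)^{k+1}(\phi^{(k-1)1}\cup_1F+\phi^{(k-2)2}\cup_2C(F)),\ \check\partial\phi^{(k-1)1}+(-1)^k\phi^{(k-2)2}\cup_1F,\ \check\partial\phi^{(k-2)2}\big)$$ (with $\phi^{(-1)2}=0$ for $k=1$), where, with $e_l$ the standard basis, $$(\phi^{(k-1)1}\cup_1F)_{\lambda_0\dots\lambda_{k+1}}=\sum_l(\phi^{(k-1)1}_{\lambda_0\dots\lambda_{k-1}})_l\,(F_{\lambda_{k-1}\lambda_k\lambda_{k+1}})_l ,$$ $$\big((\phi^{(k-2)2}\cup_1F)_{\lambda_0\dots\lambda_k}\big)_l=\sum_{i<j}(\phi^{(k-2)2}_{\lambda_0\dots\lambda_{k-2}})_{ij}\big((F_{\lambda_{k-2}\lambda_{k-1}\lambda_k})_i(e_l)_j-(e_l)_i(F_{\lambda_{k-2}\lambda_{k-1}\lambda_k})_j\big),$$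 $$(\phi^{(k-2)2}\cup_2C(F))_{\lambda_0\dots\lambda_{k+1}}=\sum_{i<j}(\phi^{(k-2)2}_{\lambda_0\dots\lambda_{k-2}})_{ij}\,C(F)_{\lambda_{k-2}\dots\lambda_{k+1},ij},$$ $$C(F)_{\lambda_0\lambda_1\lambda_2\lambda_3,ij}=(F_{\lambda_0\lambda_1\lambda_2})_i(F_{\lambda_0\lambda_2\lambda_3})_j-(F_{\lambda_1\lambda_2\lambda_3})_i(F_{\lambda_0\lambda_1\lambda_3})_j .$$ Write $\mathbb H^k_F(\mathcal W,A)$ for the cohomology, and $\mathcal S$ for the coefficients $\mathbb R/\mathbb Z\cong\mathbb T$; an $(\mathbb R/\mathbb Z)^n$-valued function is identified with a function to the dual group of $\mathbb Z^n$. The *connecting map* $\mathbb H^2_F(\mathcal W,\mathcal S)\to\mathbb H^3_F(\mathcal W,\mathbb Z)$ is the zig-zag map of $0\to\mathbb Z\to\mathbb R\to\mathbb R/\mathbb Z\to0$. **The equivariant Brauer group.** Let $\mathcal H=L^2(\mathbb R^n)$ and $\mathcal K=\mathcal K(\mathcal H)$. Let $\mathfrak{Br}_{\mathbb R^n}(X)$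 be the collection of pairs $(A,\alpha)$, where $A$ is a C*-algebra that is $C_0(X)$-isomorphic to the algebra $\Gamma_0(E,X)$ of sections vanishing at infinity of a locally trivial bundle $E\to X$ with fibre $\mathcal K$ and structure group $\operatorname{Aut}\mathcal K$ (point-norm topology), and $\alpha$ is a strongly continuous action of $\mathbb R^n$ on $A$ with $\alpha_t(f\cdot a)=\tau_t(f)\cdot\alpha_t(a)$ for $f\in C_b(X)$, $\tau_t(f)(x)=f(-t\cdot x)$. Let $\operatorname{Br}_{\mathbb R^n}(X)$ be the set of outer conjugacy classes: $(A,\alpha)\sim(B,\beta)$ if there are a $C_0(X)$-isomorphism $\varphi:A\to B$ and a strictly continuous map $w$ from $\mathbb R^n$ to the unitary multipliers of $A$ with $\varphi^{-1}\beta_t\varphi(a)=w_t\alpha_t(a)w_t^*$ and $w_{t+r}=w_t\overline\alpha_t(w_r)$. **The map $\Xi_{\mathcal U,s}:\operatorname{Br}_{\mathbb R^n}(X)\to\mathbb H^2_F(\mathcal W,\mathcal S)$.** Given $(A,\alpha)$, choose $C_0(U_\lambda)$-isomorphisms $\Phi_\lambda:A|_{U_\lambda}\to C_0(U_\lambda,\mathcal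 K)$, strongly continuous maps $v^i_\lambda:U_\lambda\to U(\mathcal H)$ with $\Phi_\lambda\alpha_{e_i}\Phi_\lambda^{-1}=\operatorname{Ad}v^i_\lambda$, and strongly continuous maps $v_{\lambda_0\lambda_1}:\pi(U_{\lambda_0})\cap\pi(U_{\lambda_1})\to U(\mathcal H)$ such that $\Phi_{\lambda_1}(\alpha_{-s_{\lambda_0\lambda_1}(z)}(a))(\sigma_{\lambda_1}(z))=\operatorname{Ad}v_{\lambda_0\lambda_1}(z)(T)$ whenever $\Phi_{\lambda_0}(a)(\sigma_{\lambda_0}(z))=T$. Put $v_\lambda^m(z)=\prod_{i=1}^n v^i_\lambda(\sigma_\lambda(z))^{m_i}$ (ordered product) for $m\in\mathbb Z^n$, and write $v^i_\lambda(z)$ for $v^i_\lambda(\sigma_\lambda(z))$. Then $\Xi_{\mathcal U,s}[A,\alpha]$ is the class of the cocycle $(\phi^{20},\phi^{11},\phi^{02})$ with $$\phi^{02}_{\lambda}(z)_{ij}=v_\lambda^j(z)v_\lambda^i(z)v_\lambda^j(z)^*v_\lambda^i(z)^*\ (i<j),\qquad \phi^{11}_{\lambda_0\lambda_1}(m,z)=v^m_{\lambda_1}(z)v_{\lambda_0\lambda_1}(z)v^m_{\lambda_0}(z)^*v_{\lambda_0\lambda_1}(z)^*,$$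 $$\phi^{20}_{\lambda_0\lambda_1\lambda_2}(z)=v_{\lambda_1\lambda_2}(z)v_{\lambda_0\lambda_1}(z)\,v_{\lambda_0}^{-F_{\lambda_0\lambda_1\lambda_2}(z)}(z)^*\,v_{\lambda_0\lambda_2}(z)^*,$$ where scalar operators $e^{2\pi i\theta}$ are identified with $[\theta]\in\mathbb R/\mathbb Z$. **The map $C(Z,M_n^u(\mathbb R))\to\operatorname{Br}_{\mathbb R^n}(X)$.** For $g\in C(Z,M_n^u(\mathbb R))$ put $\tilde g(r,t)(x)=\big[\sum_{i<j}g(\pi(x))_{ij}\,t_i r_j\big]\in\mathbb R/\mathbb Z\cong\mathbb T$, let $L_{\tilde g}(r)(x)$ be the unitary operator on $L^2(\mathbb R^n)$ with $(L_{\tilde g}(r)(x)\xi)(t)=\tilde g(r,t-r)(x)\,\xi(t-r)$, and map $g$ to $[C_0(X,\mathcal K),\operatorname{Ad}L_{\tilde g}\circ\tau]$, where $((\operatorname{Ad}L_{\tilde g}\circ\tau)_r h)(x)=L_{\tilde g}(r)(x)\,h(-r\cdot x)\,L_{\tilde g}(r)(x)^*$. **Lemma.** Let $(X,\mathcal U,s)$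 be in the standard setup. For every $g\in C(Z,M_n^u(\mathbb R))$ the value of $\Xi_{\mathcal U,s}$ at $[C_0(X,\mathcal K),\operatorname{Ad}L_{\tilde g}\circ\tau]$ is well defined (the choices exist, and all choices, for all representatives of this class, give cocycles in one and the same cohomology class), and the composition $$C(Z,M_n^u(\mathbb R))\to\operatorname{Br}_{\mathbb R^n}(X)\xrightarrow{\ \Xi_{\mathcal U,s}\ }\mathbb H^2_{\check\partial s}(\pi(\mathcal U),\mathcal S)\to\mathbb H^3_{\check\partial s}(\pi(\mathcal U),\mathbb Z)$$ is the zero map. -/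

import Mathlib

open Set Filter Topology MeasureTheory
open scoped BoundedContinuousFunction ZeroAtInfty MultiplierAlgebra

noncomputable section

namespace DimRed

universe u v w

/-! ## Čech cochains -/

/-- The index set of the entries of a strictly upper triangular `n × n` matrix; the group
`M_n^u(A)` is represented as `Pairs n → A`. -/
abbrev Pairs (n : ℕ) : Type := {p : Fin n × Fin n // p.1 < p.2}

section Cech

set_option linter.unusedSectionVars false

variable {Z : Type v} [TopologicalSpace Z] {I : Type w}

/-- The intersection `W_{l 0} ∩ ⋯ ∩ W_{l (m-1)}`. -/
def inter (W : I → Set Z) {m : ℕ} (l : Fin m → I) : Set Z := ⋂ j, W (l j)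


theorem inter_subset (W : I → Set Z) {m : ℕ} (l : Fin m → I) (j : Fin m) {z : Z}
    (hz : z ∈ inter W l) : z ∈ W (l j) := mem_iInter.1 hz j

/-- The inclusion of an intersection into an intersection of some of the sets. -/
def face (W : I → Set Z) {k m : ℕ} (l : Fin m → I) (θ : Fin k → Fin m) :
    C(inter W l, inter W (l ∘ θ)) where
  toFun z := ⟨z.1, mem_iInter.2 fun j => inter_subset W l (θ j) z.2⟩
  continuous_toFun := by fun_prop

/-- The inclusion of an intersection into one of the sets. -/
def proj (W : I → Set Z) {m : ℕ} (l : Fin m → I) (j : Fin m) : C(inter W l, W (l j)) where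
  toFun z := ⟨z.1, inter_subset W l j z.2⟩
  continuous_toFun := by fun_prop

/-- Čech `k`-cochains of the family `W` with coefficients in the sheaf of germs of continuous
`A`-valued functions. -/
abbrev Cech (W : I → Set Z) (k : ℕ) (A : Type*) [TopologicalSpace A] :=
  ∀ l : Fin (k + 1) → I, C(inter W l, A)

/-- The initial indices `0, …, k` among `0, …, k + m`. -/
def frontFace (k m : ℕ) (j : Fin (k + 1)) : Fin (k + m + 1) := ⟨j, by omega⟩

/-- The final indices `k, …, k + m` among `0, …, k + m`. -/
def backFace (k m : ℕ) (j : Fin (m + 1)) : Fin (k + m + 1) := ⟨k + j, by omega⟩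

/-- The function `φ_{l (θ 0) … l (θ k)}`, restricted to `W_{l 0} ∩ ⋯ ∩ W_{l (m-1)}`. -/
def pull {W : I → Set Z} {k m : ℕ} {A : Type*} [TopologicalSpace A] (φ : Cech W k A)
    (l : Fin m → I) (θ : Fin (k + 1) → Fin m) : C(inter W l, A) :=
  (φ (l ∘ θ)).comp (face W l θ)

variable {W : I → Set Z} {A : Type*} [TopologicalSpace A] [AddCommGroup A]
  [IsTopologicalAddGroup A] {n k : ℕ}

/-- The Čech differential. -/
def cechD (k : ℕ) : Cech W k A →+ Cech W (k + 1) A where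
  toFun φ l := ∑ j : Fin (k + 2),
    ((-1 : ℤ) ^ (j : ℕ)) • pull φ l j.succAbove
  map_zero' := by
    funext l; ext z; simp [pull]
  map_add' φ ψ := by
    funext l; ext z; simp [pull, Finset.sum_add_distrib]

/-- The product `φ ∪₁ F` of an `A^n`-valued `k`-cochain with a `ℤ^n`-valued 2-cochain:
`(φ ∪₁ F)_{0 … k+2} = ∑ i, (φ_{0 … k})_i (F_{k, k+1, k+2})_i`. -/
def cupVec (F : Cech W 2 (Fin n → ℤ)) (k : ℕ) : Cech W k (Fin n → A) →+ Cech W (k + 2) A where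
  toFun φ l :=
    ⟨fun z => ∑ i : Fin n, pull F l (backFace k 2) z i • pull φ l (frontFace k 2) z i,
      by fun_prop⟩
  map_zero' := by
    funext l; ext z; simp [pull]
  map_add' φ ψ := by
    funext l; ext z; simp [pull, Finset.sum_add_distrib]

/-- The product `φ ∪₁ F` of an `M_n^u(A)`-valued `k`-cochain with a `ℤ^n`-valued 2-cochain:
its `r`-th component is
`∑_{i<j} (φ_{0 … k})_{ij} (F_i (e_r)_j - (e_r)_i F_j)` with `F = F_{k, k+1, k+2}`. -/
def cupMat (F : Cech W 2 (Fin n → ℤ)) (k : ℕ) :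
    Cech W k (Pairs n → A) →+ Cech W (k + 2) (Fin n → A) where
  toFun φ l :=
    ⟨fun z r => ∑ p : Pairs n,
      (pull F l (backFace k 2) z p.1.1 * (Pi.single r 1 : Fin n → ℤ) p.1.2 -
        (Pi.single r 1 : Fin n → ℤ) p.1.1 * pull F l (backFace k 2) z p.1.2) •
      pull φ l (frontFace k 2) z p, by fun_prop⟩
  map_zero' := by
    funext l; ext z; simp [pull]
  map_add' φ ψ := by
    funext l; ext z; simp [pull, Finset.sum_add_distrib]

/-- The product `φ ∪₂ B` of an `M_n^u(A)`-valued `k`-cochain with an `M_n^u(ℤ)`-valued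
3-cochain. -/
def cupTwo (B : Cech W 3 (Pairs n → ℤ)) (k : ℕ) :
    Cech W k (Pairs n → A) →+ Cech W (k + 3) A where
  toFun φ l :=
    ⟨fun z => ∑ p : Pairs n, pull B l (backFace k 3) z p • pull φ l (frontFace k 3) z p,
      by fun_prop⟩
  map_zero' := by
    funext l; ext z; simp [pull]
  map_add' φ ψ := by
    funext l; ext z; simp [pull, Finset.sum_add_distrib]

/-- The 3-cochain
`C(F)_{0123} i j = F_{012} i * F_{023} j - F_{123} i * F_{013} j`. -/
def steenrodC (F : Cech W 2 (Fin n → ℤ)) : Cech W 3 (Pairs n → ℤ) := fun l =>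
  ⟨fun z p =>
    pull F l (Fin.succAbove 3) z p.1.1 *
      pull F l (Fin.succAbove 1) z p.1.2 -
    pull F l (Fin.succAbove 0) z p.1.1 *
      pull F l (Fin.succAbove 2) z p.1.2, by fun_prop⟩

/-! ## Dimensionally reduced Čech cohomology -/

/-- Dimensionally reduced cochains of degree `1` (they have no `M_n^u`-component). -/
abbrev DR1 (W : I → Set Z) (n : ℕ) (A : Type*) [TopologicalSpace A] :=
  Cech W 1 A × Cech W 0 (Fin n → A)

/-- Dimensionally reduced cochains of degree `k + 2`: triples
`(φ^{(k+2)0}, φ^{(k+1)1}, φ^{k2})`. For `A = ℝ/ℤ` a continuous function with values in the dual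
group of `ℤ^n` is represented by its values at the standard basis. -/
abbrev DR (W : I → Set Z) (n : ℕ) (A : Type*) [TopologicalSpace A] (k : ℕ) :=
  Cech W (k + 2) A × Cech W (k + 1) (Fin n → A) × Cech W k (Pairs n → A)

/-- The differential `D_F` from degree `1` to degree `2`. -/
def drD1 (F : Cech W 2 (Fin n → ℤ)) : DR1 W n A →+ DR W n A 0 where
  toFun φ := (cechD 1 φ.1 + cupVec F 0 φ.2, cechD 0 φ.2, 0)
  map_zero' := by simp
  map_add' φ ψ := by
    simp only [Prod.fst_add, Prod.snd_add, map_add, Prod.mk_add_mk, add_zero]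
    rw [add_add_add_comm]

/-- The differential `D_F` from degree `k + 2` to degree `k + 3`. -/
def drD (F : Cech W 2 (Fin n → ℤ)) (k : ℕ) : DR W n A k →+ DR W n A (k + 1) where
  toFun φ :=
    (cechD (k + 2) φ.1 + (-1 : ℤ) ^ ((k + 2) + 1) • cupVec F (k + 1) φ.2.1
        + (-1 : ℤ) ^ ((k + 2) + 1) • cupTwo (steenrodC F) k φ.2.2,
      cechD (k + 1) φ.2.1 + (-1 : ℤ) ^ (k + 2) • cupMat F k φ.2.2,
      cechD k φ.2.2)
  map_zero' := by simp
  map_add' φ ψ := by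
    simp only [Prod.fst_add, Prod.snd_add, map_add, Prod.mk_add_mk, smul_add]
    refine Prod.ext ?_ (Prod.ext ?_ rfl) <;> dsimp only <;> abel

/-- The coboundaries of degree `k + 2`. -/
def drB (F : Cech W 2 (Fin n → ℤ)) : (k : ℕ) → AddSubgroup (DR W n A k)
  | 0 => (drD1 F).range
  | k + 1 => (drD F k).range

/-- The dimensionally reduced Čech cohomology group `ℍ^{k+2}_F(W, A)`: cocycles modulo
coboundaries. -/
abbrev DRH (W : I → Set Z) (A : Type*) [TopologicalSpace A] [AddCommGroup A]
    [IsTopologicalAddGroup A] (F : Cech W 2 (Fin n → ℤ)) (k : ℕ) :=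
  (drD (A := A) F k).ker ⧸ (drB (A := A) F k).addSubgroupOf (drD (A := A) F k).ker

/-- The class of a cocycle. -/
def DRH.mk {F : Cech W 2 (Fin n → ℤ)} {k : ℕ} (φ : DR W n A k) (h : drD F k φ = 0) :
    DRH W A F k := QuotientAddGroup.mk ⟨φ, h⟩

/-! ## Change of coefficients -/

variable {B : Type*} [TopologicalSpace B] [AddCommGroup B] [IsTopologicalAddGroup B]

/-- Change of coefficients along a continuous homomorphism. -/
def cechMap (f : A →+ B) (hf : Continuous f) : Cech W k A →+ Cech W k B where
  toFun φ l := ⟨fun z => f (φ l z), by fun_prop⟩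
  map_zero' := by funext l; ext z; simp
  map_add' φ ψ := by funext l; ext z; simp

/-- Change of coefficients for tuple-valued cochains. -/
def cechMapPi {J : Type} (f : A →+ B) (hf : Continuous f) :
    Cech W k (J → A) →+ Cech W k (J → B) where
  toFun φ l := ⟨fun z j => f (φ l z j), by fun_prop⟩
  map_zero' := by funext l; ext z j; simp
  map_add' φ ψ := by funext l; ext z j; simp

/-- Change of coefficients on dimensionally reduced cochains. -/
def drMap (f : A →+ B) (hf : Continuous f) : DR W n A k →+ DR W n B k where
  toFun φ := (cechMap f hf φ.1, cechMapPi f hf φ.2.1, cechMapPi f hf φ.2.2)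
  map_zero' := by simp
  map_add' φ ψ := by simp

/-- The inclusion `ℤ → ℝ`. -/
def intToReal : ℤ →+ ℝ := Int.castAddHom ℝ

theorem continuous_intToReal : Continuous intToReal := continuous_of_discreteTopology

/-- The projection `ℝ → ℝ/ℤ`. -/
def realToCircle : ℝ →+ UnitAddCircle := QuotientAddGroup.mk' _

theorem continuous_realToCircle : Continuous realToCircle := AddCircle.continuous_mk' 1

/-- `DR` cochains: `ℤ → ℝ`. -/
abbrev drIR : DR W n ℤ k →+ DR W n ℝ k := drMap intToReal continuous_intToReal

/-- `DR` cochains: `ℝ → ℝ/ℤ`. -/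
abbrev drRT : DR W n ℝ k →+ DR W n UnitAddCircle k :=
  drMap realToCircle continuous_realToCircle

theorem cechMap_cechD (f : A →+ B) (hf : Continuous f) (φ : Cech W k A) :
    cechMap f hf (cechD k φ) = cechD k (cechMap f hf φ) := by
  funext l; ext z; simp [cechMap, cechD, pull]

theorem cechMapPi_cechD {J : Type} (f : A →+ B) (hf : Continuous f) (φ : Cech W k (J → A)) :
    cechMapPi f hf (cechD k φ) = cechD k (cechMapPi f hf φ) := by
  funext l; ext z j; simp [cechMapPi, cechD, pull]

theorem cechMap_cupVec (f : A →+ B) (hf : Continuous f) (F : Cech W 2 (Fin n → ℤ))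
    (φ : Cech W k (Fin n → A)) :
    cechMap f hf (cupVec F k φ) = cupVec F k (cechMapPi f hf φ) := by
  funext l; ext z; simp [cechMap, cechMapPi, cupVec, pull]

theorem cechMap_cupTwo (f : A →+ B) (hf : Continuous f) (F : Cech W 3 (Pairs n → ℤ))
    (φ : Cech W k (Pairs n → A)) :
    cechMap f hf (cupTwo F k φ) = cupTwo F k (cechMapPi f hf φ) := by
  funext l; ext z; simp [cechMap, cechMapPi, cupTwo, pull]

theorem cechMapPi_cupMat (f : A →+ B) (hf : Continuous f) (F : Cech W 2 (Fin n → ℤ))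
    (φ : Cech W k (Pairs n → A)) :
    cechMapPi f hf (cupMat F k φ) = cupMat F k (cechMapPi f hf φ) := by
  funext l; ext z j; simp [cechMapPi, cupMat, pull]

theorem drMap_drD (f : A →+ B) (hf : Continuous f) (F : Cech W 2 (Fin n → ℤ))
    (φ : DR W n A k) : drMap f hf (drD F k φ) = drD F k (drMap f hf φ) := by
  refine Prod.ext ?_ (Prod.ext ?_ ?_)
  · simp [drMap, drD, cechMap_cechD, cechMap_cupVec, cechMap_cupTwo]
  · simp [drMap, drD, cechMapPi_cechD, cechMapPi_cupMat]
  · simp [drMap, drD, cechMapPi_cechD]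

end Cech


/-! ## The connecting homomorphism -/

section Connecting

set_option linter.unusedSectionVars false

variable {Z : Type v} [TopologicalSpace Z] {I : Type w} {W : I → Set Z} {n : ℕ}

open Classical in
/-- The value of a cochain at a point, extended by zero. -/
def cval {A : Type*} [TopologicalSpace A] [Zero A] {k : ℕ} (φ : Cech W k A)
    (l : Fin (k + 1) → I) (z : Z) : A :=
  if h : z ∈ inter W l then φ l ⟨z, h⟩ else 0

theorem apply_eq_cval {A : Type*} [TopologicalSpace A] [Zero A] {k : ℕ} (φ : Cech W k A)
    (l : Fin (k + 1) → I) (z : inter W l) : φ l z = cval φ l z.1 := by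
  rw [cval, dif_pos z.2]

theorem pull_eq_cval {A : Type*} [TopologicalSpace A] [Zero A] {k m : ℕ} (φ : Cech W k A)
    (l : Fin m → I) (θ : Fin (k + 1) → Fin m) (z : inter W l) :
    pull φ l θ z = cval φ (l ∘ θ) z.1 := apply_eq_cval φ _ (face W l θ z)

theorem cval_one {A : Type*} [TopologicalSpace A] [Zero A] (φ : Cech W 0 A)
    (l : Fin 1 → I) (z : Z) : cval φ l z = cval φ ![l 0] z := by
  congr 1; ext j; fin_cases j; rfl

theorem cval_two {A : Type*} [TopologicalSpace A] [Zero A] (φ : Cech W 1 A)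
    (l : Fin 2 → I) (z : Z) : cval φ l z = cval φ ![l 0, l 1] z := by
  congr 1; ext j; fin_cases j <;> rfl

theorem cval_three {A : Type*} [TopologicalSpace A] [Zero A] (φ : Cech W 2 A)
    (l : Fin 3 → I) (z : Z) : cval φ l z = cval φ ![l 0, l 1, l 2] z := by
  congr 1; ext j; fin_cases j <;> rfl


theorem cval_four {A : Type*} [TopologicalSpace A] [Zero A] (φ : Cech W 3 A)
    (l : Fin 4 → I) (z : Z) : cval φ l z = cval φ ![l 0, l 1, l 2, l 3] z := by
  congr 1; ext j; fin_cases j <;> rfl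

theorem cval_of_mem {A : Type*} [TopologicalSpace A] [Zero A] {k : ℕ} (φ : Cech W k A)
    (l : Fin (k + 1) → I) {z : Z} (h : z ∈ inter W l) : cval φ l z = φ l ⟨z, h⟩ := dif_pos h

section Values

variable {A : Type*} [TopologicalSpace A] [AddCommGroup A] [IsTopologicalAddGroup A]
  {z : Z} {a b c d e : I}

theorem mem_inter_two (ha : z ∈ W a) (hb : z ∈ W b) : z ∈ inter W ![a, b] :=
  mem_iInter.2 fun j => by fin_cases j <;> assumption

theorem mem_inter_three (ha : z ∈ W a) (hb : z ∈ W b) (hc : z ∈ W c) :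
    z ∈ inter W ![a, b, c] :=
  mem_iInter.2 fun j => by fin_cases j <;> assumption

theorem mem_inter_four (ha : z ∈ W a) (hb : z ∈ W b) (hc : z ∈ W c) (hd : z ∈ W d) :
    z ∈ inter W ![a, b, c, d] :=
  mem_iInter.2 fun j => by fin_cases j <;> assumption

theorem mem_inter_five (ha : z ∈ W a) (hb : z ∈ W b) (hc : z ∈ W c) (hd : z ∈ W d)
    (he : z ∈ W e) : z ∈ inter W ![a, b, c, d, e] :=
  mem_iInter.2 fun j => by fin_cases j <;> assumption

theorem cval_cechD_zero (φ : Cech W 0 A) (ha : z ∈ W a) (hb : z ∈ W b) :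
    cval (cechD 0 φ) ![a, b] z = cval φ ![b] z - cval φ ![a] z := by
  rw [cval_of_mem _ _ (mem_inter_two ha hb)]
  simp only [cechD, AddMonoidHom.coe_mk, ZeroHom.coe_mk, Fin.sum_univ_succ, ContinuousMap.coe_add,
    ContinuousMap.coe_smul, Pi.add_apply, Pi.smul_apply, pull_eq_cval, Finset.univ_eq_empty,
    Finset.sum_empty, ContinuousMap.coe_zero, Pi.zero_apply]
  rw [cval_one _ (![a, b] ∘ _), cval_one _ (![a, b] ∘ _)]
  simp [Fin.succAbove, sub_eq_add_neg]

theorem cval_cechD_one (φ : Cech W 1 A) (ha : z ∈ W a) (hb : z ∈ W b) (hc : z ∈ W c) :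
    cval (cechD 1 φ) ![a, b, c] z =
      cval φ ![b, c] z - cval φ ![a, c] z + cval φ ![a, b] z := by
  rw [cval_of_mem _ _ (mem_inter_three ha hb hc)]
  simp only [cechD, AddMonoidHom.coe_mk, ZeroHom.coe_mk, Fin.sum_univ_succ, ContinuousMap.coe_add,
    ContinuousMap.coe_smul, Pi.add_apply, Pi.smul_apply, pull_eq_cval, Finset.univ_eq_empty,
    Finset.sum_empty, ContinuousMap.coe_zero, Pi.zero_apply]
  rw [cval_two _ (![a, b, c] ∘ _), cval_two _ (![a, b, c] ∘ _), cval_two _ (![a, b, c] ∘ _)]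
  simp [Fin.succAbove, Fin.lt_def, sub_eq_add_neg, add_assoc]

theorem cval_cechD_two (φ : Cech W 2 A) (ha : z ∈ W a) (hb : z ∈ W b) (hc : z ∈ W c)
    (hd : z ∈ W d) :
    cval (cechD 2 φ) ![a, b, c, d] z =
      cval φ ![b, c, d] z - cval φ ![a, c, d] z + cval φ ![a, b, d] z - cval φ ![a, b, c] z := by
  rw [cval_of_mem _ _ (mem_inter_four ha hb hc hd)]
  simp only [cechD, AddMonoidHom.coe_mk, ZeroHom.coe_mk, Fin.sum_univ_succ, ContinuousMap.coe_add,
    ContinuousMap.coe_smul, Pi.add_apply, Pi.smul_apply, pull_eq_cval, Finset.univ_eq_empty,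
    Finset.sum_empty, ContinuousMap.coe_zero, Pi.zero_apply]
  rw [cval_three _ (![a, b, c, d] ∘ _), cval_three _ (![a, b, c, d] ∘ _),
    cval_three _ (![a, b, c, d] ∘ _), cval_three _ (![a, b, c, d] ∘ _)]
  simp [Fin.succAbove, Fin.lt_def, pow_succ, sub_eq_add_neg, add_assoc]

theorem cval_cechD_three (φ : Cech W 3 A) (ha : z ∈ W a) (hb : z ∈ W b) (hc : z ∈ W c)
    (hd : z ∈ W d) (he : z ∈ W e) :
    cval (cechD 3 φ) ![a, b, c, d, e] z =
      cval φ ![b, c, d, e] z - cval φ ![a, c, d, e] z + cval φ ![a, b, d, e] z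
        - cval φ ![a, b, c, e] z + cval φ ![a, b, c, d] z := by
  rw [cval_of_mem _ _ (mem_inter_five ha hb hc hd he)]
  simp only [cechD, AddMonoidHom.coe_mk, ZeroHom.coe_mk, Fin.sum_univ_succ, ContinuousMap.coe_add,
    ContinuousMap.coe_smul, Pi.add_apply, Pi.smul_apply, pull_eq_cval, Finset.univ_eq_empty,
    Finset.sum_empty, ContinuousMap.coe_zero, Pi.zero_apply]
  rw [cval_four _ (![a, b, c, d, e] ∘ _), cval_four _ (![a, b, c, d, e] ∘ _),
    cval_four _ (![a, b, c, d, e] ∘ _), cval_four _ (![a, b, c, d, e] ∘ _),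
    cval_four _ (![a, b, c, d, e] ∘ _)]
  simp [Fin.succAbove, Fin.lt_def, pow_succ, sub_eq_add_neg, add_assoc]

theorem cval_cupVec_zero (F : Cech W 2 (Fin n → ℤ)) (φ : Cech W 0 (Fin n → A))
    (ha : z ∈ W a) (hb : z ∈ W b) (hc : z ∈ W c) :
    cval (cupVec F 0 φ) ![a, b, c] z = ∑ i, cval F ![a, b, c] z i • cval φ ![a] z i := by
  rw [cval_of_mem _ _ (mem_inter_three ha hb hc)]
  simp only [cupVec, AddMonoidHom.coe_mk, ZeroHom.coe_mk, ContinuousMap.coe_mk, pull_eq_cval]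
  rw [cval_three _ (![a, b, c] ∘ _), cval_one _ (![a, b, c] ∘ _)]
  rfl

theorem cval_cupVec_one (F : Cech W 2 (Fin n → ℤ)) (φ : Cech W 1 (Fin n → A))
    (ha : z ∈ W a) (hb : z ∈ W b) (hc : z ∈ W c) (hd : z ∈ W d) :
    cval (cupVec F 1 φ) ![a, b, c, d] z = ∑ i, cval F ![b, c, d] z i • cval φ ![a, b] z i := by
  rw [cval_of_mem _ _ (mem_inter_four ha hb hc hd)]
  simp only [cupVec, AddMonoidHom.coe_mk, ZeroHom.coe_mk, ContinuousMap.coe_mk, pull_eq_cval]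
  rw [cval_three _ (![a, b, c, d] ∘ _), cval_two _ (![a, b, c, d] ∘ _)]
  rfl

theorem cval_cupVec_two (F : Cech W 2 (Fin n → ℤ)) (φ : Cech W 2 (Fin n → A))
    (ha : z ∈ W a) (hb : z ∈ W b) (hc : z ∈ W c) (hd : z ∈ W d) (he : z ∈ W e) :
    cval (cupVec F 2 φ) ![a, b, c, d, e] z =
      ∑ i, cval F ![c, d, e] z i • cval φ ![a, b, c] z i := by
  rw [cval_of_mem _ _ (mem_inter_five ha hb hc hd he)]
  simp only [cupVec, AddMonoidHom.coe_mk, ZeroHom.coe_mk, ContinuousMap.coe_mk, pull_eq_cval]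
  rw [cval_three F (![a, b, c, d, e] ∘ _), cval_three φ (![a, b, c, d, e] ∘ _)]
  rfl

theorem cval_cupMat_zero (F : Cech W 2 (Fin n → ℤ)) (φ : Cech W 0 (Pairs n → A))
    (ha : z ∈ W a) (hb : z ∈ W b) (hc : z ∈ W c) (r : Fin n) :
    cval (cupMat F 0 φ) ![a, b, c] z r = ∑ p : Pairs n,
      (cval F ![a, b, c] z p.1.1 * (Pi.single r 1 : Fin n → ℤ) p.1.2 -
        (Pi.single r 1 : Fin n → ℤ) p.1.1 * cval F ![a, b, c] z p.1.2) • cval φ ![a] z p := by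
  rw [cval_of_mem _ _ (mem_inter_three ha hb hc)]
  simp only [cupMat, AddMonoidHom.coe_mk, ZeroHom.coe_mk, ContinuousMap.coe_mk, pull_eq_cval]
  rw [cval_three _ (![a, b, c] ∘ _), cval_one _ (![a, b, c] ∘ _)]
  rfl

theorem cval_cupMat_one (F : Cech W 2 (Fin n → ℤ)) (φ : Cech W 1 (Pairs n → A))
    (ha : z ∈ W a) (hb : z ∈ W b) (hc : z ∈ W c) (hd : z ∈ W d) (r : Fin n) :
    cval (cupMat F 1 φ) ![a, b, c, d] z r = ∑ p : Pairs n,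
      (cval F ![b, c, d] z p.1.1 * (Pi.single r 1 : Fin n → ℤ) p.1.2 -
        (Pi.single r 1 : Fin n → ℤ) p.1.1 * cval F ![b, c, d] z p.1.2) •
        cval φ ![a, b] z p := by
  rw [cval_of_mem _ _ (mem_inter_four ha hb hc hd)]
  simp only [cupMat, AddMonoidHom.coe_mk, ZeroHom.coe_mk, ContinuousMap.coe_mk, pull_eq_cval]
  rw [cval_three _ (![a, b, c, d] ∘ _), cval_two _ (![a, b, c, d] ∘ _)]
  rfl

theorem cval_cupTwo_zero (F : Cech W 3 (Pairs n → ℤ)) (φ : Cech W 0 (Pairs n → A))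
    (ha : z ∈ W a) (hb : z ∈ W b) (hc : z ∈ W c) (hd : z ∈ W d) :
    cval (cupTwo F 0 φ) ![a, b, c, d] z =
      ∑ p, cval F ![a, b, c, d] z p • cval φ ![a] z p := by
  rw [cval_of_mem _ _ (mem_inter_four ha hb hc hd)]
  simp only [cupTwo, AddMonoidHom.coe_mk, ZeroHom.coe_mk, ContinuousMap.coe_mk, pull_eq_cval]
  rw [cval_four _ (![a, b, c, d] ∘ _), cval_one _ (![a, b, c, d] ∘ _)]
  rfl

theorem cval_cupTwo_one (F : Cech W 3 (Pairs n → ℤ)) (φ : Cech W 1 (Pairs n → A))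
    (ha : z ∈ W a) (hb : z ∈ W b) (hc : z ∈ W c) (hd : z ∈ W d) (he : z ∈ W e) :
    cval (cupTwo F 1 φ) ![a, b, c, d, e] z =
      ∑ p, cval F ![b, c, d, e] z p • cval φ ![a, b] z p := by
  rw [cval_of_mem _ _ (mem_inter_five ha hb hc hd he)]
  simp only [cupTwo, AddMonoidHom.coe_mk, ZeroHom.coe_mk, ContinuousMap.coe_mk, pull_eq_cval]
  rw [cval_four _ (![a, b, c, d, e] ∘ _), cval_two _ (![a, b, c, d, e] ∘ _)]
  rfl

theorem cval_steenrodC (F : Cech W 2 (Fin n → ℤ))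
    (ha : z ∈ W a) (hb : z ∈ W b) (hc : z ∈ W c) (hd : z ∈ W d) (p : Pairs n) :
    cval (steenrodC F) ![a, b, c, d] z p =
      cval F ![a, b, c] z p.1.1 * cval F ![a, c, d] z p.1.2 -
        cval F ![b, c, d] z p.1.1 * cval F ![a, b, d] z p.1.2 := by
  rw [cval_of_mem _ _ (mem_inter_four ha hb hc hd)]
  simp only [steenrodC, ContinuousMap.coe_mk, pull_eq_cval]
  rw [cval_three _ (![a, b, c, d] ∘ _), cval_three _ (![a, b, c, d] ∘ _),
    cval_three _ (![a, b, c, d] ∘ _), cval_three _ (![a, b, c, d] ∘ _)]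
  rfl

theorem cval_add {k : ℕ} (φ ψ : Cech W k A) (l : Fin (k + 1) → I) :
    cval (φ + ψ) l z = cval φ l z + cval ψ l z := by
  by_cases h : z ∈ inter W l <;> simp [cval, h]

theorem cval_zsmul {k : ℕ} (m : ℤ) (φ : Cech W k A) (l : Fin (k + 1) → I) :
    cval (m • φ) l z = m • cval φ l z := by
  by_cases h : z ∈ inter W l <;> simp [cval, h]

theorem cval_zero {k : ℕ} (l : Fin (k + 1) → I) :
    cval (0 : Cech W k A) l z = 0 := by
  by_cases h : z ∈ inter W l <;> simp [cval, h]

theorem cech_ext_three {φ ψ : Cech W 2 A}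
    (h : ∀ a b c z, z ∈ W a → z ∈ W b → z ∈ W c →
      cval φ ![a, b, c] z = cval ψ ![a, b, c] z) : φ = ψ := by
  funext l; ext z
  rw [apply_eq_cval, apply_eq_cval, cval_three, cval_three ψ]
  exact h _ _ _ _ (inter_subset W l 0 z.2) (inter_subset W l 1 z.2) (inter_subset W l 2 z.2)

theorem cech_ext_four {φ ψ : Cech W 3 A}
    (h : ∀ a b c d z, z ∈ W a → z ∈ W b → z ∈ W c → z ∈ W d →
      cval φ ![a, b, c, d] z = cval ψ ![a, b, c, d] z) : φ = ψ := by
  funext l; ext z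
  rw [apply_eq_cval, apply_eq_cval, cval_four, cval_four ψ]
  exact h _ _ _ _ _ (inter_subset W l 0 z.2) (inter_subset W l 1 z.2) (inter_subset W l 2 z.2)
    (inter_subset W l 3 z.2)

theorem cech_ext_five {φ ψ : Cech W 4 A}
    (h : ∀ a b c d e z, z ∈ W a → z ∈ W b → z ∈ W c → z ∈ W d → z ∈ W e →
      cval φ ![a, b, c, d, e] z = cval ψ ![a, b, c, d, e] z) : φ = ψ := by
  funext l; ext z
  have hl : ![l 0, l 1, l 2, l 3, l 4] = l := by ext j; fin_cases j <;> rfl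
  rw [apply_eq_cval, apply_eq_cval]
  refine (congrArg (fun l => cval φ l z.1) hl).symm.trans
    (Eq.trans ?_ (congrArg (fun l => cval ψ l z.1) hl))
  exact h _ _ _ _ _ _ (inter_subset W l 0 z.2) (inter_subset W l 1 z.2) (inter_subset W l 2 z.2)
    (inter_subset W l 3 z.2) (inter_subset W l 4 z.2)

end Values

section Square

variable {J : Type} {F : Cech W 2 (Fin n → ℤ)}

theorem cechD_cechD_zero (φ : Cech W 0 (J → ℝ)) : cechD 1 (cechD 0 φ) = 0 := by
  refine cech_ext_three fun a b c z ha hb hc => ?_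
  simp only [cval_cechD_one, cval_cechD_zero, cval_zero, ha, hb, hc]
  abel

theorem cechD_cechD_one {A : Type*} [TopologicalSpace A] [AddCommGroup A]
    [IsTopologicalAddGroup A] (φ : Cech W 1 A) : cechD 2 (cechD 1 φ) = 0 := by
  refine cech_ext_four fun a b c d z ha hb hc hd => ?_
  simp only [cval_cechD_two, cval_cechD_one, cval_zero, ha, hb, hc, hd]
  abel

theorem cechD_cechD_two {A : Type*} [TopologicalSpace A] [AddCommGroup A]
    [IsTopologicalAddGroup A] (φ : Cech W 2 A) : cechD 3 (cechD 2 φ) = 0 := by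
  refine cech_ext_five fun a b c d e z ha hb hc hd he => ?_
  simp only [cval_cechD_three, cval_cechD_two, cval_zero, ha, hb, hc, hd, he]
  abel

theorem cocycle_eq (hF : cechD 2 F = 0) {z : Z} {a b c d : I}
    (ha : z ∈ W a) (hb : z ∈ W b) (hc : z ∈ W c) (hd : z ∈ W d) (i : Fin n) :
    (cval F ![b, c, d] z i : ℝ) = cval F ![a, c, d] z i - cval F ![a, b, d] z i
      + cval F ![a, b, c] z i := by
  have h := cval_cechD_two F ha hb hc hd
  rw [hF, cval_zero] at h
  have h' := congrArg (Int.cast : ℤ → ℝ) (congrFun h i)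
  simp at h'
  linarith

theorem cechD_cupVec_zero (hF : cechD 2 F = 0) (g : Cech W 0 (Fin n → ℝ)) :
    cechD 2 (cupVec F 0 g) = cupVec F 1 (cechD 0 g) := by
  refine cech_ext_four fun a b c d z ha hb hc hd => ?_
  simp only [cval_cechD_two, cval_cechD_zero, ha, hb, hc, hd, cval_cupVec_zero, cval_cupVec_one]
  simp only [zsmul_eq_mul, cocycle_eq hF ha hb hc hd, ← Finset.sum_sub_distrib,
    ← Finset.sum_add_distrib, Pi.sub_apply]
  exact Finset.sum_congr rfl fun i _ => by ring

theorem cechD_cupVec_one (hF : cechD 2 F = 0) (g : Cech W 1 (Fin n → ℝ)) :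
    cechD 3 (cupVec F 1 g) = cupVec F 2 (cechD 1 g) := by
  refine cech_ext_five fun a b c d e z ha hb hc hd he => ?_
  simp only [cval_cechD_three, cval_cechD_one, ha, hb, hc, hd, he, cval_cupVec_two,
    cval_cupVec_one]
  simp only [zsmul_eq_mul, cocycle_eq hF ha hb hc hd, cocycle_eq hF ha hb hc he,
    cocycle_eq hF ha hb hd he, cocycle_eq hF ha hc hd he, ← Finset.sum_sub_distrib,
    ← Finset.sum_add_distrib, Pi.sub_apply, Pi.add_apply]
  exact Finset.sum_congr rfl fun i _ => by ring

theorem cechD_cupMat_zero (hF : cechD 2 F = 0) (h : Cech W 0 (Pairs n → ℝ)) :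
    cechD 2 (cupMat F 0 h) = cupMat F 1 (cechD 0 h) := by
  refine cech_ext_four fun a b c d z ha hb hc hd => funext fun r => ?_
  simp only [cval_cechD_two, cval_cechD_zero, ha, hb, hc, hd, cval_cupMat_zero, cval_cupMat_one,
    Pi.sub_apply, Pi.add_apply]
  simp only [zsmul_eq_mul, Int.cast_sub, Int.cast_mul, cocycle_eq hF ha hb hc hd,
    ← Finset.sum_sub_distrib, ← Finset.sum_add_distrib]
  exact Finset.sum_congr rfl fun i _ => by ring

theorem sum_single_mul (x y : Fin n → ℝ) (h : Pairs n → ℝ) :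
    ∑ r, x r * ∑ p : Pairs n, (y p.1.1 * (((Pi.single r 1 : Fin n → ℤ) p.1.2 : ℤ) : ℝ) -
      (((Pi.single r 1 : Fin n → ℤ) p.1.1 : ℤ) : ℝ) * y p.1.2) * h p =
    ∑ p : Pairs n, (y p.1.1 * x p.1.2 - x p.1.1 * y p.1.2) * h p := by
  simp_rw [Finset.mul_sum]
  rw [Finset.sum_comm]
  refine Finset.sum_congr rfl fun p _ => ?_
  have h1 : ∀ q : Fin n, ∑ r, x r * (((Pi.single r 1 : Fin n → ℤ) q : ℤ) : ℝ) = x q := by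
    intro q
    simp [Pi.single_apply]
  calc _ = ∑ r, ((y p.1.1 * h p) * (x r * (((Pi.single r 1 : Fin n → ℤ) p.1.2 : ℤ) : ℝ)) -
        (y p.1.2 * h p) * (x r * (((Pi.single r 1 : Fin n → ℤ) p.1.1 : ℤ) : ℝ))) :=
        Finset.sum_congr rfl fun r _ => by ring
    _ = _ := by
        rw [Finset.sum_sub_distrib, ← Finset.mul_sum, ← Finset.mul_sum, h1, h1]; ring

theorem cechD_cupTwo_zero (hF : cechD 2 F = 0) (h : Cech W 0 (Pairs n → ℝ)) :
    cechD 3 (cupTwo (steenrodC F) 0 h) =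
      cupTwo (steenrodC F) 1 (cechD 0 h) + cupVec F 2 (cupMat F 0 h) := by
  refine cech_ext_five fun a b c d e z ha hb hc hd he => ?_
  simp only [cval_cechD_three, cval_cechD_zero, cval_add, ha, hb, hc, hd, he, cval_cupTwo_zero,
    cval_cupTwo_one, cval_cupVec_two, cval_cupMat_zero, cval_steenrodC]
  simp only [zsmul_eq_mul, Int.cast_sub, Int.cast_mul, Pi.sub_apply]
  rw [sum_single_mul (fun r => (cval F ![c, d, e] z r : ℝ)) (fun r => (cval F ![a, b, c] z r : ℝ))]
  simp only [cocycle_eq hF ha hb hc hd, cocycle_eq hF ha hb hc he,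
    cocycle_eq hF ha hb hd he, cocycle_eq hF ha hc hd he, ← Finset.sum_sub_distrib,
    ← Finset.sum_add_distrib]
  exact Finset.sum_congr rfl fun i _ => by ring

/-- The differential squares to zero. -/
theorem drD_drD1 (hF : cechD 2 F = 0) (η : DR1 W n ℝ) : drD F 0 (drD1 F η) = 0 := by
  have h1 := cechD_cechD_one η.1
  have h2 := cechD_cupVec_zero hF η.2
  have h3 := cechD_cechD_zero η.2
  refine Prod.ext ?_ (Prod.ext ?_ ?_)
  · change cechD 2 (cechD 1 η.1 + cupVec F 0 η.2) + (-1 : ℤ) ^ 3 • cupVec F 1 (cechD 0 η.2)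
      + (-1 : ℤ) ^ 3 • cupTwo (steenrodC F) 0 0 = 0
    rw [map_add, h1, h2, map_zero]
    simp
  · change cechD 1 (cechD 0 η.2) + (-1 : ℤ) ^ 2 • cupMat F 0 0 = 0
    rw [h3, map_zero]
    simp
  · change cechD 0 0 = 0
    rw [map_zero]

/-- The differential squares to zero. -/
theorem drD_drD (hF : cechD 2 F = 0) (φ : DR W n ℝ 0) : drD F 1 (drD F 0 φ) = 0 := by
  obtain ⟨f, g, h⟩ := φ
  have e1 := cechD_cechD_two f
  have e2 := cechD_cupVec_one hF g
  have e3 := cechD_cupTwo_zero hF h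
  have e4 := cechD_cechD_one g
  have e5 := cechD_cupMat_zero hF h
  have e6 := cechD_cechD_zero h
  refine Prod.ext ?_ (Prod.ext ?_ ?_)
  · change cechD 3 (cechD 2 f + (-1 : ℤ) ^ 3 • cupVec F 1 g
        + (-1 : ℤ) ^ 3 • cupTwo (steenrodC F) 0 h)
      + (-1 : ℤ) ^ 4 • cupVec F 2 (cechD 1 g + (-1 : ℤ) ^ 2 • cupMat F 0 h)
      + (-1 : ℤ) ^ 4 • cupTwo (steenrodC F) 1 (cechD 0 h) = 0
    simp only [map_add, map_zsmul, e1, e2, e3]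
    norm_num
    abel
  · change cechD 2 (cechD 1 g + (-1 : ℤ) ^ 2 • cupMat F 0 h)
      + (-1 : ℤ) ^ 3 • cupMat F 1 (cechD 0 h) = 0
    simp only [map_add, map_zsmul, e4, e5]
    norm_num
  · exact e6

end Square


/-- A good open cover: an open cover all of whose non-empty finite intersections are
contractible. -/
structure IsGoodCover {Y : Type*} [TopologicalSpace Y] {I : Type*} (W : I → Set Y) : Prop where
  isOpen : ∀ i, IsOpen (W i)
  cover : ⋃ i, W i = univ
  contractible : ∀ (m : ℕ) (l : Fin (m + 1) → I), (inter W l).Nonempty →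
    ContractibleSpace (inter W l)

/-- A continuous circle-valued function on a contractible space lifts to the real line. -/
theorem exists_real_lift {Y : Type*} [TopologicalSpace Y] [ContractibleSpace Y]
    (f : C(Y, UnitAddCircle)) : ∃ g : C(Y, ℝ), ∀ y, realToCircle (g y) = f y := by
  obtain ⟨y₀, ⟨H⟩⟩ := (contractible_iff_id_nullhomotopic Y).1 inferInstance
  obtain ⟨t, ht⟩ := QuotientAddGroup.mk_surjective (f y₀)
  have cov : IsCoveringMap ((↑) : ℝ → UnitAddCircle) := AddCircle.isCoveringMap_coe 1
  let G : C(unitInterval × Y, UnitAddCircle) := f.comp H.symm.toContinuousMap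
  have h0 : ∀ y, G (0, y) = ((ContinuousMap.const Y t y : ℝ) : UnitAddCircle) := by
    intro y
    change f (H.symm (0, y)) = _
    rw [ContinuousMap.Homotopy.apply_zero]
    exact ht.symm
  let L := cov.liftHomotopy G (ContinuousMap.const Y t) h0
  refine ⟨L.comp ⟨fun y => (1, y), by fun_prop⟩, fun y => ?_⟩
  have := congrFun (cov.liftHomotopy_lifts G (ContinuousMap.const Y t) h0) (1, y)
  refine this.trans ?_
  change f (H.symm (1, y)) = _
  rw [ContinuousMap.Homotopy.apply_one]
  rfl

theorem exists_cech_lift (hW : IsGoodCover W) {k : ℕ} (φ : Cech W k UnitAddCircle) :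
    ∃ ψ : Cech W k ℝ, cechMap realToCircle continuous_realToCircle ψ = φ := by
  have : ∀ l, ∃ g : C(inter W l, ℝ), ∀ z, realToCircle (g z) = φ l z := by
    intro l
    by_cases h : (inter W l).Nonempty
    · have := hW.contractible k l h
      exact exists_real_lift _
    · have : IsEmpty (inter W l) := ⟨fun z => h ⟨z.1, z.2⟩⟩
      exact ⟨0, fun z => isEmptyElim z⟩
  choose g hg using this
  exact ⟨g, by funext l; ext z; exact hg l z⟩

theorem exists_cech_lift_pi (hW : IsGoodCover W) {k : ℕ} {J : Type}
    (φ : Cech W k (J → UnitAddCircle)) :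
    ∃ ψ : Cech W k (J → ℝ), cechMapPi realToCircle continuous_realToCircle ψ = φ := by
  choose g hg using fun j => exists_cech_lift hW
    (fun l => ⟨fun z => φ l z j, by fun_prop⟩ : Cech W k UnitAddCircle)
  refine ⟨fun l => ⟨fun z j => g j l z, by fun_prop⟩, ?_⟩
  funext l; ext z j
  exact congrArg (fun f : Cech W k UnitAddCircle => f l z) (hg j)

/-- Over a good cover every `ℝ/ℤ`-valued cochain lifts to a real cochain. -/
theorem exists_dr_lift (hW : IsGoodCover W) {k : ℕ} (φ : DR W n UnitAddCircle k) :
    ∃ ψ : DR W n ℝ k, drRT ψ = φ := by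
  obtain ⟨a, ha⟩ := exists_cech_lift hW φ.1
  obtain ⟨b, hb⟩ := exists_cech_lift_pi hW φ.2.1
  obtain ⟨c, hc⟩ := exists_cech_lift_pi hW φ.2.2
  exact ⟨(a, b, c), Prod.ext ha (Prod.ext hb hc)⟩

theorem exists_dr1_lift (hW : IsGoodCover W) {F : Cech W 2 (Fin n → ℤ)}
    (η : DR1 W n UnitAddCircle) : ∃ ζ : DR1 W n ℝ, drRT (drD1 F ζ) = drD1 F η := by
  obtain ⟨a, ha⟩ := exists_cech_lift hW η.1
  obtain ⟨b, hb⟩ := exists_cech_lift_pi hW η.2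
  refine ⟨(a, b), Prod.ext ?_ (Prod.ext ?_ ?_)⟩
  · change cechMap _ _ (cechD 1 a + cupVec F 0 b) = cechD 1 η.1 + cupVec F 0 η.2
    rw [map_add, cechMap_cechD, cechMap_cupVec, ha, hb]
  · change cechMapPi _ _ (cechD 0 b) = cechD 0 η.2
    rw [cechMapPi_cechD, hb]
  · exact map_zero _

theorem continuous_int_of_cast {Y : Type*} [TopologicalSpace Y] {f : Y → ℤ}
    (h : Continuous fun y => (f y : ℝ)) : Continuous f :=
  Int.isClosedEmbedding_coe_real.isEmbedding.continuous_iff.2 h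

theorem realToCircle_eq_zero {t : ℝ} : realToCircle t = 0 ↔ ∃ m : ℤ, (m : ℝ) = t := by
  change ((t : ℝ) : UnitAddCircle) = 0 ↔ _
  rw [AddCircle.coe_eq_zero_iff]
  simp

theorem exists_int_cech {k : ℕ} (ψ : Cech W k ℝ)
    (h : cechMap realToCircle continuous_realToCircle ψ = 0) :
    ∃ χ : Cech W k ℤ, cechMap intToReal continuous_intToReal χ = ψ := by
  have h1 : ∀ l z, ∃ m : ℤ, (m : ℝ) = ψ l z := fun l z =>
    realToCircle_eq_zero.1 (congrArg (fun f : Cech W k UnitAddCircle => f l z) h)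
  choose m hm using h1
  refine ⟨fun l => ⟨m l, continuous_int_of_cast ?_⟩, ?_⟩
  · simp_rw [hm]
    exact (ψ l).continuous
  · funext l; ext z; exact hm l z

theorem exists_int_cech_pi {k : ℕ} {J : Type} (ψ : Cech W k (J → ℝ))
    (h : cechMapPi realToCircle continuous_realToCircle ψ = 0) :
    ∃ χ : Cech W k (J → ℤ), cechMapPi intToReal continuous_intToReal χ = ψ := by
  choose g hg using fun j => exists_int_cech
    (fun l => ⟨fun z => ψ l z j, by fun_prop⟩ : Cech W k ℝ) (by
      funext l; ext z
      exact congrFun (congrArg (fun f : Cech W k (J → UnitAddCircle) => f l z) h) j)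
  refine ⟨fun l => ⟨fun z j => g j l z, by fun_prop⟩, ?_⟩
  funext l; ext z j
  exact congrArg (fun f : Cech W k ℝ => f l z) (hg j)

/-- A real cochain that vanishes modulo `ℤ` is integral. -/
theorem exists_dr_int {k : ℕ} (ψ : DR W n ℝ k) (h : drRT ψ = 0) :
    ∃ χ : DR W n ℤ k, drIR χ = ψ := by
  obtain ⟨a, ha⟩ := exists_int_cech ψ.1 (congrArg Prod.fst h)
  obtain ⟨b, hb⟩ := exists_int_cech_pi ψ.2.1 (congrArg (fun x => x.2.1) h)
  obtain ⟨c, hc⟩ := exists_int_cech_pi ψ.2.2 (congrArg (fun x => x.2.2) h)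
  exact ⟨(a, b, c), Prod.ext ha (Prod.ext hb hc)⟩

theorem drIR_injective {k : ℕ} : Function.Injective (drIR : DR W n ℤ k → DR W n ℝ k) := by
  intro χ χ' h
  refine Prod.ext ?_ (Prod.ext ?_ ?_)
  · funext l; ext z
    have := congrArg (fun x : DR W n ℝ k => x.1 l z) h
    exact Int.cast_injective (α := ℝ) this
  · funext l; ext z j
    have := congrArg (fun x : DR W n ℝ k => x.2.1 l z j) h
    exact Int.cast_injective (α := ℝ) this
  · funext l; ext z j
    have := congrArg (fun x : DR W n ℝ k => x.2.2 l z j) h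
    exact Int.cast_injective (α := ℝ) this

variable {F : Cech W 2 (Fin n → ℤ)}

theorem drRT_drIR {k : ℕ} (χ : DR W n ℤ k) : drRT (drIR χ) = 0 := by
  refine Prod.ext ?_ (Prod.ext ?_ ?_)
  · funext l; ext z; exact realToCircle_eq_zero.2 ⟨_, rfl⟩
  · funext l; ext z j; exact realToCircle_eq_zero.2 ⟨_, rfl⟩
  · funext l; ext z j; exact realToCircle_eq_zero.2 ⟨_, rfl⟩

/-- The zig-zag: `φ` lifts to the real cochain `ψ`, and `D_F ψ` is the image of the integral
cochain `χ`. -/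
def IsZigzag (F : Cech W 2 (Fin n → ℤ)) (φ : DR W n UnitAddCircle 0) (χ : DR W n ℤ 1) : Prop :=
  ∃ ψ : DR W n ℝ 0, drRT ψ = φ ∧ drIR χ = drD F 0 ψ

theorem exists_isZigzag (hW : IsGoodCover W) {φ : DR W n UnitAddCircle 0} (h : drD F 0 φ = 0) :
    ∃ χ, IsZigzag F φ χ := by
  obtain ⟨ψ, hψ⟩ := exists_dr_lift hW φ
  obtain ⟨χ, hχ⟩ := exists_dr_int (drD F 0 ψ) (by rw [drRT, drMap_drD, ← drRT, hψ, h])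
  exact ⟨χ, ψ, hψ, hχ⟩

theorem IsZigzag.closed (hF : cechD 2 F = 0) {φ : DR W n UnitAddCircle 0} {χ : DR W n ℤ 1}
    (h : IsZigzag F φ χ) : drD F 1 χ = 0 := by
  obtain ⟨ψ, -, hχ⟩ := h
  apply drIR_injective
  rw [drIR, drMap_drD, ← drIR, hχ, drD_drD hF, map_zero]

theorem IsZigzag.add {φ φ' : DR W n UnitAddCircle 0} {χ χ' : DR W n ℤ 1}
    (h : IsZigzag F φ χ) (h' : IsZigzag F φ' χ') : IsZigzag F (φ + φ') (χ + χ') := by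
  obtain ⟨ψ, h1, h2⟩ := h
  obtain ⟨ψ', h1', h2'⟩ := h'
  exact ⟨ψ + ψ', by rw [map_add, h1, h1'], by rw [map_add, map_add, h2, h2']⟩

theorem IsZigzag.neg {φ : DR W n UnitAddCircle 0} {χ : DR W n ℤ 1}
    (h : IsZigzag F φ χ) : IsZigzag F (-φ) (-χ) := by
  obtain ⟨ψ, h1, h2⟩ := h
  exact ⟨-ψ, by rw [map_neg, h1], by rw [map_neg, map_neg, h2]⟩

theorem IsZigzag.mem_of_eq_zero {φ : DR W n UnitAddCircle 0} (hφ : φ = 0) {χ : DR W n ℤ 1}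
    (h : IsZigzag F φ χ) : χ ∈ drB F 1 := by
  subst hφ
  obtain ⟨ψ, h1, h2⟩ := h
  obtain ⟨χ', h'⟩ := exists_dr_int ψ h1
  refine ⟨χ', drIR_injective ?_⟩
  rw [h2, drIR, drMap_drD, ← drIR, h']

theorem IsZigzag.mem_of_coboundary (hW : IsGoodCover W) (hF : cechD 2 F = 0)
    {φ : DR W n UnitAddCircle 0} (hφ : φ ∈ drB F 0) {χ : DR W n ℤ 1} (h : IsZigzag F φ χ) :
    χ ∈ drB F 1 := by
  obtain ⟨η, rfl⟩ := hφ
  obtain ⟨ζ, hζ⟩ := exists_dr1_lift hW (F := F) η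
  have h0 : IsZigzag F (drD1 F η) 0 := ⟨drD1 F ζ, hζ, by rw [drD_drD1 hF, map_zero]⟩
  have := h.add h0.neg
  rw [neg_zero, add_zero] at this
  exact this.mem_of_eq_zero (add_neg_cancel _)

/-- The connecting homomorphism on cocycles: the class of an integral cochain obtained from a
zig-zag (it does not depend on the choices). -/
def connectingCocycle (hW : IsGoodCover W) (hF : cechD 2 F = 0) :
    (drD (A := UnitAddCircle) F 0).ker →+ DRH W ℤ F 1 :=
  AddMonoidHom.mk'
    (fun φ => DRH.mk (exists_isZigzag hW φ.2).choose
      ((exists_isZigzag hW φ.2).choose_spec.closed hF))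
    (by
      intro φ φ'
      have h := (exists_isZigzag hW φ.2).choose_spec
      have h' := (exists_isZigzag hW φ'.2).choose_spec
      have h'' := (exists_isZigzag hW (φ + φ').2).choose_spec
      refine QuotientAddGroup.eq.2 ?_
      have := (h''.neg.add (h.add h'))
      exact this.mem_of_eq_zero (neg_add_cancel _))

/-- The connecting homomorphism `ℍ²_F(W, 𝒮) → ℍ³_F(W, ℤ)` of the exact sequence
`0 → ℤ → ℝ → ℝ/ℤ → 0`. -/
def connecting (hW : IsGoodCover W) (hF : cechD 2 F = 0) :
    DRH W UnitAddCircle F 0 →+ DRH W ℤ F 1 :=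
  QuotientAddGroup.lift _ (connectingCocycle hW hF) (by
    intro φ hφ
    have h := (exists_isZigzag hW φ.2).choose_spec
    refine (QuotientAddGroup.eq_zero_iff _).2 ?_
    exact h.mem_of_coboundary hW hF hφ)

/-- Every zig-zag computes the connecting homomorphism. -/
theorem connecting_mk (hW : IsGoodCover W) (hF : cechD 2 F = 0) {φ : DR W n UnitAddCircle 0}
    (hφ : drD F 0 φ = 0) {χ : DR W n ℤ 1} (h : IsZigzag F φ χ) :
    connecting hW hF (DRH.mk φ hφ) = DRH.mk χ (h.closed hF) := by
  have h' := (exists_isZigzag hW (F := F) hφ).choose_spec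
  refine QuotientAddGroup.eq.2 ?_
  have := h'.neg.add h
  exact this.mem_of_eq_zero (neg_add_cancel _)

end Connecting


/-! ## Compact operators -/

section Compacts

variable {H : Type*} [NormedAddCommGroup H] [InnerProductSpace ℂ H] [CompleteSpace H]

theorem isCompactOperator_adjoint {T : H →L[ℂ] H} (hT : IsCompactOperator T) :
    IsCompactOperator (star T : H →L[ℂ] H) := by
  have hTS : IsCompactOperator (T ∘L star T : H →L[ℂ] H) := hT.comp_clm (star T)
  refine (isCompactOperator_iff_isCompact_closure_image_ball
    (star T : H →L[ℂ] H).toLinearMap one_pos).2 ?_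
  refine TotallyBounded.isCompact_of_isClosed (TotallyBounded.closure ?_) isClosed_closure
  have htb : TotallyBounded ((T ∘L star T : H →L[ℂ] H) '' Metric.ball 0 1) :=
    ((IsCompactOperator.isCompact_closure_image_ball
      (f := (T ∘L star T : H →L[ℂ] H).toLinearMap) hTS 1).totallyBounded).subset subset_closure
  rw [Metric.totallyBounded_iff]
  intro ε hε
  obtain ⟨t, hts, htf, hcov⟩ := Metric.finite_approx_of_totallyBounded htb (ε ^ 2 / 2) (by positivity)
  choose! g hg1 hg2 using fun y (hy : y ∈ t) => hts hy
  refine ⟨(fun y => (star T : H →L[ℂ] H) (g y)) '' t, htf.image _, ?_⟩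
  rintro _ ⟨x, hx, rfl⟩
  obtain ⟨y, hy, hxy⟩ := mem_iUnion₂.1 (hcov ⟨x, hx, rfl⟩)
  refine mem_iUnion₂.2 ⟨_, ⟨y, hy, rfl⟩, ?_⟩
  rw [Metric.mem_ball, dist_eq_norm] at hxy ⊢
  have h1 : ‖(T ∘L star T : H →L[ℂ] H) (x - g y)‖ < ε ^ 2 / 2 := by
    rw [map_sub, hg2 y hy]; exact hxy
  have h2 : ‖x - g y‖ ≤ 2 := by
    have a1 : ‖x‖ < 1 := by simpa using hx
    have a2 : ‖g y‖ < 1 := by simpa using hg1 y hy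
    linarith [norm_sub_le x (g y)]
  have h3 : ‖(star T : H →L[ℂ] H) (x - g y)‖ ^ 2 < ε ^ 2 := by
    have e : ‖(star T : H →L[ℂ] H) (x - g y)‖ ^ 2 =
        RCLike.re (inner ℂ ((T ∘L star T : H →L[ℂ] H) (x - g y)) (x - g y)) := by
      rw [ContinuousLinearMap.comp_apply, ContinuousLinearMap.star_eq_adjoint,
        ← ContinuousLinearMap.adjoint_inner_right, inner_self_eq_norm_sq]
    calc _ ≤ ‖(T ∘L star T : H →L[ℂ] H) (x - g y)‖ * ‖x - g y‖ := by
            rw [e]; exact re_inner_le_norm _ _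
      _ ≤ ‖(T ∘L star T : H →L[ℂ] H) (x - g y)‖ * 2 := by gcongr
      _ < _ := by linarith
  change ‖(star T : H →L[ℂ] H) x - (star T : H →L[ℂ] H) (g y)‖ < ε
  rw [← map_sub]
  exact lt_of_pow_lt_pow_left₀ 2 hε.le h3

/-- The C⋆-algebra `𝒦(H)` of compact operators on a Hilbert space. -/
def compacts (H : Type*) [NormedAddCommGroup H] [InnerProductSpace ℂ H] [CompleteSpace H] :
    NonUnitalStarSubalgebra ℂ (H →L[ℂ] H) where
  carrier := {T | IsCompactOperator T}
  zero_mem' := isCompactOperator_zero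
  add_mem' hS hT := hS.add hT
  mul_mem' {_ T} hS _ := hS.comp_clm T
  smul_mem' c _ hT := hT.smul c
  star_mem' hT := isCompactOperator_adjoint hT

theorem mem_compacts {T : H →L[ℂ] H} : T ∈ compacts H ↔ IsCompactOperator T := Iff.rfl

theorem isClosed_compacts : IsClosed (compacts H : Set (H →L[ℂ] H)) :=
  isClosed_setOfPred_isCompactOperator

instance : NonUnitalCStarAlgebra (compacts H) :=
  NonUnitalStarSubalgebra.nonUnitalCStarAlgebra _ (h_closed := isClosed_compacts)

theorem norm_unitary_mul (u : unitary (H →L[ℂ] H)) (T : H →L[ℂ] H) :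
    ‖(u : H →L[ℂ] H) * T‖ = ‖T‖ := CStarRing.norm_coe_unitary_mul u T

theorem norm_mul_unitary (u : unitary (H →L[ℂ] H)) (T : H →L[ℂ] H) :
    ‖T * (u : H →L[ℂ] H)‖ = ‖T‖ := CStarRing.norm_mul_coe_unitary T u

/-- Conjugation `T ↦ u T u⋆` of compact operators by a unitary operator. -/
def conj (u : unitary (H →L[ℂ] H)) (T : compacts H) : compacts H :=
  ⟨u * T * star (u : H →L[ℂ] H),
    (IsCompactOperator.clm_comp (mem_compacts.1 T.2) (u : H →L[ℂ] H)).comp_clm _⟩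

theorem coe_conj (u : unitary (H →L[ℂ] H)) (T : compacts H) :
    (conj u T : H →L[ℂ] H) = u * T * star (u : H →L[ℂ] H) := rfl

theorem norm_conj (u : unitary (H →L[ℂ] H)) (T : compacts H) : ‖conj u T‖ = ‖T‖ := by
  change ‖(u : H →L[ℂ] H) * T * (star u : unitary (H →L[ℂ] H))‖ = ‖(T : H →L[ℂ] H)‖
  rw [norm_mul_unitary, norm_unitary_mul]

theorem conj_mul (u : unitary (H →L[ℂ] H)) (S T : compacts H) :
    conj u (S * T) = conj u S * conj u T := by
  apply Subtype.ext
  change (u : H →L[ℂ] H) * (S * T) * star (u : H →L[ℂ] H) =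
    (u * S * star (u : H →L[ℂ] H)) * (u * T * star (u : H →L[ℂ] H))
  have : star (u : H →L[ℂ] H) * u = 1 := Unitary.coe_star_mul_self u
  calc _ = (u : H →L[ℂ] H) * S * 1 * T * star (u : H →L[ℂ] H) := by
        simp only [mul_assoc, one_mul]
    _ = _ := by rw [← this]; simp only [mul_assoc]

theorem conj_add (u : unitary (H →L[ℂ] H)) (S T : compacts H) :
    conj u (S + T) = conj u S + conj u T := by
  apply Subtype.ext
  change (u : H →L[ℂ] H) * (S + T) * star (u : H →L[ℂ] H) =
    u * S * star (u : H →L[ℂ] H) + u * T * star (u : H →L[ℂ] H)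
  rw [mul_add, add_mul]

theorem conj_smul (u : unitary (H →L[ℂ] H)) (c : ℂ) (T : compacts H) :
    conj u (c • T) = c • conj u T := by
  apply Subtype.ext
  change (u : H →L[ℂ] H) * (c • (T : H →L[ℂ] H)) * star (u : H →L[ℂ] H) =
    c • (u * T * star (u : H →L[ℂ] H))
  rw [mul_smul_comm, smul_mul_assoc]

theorem conj_star (u : unitary (H →L[ℂ] H)) (T : compacts H) :
    conj u (star T) = star (conj u T) := by
  apply Subtype.ext
  change (u : H →L[ℂ] H) * star (T : H →L[ℂ] H) * star (u : H →L[ℂ] H) =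
    star ((u : H →L[ℂ] H) * (T : H →L[ℂ] H) * star (u : H →L[ℂ] H))
  simp [mul_assoc]

theorem conj_conj (u v : unitary (H →L[ℂ] H)) (T : compacts H) :
    conj u (conj v T) = conj (u * v) T := by
  apply Subtype.ext
  change (u : H →L[ℂ] H) * ((v : H →L[ℂ] H) * (T : H →L[ℂ] H) * star (v : H →L[ℂ] H)) *
    star (u : H →L[ℂ] H) = ((u : H →L[ℂ] H) * (v : H →L[ℂ] H)) * (T : H →L[ℂ] H) *
    star ((u : H →L[ℂ] H) * v)
  simp [mul_assoc]

/-- Conjugation does not see a scalar of modulus one. -/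
theorem conj_eq_of_smul {u v : unitary (H →L[ℂ] H)} {c : ℂ} (hc : c * star c = 1)
    (h : (u : H →L[ℂ] H) = c • (v : H →L[ℂ] H)) (T : compacts H) : conj u T = conj v T := by
  apply Subtype.ext
  rw [coe_conj, coe_conj, h, star_smul, smul_mul_assoc, smul_mul_assoc, mul_smul_comm, smul_smul,
    hc, one_smul]

theorem conj_one (T : compacts H) : conj 1 T = T := by
  apply Subtype.ext
  simp [coe_conj]

/-- If `w` tends strongly to the identity then `w S` tends to `S` in norm for compact `S`. -/
theorem tendsto_mul_compact {Y : Type*} {l : Filter Y} {w : Y → unitary (H →L[ℂ] H)}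
    (hw : ∀ ξ, Tendsto (fun y => (w y : H →L[ℂ] H) ξ) l (𝓝 ξ)) {S : H →L[ℂ] H}
    (hS : IsCompactOperator S) : Tendsto (fun y => (w y : H →L[ℂ] H) * S) l (𝓝 S) := by
  rw [Metric.tendsto_nhds]
  intro ε hε
  have htb : TotallyBounded (S '' Metric.closedBall 0 1) :=
    ((IsCompactOperator.isCompact_closure_image_closedBall (f := S.toLinearMap) hS
      1).totallyBounded).subset subset_closure
  obtain ⟨t, htf, hcov⟩ := Metric.totallyBounded_iff.1 htb (ε / 6) (by positivity)
  have h1 : ∀ᶠ y in l, ∀ c ∈ t, dist ((w y : H →L[ℂ] H) c) c < ε / 6 :=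
    (htf.eventually_all).2 fun c _ => (Metric.tendsto_nhds.1 (hw c)) _ (by positivity)
  filter_upwards [h1] with y hy
  rw [dist_eq_norm]
  refine lt_of_le_of_lt (ContinuousLinearMap.opNorm_le_of_unit_norm (C := ε / 2)
    (by positivity) ?_) (by linarith)
  intro x hx
  obtain ⟨c, hc, hxc⟩ := mem_iUnion₂.1 (hcov ⟨x, by simp [hx], rfl⟩)
  rw [Metric.mem_ball, dist_eq_norm] at hxc
  have h2 := hy c hc
  rw [dist_eq_norm] at h2
  have h3 : ‖(w y : H →L[ℂ] H) (S x - c)‖ = ‖S x - c‖ :=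
    (Unitary.linearIsometryEquiv (w y)).norm_map _
  have e : ((w y : H →L[ℂ] H) * S - S) x =
      (w y : H →L[ℂ] H) (S x - c) + ((w y : H →L[ℂ] H) c - c) - (S x - c) := by
    simp only [sub_apply, mul_apply_eq_comp, map_sub]
    abel
  rw [e]
  have := norm_sub_le ((w y : H →L[ℂ] H) (S x - c) + ((w y : H →L[ℂ] H) c - c)) (S x - c)
  have := norm_add_le ((w y : H →L[ℂ] H) (S x - c)) ((w y : H →L[ℂ] H) c - c)
  linarith

/-- Conjugation is jointly continuous for the strong topology on unitary operators and the norm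
topology on compact operators. -/
theorem continuous_conj {Y : Type*} [TopologicalSpace Y] {u : Y → unitary (H →L[ℂ] H)}
    (hu : ∀ ξ, Continuous fun y => (u y : H →L[ℂ] H) ξ) {T : Y → compacts H} (hT : Continuous T) :
    Continuous fun y => conj (u y) (T y) := by
  rw [continuous_iff_continuousAt]
  intro y₀
  rw [ContinuousAt, tendsto_iff_norm_sub_tendsto_zero]
  have hw : ∀ ξ, Tendsto (fun y => ((star (u y₀) * u y : unitary (H →L[ℂ] H)) : H →L[ℂ] H) ξ)
      (𝓝 y₀) (𝓝 ξ) := by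
    intro ξ
    have h1 := ((star (u y₀ : H →L[ℂ] H)).continuous.comp (hu ξ)).tendsto y₀
    have h2 : (star (u y₀ : H →L[ℂ] H)) ((u y₀ : H →L[ℂ] H) ξ) = ξ := by
      rw [← mul_apply_eq_comp, Unitary.coe_star_mul_self]; rfl
    change Tendsto _ _ (𝓝 ((star (u y₀ : H →L[ℂ] H)) ((u y₀ : H →L[ℂ] H) ξ))) at h1
    rw [h2] at h1
    exact h1
  have c1 := tendsto_mul_compact hw (T y₀).2
  have c2 := (tendsto_mul_compact hw (star (T y₀)).2).star
  have c3 : Tendsto (fun y => ‖T y - T y₀‖) (𝓝 y₀) (𝓝 0) :=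
    tendsto_iff_norm_sub_tendsto_zero.1 (hT.tendsto y₀)
  rw [tendsto_iff_norm_sub_tendsto_zero] at c1 c2
  have c := c3.add (c1.add c2)
  rw [add_zero, add_zero] at c
  refine squeeze_zero (fun _ => norm_nonneg _) (fun y => ?_)
    c
  set w : unitary (H →L[ℂ] H) := star (u y₀) * u y with hwdef
  have huw : u y = u y₀ * w := by
    rw [hwdef, ← mul_assoc, Unitary.mul_star_self, one_mul]
  have e1 : ‖conj (u y) (T y₀) - conj (u y₀) (T y₀)‖ = ‖conj w (T y₀) - T y₀‖ := by
    have : conj (u y) (T y₀) - conj (u y₀) (T y₀) = conj (u y₀) (conj w (T y₀) - T y₀) := by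
      rw [huw, ← conj_conj, sub_eq_add_neg, sub_eq_add_neg, conj_add]
      congr 1
      simpa using (conj_smul (u y₀) (-1) (T y₀)).symm
    rw [this, norm_conj]
  have e2 : ‖conj (u y) (T y) - conj (u y) (T y₀)‖ = ‖T y - T y₀‖ := by
    have : conj (u y) (T y) - conj (u y) (T y₀) = conj (u y) (T y - T y₀) := by
      rw [sub_eq_add_neg, sub_eq_add_neg, conj_add]
      congr 1
      simpa using (conj_smul (u y) (-1) (T y₀)).symm
    rw [this, norm_conj]
  have e3 : ‖conj w (T y₀) - T y₀‖ ≤ ‖(w : H →L[ℂ] H) * (T y₀ : H →L[ℂ] H) - T y₀‖ +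
      ‖star ((w : H →L[ℂ] H) * ((star (T y₀) : compacts H) : H →L[ℂ] H)) -
        star ((star (T y₀) : compacts H) : H →L[ℂ] H)‖ := by
    change ‖(w : H →L[ℂ] H) * (T y₀ : H →L[ℂ] H) * star (w : H →L[ℂ] H) - T y₀‖ ≤ _
    have s1 : ((star (T y₀) : compacts H) : H →L[ℂ] H) = star (T y₀ : H →L[ℂ] H) := rfl
    rw [s1, star_mul, star_star]
    have s2 : (w : H →L[ℂ] H) * (T y₀ : H →L[ℂ] H) * star (w : H →L[ℂ] H) - T y₀ =
      ((w : H →L[ℂ] H) * (T y₀ : H →L[ℂ] H) - T y₀) * (star w : unitary (H →L[ℂ] H)) +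
        ((T y₀ : H →L[ℂ] H) * star (w : H →L[ℂ] H) - T y₀) := by
      rw [Unitary.coe_star, sub_mul]; abel
    rw [s2]
    refine (norm_add_le _ _).trans ?_
    rw [norm_mul_unitary]
  calc _ = ‖(conj (u y) (T y) - conj (u y) (T y₀)) +
        (conj (u y) (T y₀) - conj (u y₀) (T y₀))‖ := by rw [sub_add_sub_cancel]
    _ ≤ ‖conj (u y) (T y) - conj (u y) (T y₀)‖ +
        ‖conj (u y) (T y₀) - conj (u y₀) (T y₀)‖ := norm_add_le _ _
    _ ≤ _ := by rw [e1, e2]; gcongr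

end Compacts


/-! ## The operators `L_g̃(s)` on `L²(ℝⁿ)` -/

section LOp

/-- The group `ℝⁿ`. -/
abbrev Rn (n : ℕ) : Type := Fin n → ℝ

/-- The inclusion `ℤⁿ → ℝⁿ`. -/
def latt {n : ℕ} (m : Fin n → ℤ) : Rn n := fun i => (m i : ℝ)

/-- The Hilbert space `L²(ℝⁿ)`. -/
abbrev HSp (n : ℕ) : Type := Lp ℂ 2 (volume : Measure (Rn n))

/-- The C⋆-algebra `𝒦` of compact operators on `L²(ℝⁿ)`. -/
def KK (n : ℕ) : Type := compacts (HSp n)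

instance (n : ℕ) : NonUnitalCStarAlgebra (KK n) :=
  inferInstanceAs (NonUnitalCStarAlgebra (compacts (HSp n)))

/-- The bounded operators on `L²(ℝⁿ)`. -/
abbrev BB (n : ℕ) : Type := HSp n →L[ℂ] HSp n

/-- A compact operator as a bounded operator. -/
def KK.op {n : ℕ} (T : KK n) : BB n := Subtype.val (p := fun T => T ∈ compacts (HSp n)) T

/-- The unitary operators on `L²(ℝⁿ)`. -/
abbrev UU (n : ℕ) : Type := unitary (BB n)

/-- Conjugation `T ↦ u T u⋆` of compact operators on `L²(ℝⁿ)` by a unitary operator. -/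
def conjK {n : ℕ} (u : UU n) (T : KK n) : KK n := conj u T

theorem op_conjK {n : ℕ} (u : UU n) (T : KK n) :
    (conjK u T).op = (u : BB n) * T.op * star (u : BB n) := rfl

theorem norm_conjK {n : ℕ} (u : UU n) (T : KK n) : ‖conjK u T‖ = ‖T‖ := norm_conj u T

theorem conjK_mul {n : ℕ} (u : UU n) (S T : KK n) : conjK u (S * T) = conjK u S * conjK u T :=
  conj_mul u S T

theorem conjK_add {n : ℕ} (u : UU n) (S T : KK n) : conjK u (S + T) = conjK u S + conjK u T :=
  conj_add u S T

theorem conjK_smul {n : ℕ} (u : UU n) (c : ℂ) (T : KK n) : conjK u (c • T) = c • conjK u T :=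
  conj_smul u c T

theorem conjK_star {n : ℕ} (u : UU n) (T : KK n) : conjK u (star T) = star (conjK u T) :=
  conj_star u T

theorem conjK_conjK {n : ℕ} (u v : UU n) (T : KK n) : conjK u (conjK v T) = conjK (u * v) T :=
  conj_conj u v T

theorem conjK_one {n : ℕ} (T : KK n) : conjK 1 T = T := conj_one T

theorem conjK_eq_of_smul {n : ℕ} {u v : UU n} {c : ℂ} (hc : c * star c = 1)
    (h : (u : BB n) = c • (v : BB n)) (T : KK n) : conjK u T = conjK v T :=
  conj_eq_of_smul hc h T

theorem continuous_conjK {n : ℕ} {Y : Type*} [TopologicalSpace Y] {u : Y → UU n}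
    (hu : ∀ ξ, Continuous fun y => (u y : BB n) ξ) {T : Y → KK n} (hT : Continuous T) :
    Continuous fun y => conjK (u y) (T y) := continuous_conj hu hT

variable {n : ℕ}

theorem memLp_phase {θ : Rn n → Circle} (hθ : Continuous θ) (ξ : HSp n) :
    MemLp (fun t => (θ t : ℂ) * ξ t) 2 volume := by
  refine (Lp.memLp ξ).congr_norm ?_ (Eventually.of_forall fun t => by
    rw [norm_mul, Circle.norm_coe, one_mul])
  exact (continuous_subtype_val.comp hθ).aestronglyMeasurable.mul (Lp.aestronglyMeasurable ξ)

/-- Multiplication by a continuous function of modulus one. -/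
def phaseLI (θ : C(Rn n, Circle)) : HSp n →ₗᵢ[ℂ] HSp n where
  toFun ξ := (memLp_phase θ.continuous ξ).toLp _
  map_add' ξ η := by
    apply Lp.ext
    filter_upwards [(memLp_phase θ.continuous (ξ + η)).coeFn_toLp,
      (memLp_phase θ.continuous ξ).coeFn_toLp, (memLp_phase θ.continuous η).coeFn_toLp,
      Lp.coeFn_add ξ η, Lp.coeFn_add ((memLp_phase θ.continuous ξ).toLp _)
        ((memLp_phase θ.continuous η).toLp _)] with t h1 h2 h3 h4 h5
    rw [h1, h5, Pi.add_apply, h2, h3, h4, Pi.add_apply, mul_add]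
  map_smul' c ξ := by
    apply Lp.ext
    filter_upwards [(memLp_phase θ.continuous (c • ξ)).coeFn_toLp,
      (memLp_phase θ.continuous ξ).coeFn_toLp,
      Lp.coeFn_smul c ξ, Lp.coeFn_smul c ((memLp_phase θ.continuous ξ).toLp _)] with t h1 h2 h3 h4
    rw [RingHom.id_apply, h1, h4, Pi.smul_apply, h2, h3, Pi.smul_apply, smul_eq_mul, smul_eq_mul]
    ring
  norm_map' ξ := by
    change ‖(memLp_phase θ.continuous ξ).toLp _‖ = ‖ξ‖
    rw [Lp.norm_toLp, Lp.norm_def]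
    congr 1
    exact eLpNorm_congr_norm_ae (Eventually.of_forall fun t => by
      rw [norm_mul, Circle.norm_coe, one_mul])

theorem phaseLI_ae (θ : C(Rn n, Circle)) (ξ : HSp n) :
    (phaseLI θ ξ : Rn n → ℂ) =ᵐ[volume] fun t => (θ t : ℂ) * ξ t :=
  (memLp_phase θ.continuous ξ).coeFn_toLp

theorem phaseLI_surjective (θ : C(Rn n, Circle)) : Function.Surjective (phaseLI θ) := by
  intro η
  refine ⟨phaseLI ⟨fun t => (θ t)⁻¹, by fun_prop⟩ η, ?_⟩
  apply Lp.ext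
  filter_upwards [phaseLI_ae θ (phaseLI ⟨fun t => (θ t)⁻¹, by fun_prop⟩ η),
    phaseLI_ae ⟨fun t => (θ t)⁻¹, by fun_prop⟩ η] with t h1 h2
  rw [h1, h2]
  change (θ t : ℂ) * (((θ t)⁻¹ : Circle) * η t) = η t
  rw [Circle.coe_inv, mul_inv_cancel_left₀ (Circle.coe_ne_zero _)]

/-- Translation `ξ ↦ ξ(· - s)`. -/
def transLI (s : Rn n) : HSp n →ₗᵢ[ℂ] HSp n :=
  Lp.compMeasurePreservingₗᵢ ℂ (fun t => t - s) (measurePreserving_sub_right volume s)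

theorem transLI_ae (s : Rn n) (ξ : HSp n) :
    (transLI s ξ : Rn n → ℂ) =ᵐ[volume] fun t => ξ (t - s) :=
  Lp.coeFn_compMeasurePreserving ξ (measurePreserving_sub_right volume s)

theorem transLI_surjective (s : Rn n) : Function.Surjective (transLI s) := by
  intro η
  refine ⟨transLI (-s) η, ?_⟩
  apply Lp.ext
  have h2 := (measurePreserving_sub_right (volume : Measure (Rn n)) s).quasiMeasurePreserving.ae_eq_comp
    (transLI_ae (-s) η)
  filter_upwards [transLI_ae s (transLI (-s) η), h2] with t h1 h2
  rw [h1]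
  simpa using h2

/-- The cocycle `g̃(s, t) = [∑_{i<j} g_ij t_i s_j]`, for a fixed matrix `g`. -/
def gTilde (g : Pairs n → ℝ) (s t : Rn n) : UnitAddCircle :=
  ((∑ p : Pairs n, g p * t p.1.1 * s p.1.2 : ℝ) : UnitAddCircle)

/-- The character `ℝ/ℤ → U(1)`, `[t] ↦ exp(2πit)`. -/
def ee (θ : UnitAddCircle) : Circle := AddCircle.toCircle θ

theorem continuous_ee : Continuous ee := AddCircle.continuous_toCircle

theorem ee_add (a b : UnitAddCircle) : ee (a + b) = ee a * ee b := AddCircle.toCircle_add a b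

theorem continuous_gTilde :
    Continuous fun x : (Pairs n → ℝ) × Rn n × Rn n => gTilde x.1 x.2.1 x.2.2 := by
  refine continuous_realToCircle.comp ?_
  fun_prop

theorem gTilde_cocycle (g : Pairs n → ℝ) (s t r : Rn n) :
    gTilde g s (r - s) + gTilde g t (r - s - t) =
      gTilde g s t + gTilde g (s + t) (r - (s + t)) := by
  unfold gTilde
  rw [← AddCircle.coe_add, ← AddCircle.coe_add, ← Finset.sum_add_distrib,
    ← Finset.sum_add_distrib]
  congr 1
  refine Finset.sum_congr rfl fun p _ => ?_
  simp only [Pi.add_apply, Pi.sub_apply]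
  ring

/-- The phase `t ↦ g̃(s, t - s)`. -/
def lPhase (g : Pairs n → ℝ) (s : Rn n) : C(Rn n, Circle) :=
  ⟨fun t => ee (gTilde g s (t - s)), continuous_ee.comp
    (continuous_gTilde.comp (by fun_prop : Continuous fun t : Rn n => (g, s, t - s)))⟩

/-- The unitary operator `L_g̃(s)` on `L²(ℝⁿ)`:
`(L_g̃(s) ξ)(t) = g̃(s, t - s) ξ(t - s)`. -/
def lOp (g : Pairs n → ℝ) (s : Rn n) : UU n :=
  Unitary.linearIsometryEquiv.symm
    (LinearIsometryEquiv.ofSurjective ((phaseLI (lPhase g s)).comp (transLI s))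
      ((phaseLI_surjective _).comp (transLI_surjective s)))

theorem lOp_apply (g : Pairs n → ℝ) (s : Rn n) (ξ : HSp n) :
    (lOp g s : HSp n →L[ℂ] HSp n) ξ = phaseLI (lPhase g s) (transLI s ξ) := rfl

theorem lOp_ae (g : Pairs n → ℝ) (s : Rn n) (ξ : HSp n) :
    ((lOp g s : HSp n →L[ℂ] HSp n) ξ : Rn n → ℂ) =ᵐ[volume]
      fun t => (ee (gTilde g s (t - s)) : ℂ) * ξ (t - s) := by
  rw [lOp_apply]
  filter_upwards [phaseLI_ae (lPhase g s) (transLI s ξ), transLI_ae s ξ] with t h1 h2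
  rw [h1, h2]
  rfl

theorem lOp_mul (g : Pairs n → ℝ) (s t : Rn n) :
    ((lOp g s * lOp g t : UU n) : HSp n →L[ℂ] HSp n) =
      (ee (gTilde g s t) : ℂ) • (lOp g (s + t) : HSp n →L[ℂ] HSp n) := by
  ext1 ξ
  apply Lp.ext
  have h2 := (measurePreserving_sub_right (volume : Measure (Rn n)) s).quasiMeasurePreserving.ae_eq_comp
    (lOp_ae g t ξ)
  filter_upwards [lOp_ae g s ((lOp g t : HSp n →L[ℂ] HSp n) ξ), h2, lOp_ae g (s + t) ξ,
    Lp.coeFn_smul (ee (gTilde g s t) : ℂ) ((lOp g (s + t) : HSp n →L[ℂ] HSp n) ξ)]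
    with r h1 h2 h3 h4
  refine h1.trans ?_
  refine Eq.trans ?_ h4.symm
  simp only [Function.comp_apply] at h2
  rw [h2, Pi.smul_apply, h3, smul_eq_mul, ← mul_assoc, ← mul_assoc, ← Circle.coe_mul,
    ← Circle.coe_mul, ← ee_add, ← ee_add, gTilde_cocycle, sub_sub]

theorem lOp_zero (g : Pairs n → ℝ) : lOp g 0 = 1 := by
  apply Subtype.ext
  ext1 ξ
  apply Lp.ext
  filter_upwards [lOp_ae g 0 ξ] with t h
  refine h.trans ?_
  simp [gTilde, ee]

theorem continuous_phase {Y : Type*} [TopologicalSpace Y] [FirstCountableTopology Y]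
    {θ : Y → C(Rn n, Circle)} (hθ : ∀ t, Continuous fun y => θ y t) (ξ : HSp n) :
    Continuous fun y => phaseLI (θ y) ξ := by
  rw [continuous_iff_continuousAt]
  intro y₀
  rw [ContinuousAt, tendsto_iff_norm_sub_tendsto_zero]
  have key : Tendsto (fun y => inner ℂ (phaseLI (θ y) ξ) (phaseLI (θ y₀) ξ)) (𝓝 y₀)
      (𝓝 (inner ℂ ξ ξ)) := by
    have e : ∀ y, inner ℂ (phaseLI (θ y) ξ) (phaseLI (θ y₀) ξ) =
        ∫ t, inner ℂ ((θ y t : ℂ) * ξ t) ((θ y₀ t : ℂ) * ξ t) := fun y => by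
      rw [L2.inner_def]
      refine integral_congr_ae ?_
      filter_upwards [phaseLI_ae (θ y) ξ, phaseLI_ae (θ y₀) ξ] with t h1 h2
      rw [h1, h2]
    rw [← (phaseLI (θ y₀)).inner_map_map ξ ξ]
    simp_rw [e]
    refine tendsto_integral_filter_of_dominated_convergence (fun t => ‖ξ t‖ ^ 2) ?_ ?_ ?_ ?_
    · refine Eventually.of_forall fun y => ?_
      exact (memLp_phase (θ y).continuous ξ).aestronglyMeasurable.inner
        (memLp_phase (θ y₀).continuous ξ).aestronglyMeasurable
    · refine Eventually.of_forall fun y => Eventually.of_forall fun t => ?_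
      refine (norm_inner_le_norm _ _).trans ?_
      rw [norm_mul, norm_mul, Circle.norm_coe, Circle.norm_coe, one_mul, sq]
    · exact (memLp_two_iff_integrable_sq_norm (Lp.aestronglyMeasurable ξ)).1 (Lp.memLp ξ)
    · refine Eventually.of_forall fun t => ?_
      exact ((((continuous_subtype_val.comp (hθ t)).mul continuous_const).inner
        continuous_const).tendsto y₀)
  have h2 : Tendsto (fun y => ‖phaseLI (θ y) ξ - phaseLI (θ y₀) ξ‖ ^ 2) (𝓝 y₀) (𝓝 0) := by
    have h3 : ∀ y, ‖phaseLI (θ y) ξ - phaseLI (θ y₀) ξ‖ ^ 2 = ‖ξ‖ ^ 2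
        - 2 * RCLike.re (inner ℂ (phaseLI (θ y) ξ) (phaseLI (θ y₀) ξ)) + ‖ξ‖ ^ 2 := by
      intro y
      rw [@norm_sub_sq ℂ, LinearIsometry.norm_map, LinearIsometry.norm_map]
    simp_rw [h3]
    have h4 := ((RCLike.continuous_re.tendsto _).comp key).const_mul 2
    have h5 := (tendsto_const_nhds (x := ‖ξ‖ ^ 2)).sub h4 |>.add_const (‖ξ‖ ^ 2)
    have h7 : ‖ξ‖ ^ 2 - 2 * RCLike.re (inner ℂ ξ ξ) + ‖ξ‖ ^ 2 = 0 := by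
      rw [inner_self_eq_norm_sq]
      ring
    rw [h7] at h5
    exact h5
  have h6 := (Real.continuous_sqrt.tendsto 0).comp h2
  rw [Real.sqrt_zero] at h6
  refine h6.congr fun y => ?_
  simp [Real.sqrt_sq]

/-- The operators `L_g̃(s)` depend strongly continuously on `g` and `s`. -/
theorem continuous_lOp (ξ : HSp n) :
    Continuous fun x : (Pairs n → ℝ) × Rn n => (lOp x.1 x.2 : HSp n →L[ℂ] HSp n) ξ := by
  have ht : Continuous fun s : Rn n => transLI s ξ := by
    have hc : Continuous fun s : Rn n => (⟨fun t => t - s, by fun_prop⟩ : C(Rn n, Rn n)) :=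
      ContinuousMap.continuous_of_continuous_uncurry _
        (by fun_prop : Continuous fun x : Rn n × Rn n => x.2 - x.1)
    exact Continuous.compMeasurePreservingLp (continuous_const (y := ξ)) hc
      (fun s => measurePreserving_sub_right volume s) (by simp)
  rw [continuous_iff_continuousAt]
  intro x₀
  rw [ContinuousAt, tendsto_iff_norm_sub_tendsto_zero]
  have hθ : ∀ t, Continuous fun x : (Pairs n → ℝ) × Rn n => lPhase x.1 x.2 t := fun t =>
    continuous_ee.comp (continuous_gTilde.comp
      (by fun_prop : Continuous fun x : (Pairs n → ℝ) × Rn n => (x.1, x.2, t - x.2)))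
  have h1 := tendsto_iff_norm_sub_tendsto_zero.1
    ((continuous_phase hθ (transLI x₀.2 ξ)).tendsto x₀)
  have h2 := tendsto_iff_norm_sub_tendsto_zero.1
    ((ht.comp continuous_snd).tendsto x₀)
  have h3 := h2.add h1
  rw [add_zero] at h3
  refine squeeze_zero (fun _ => norm_nonneg _) (fun x => ?_) h3
  rw [lOp_apply, lOp_apply, ← sub_add_sub_cancel _ (phaseLI (lPhase x.1 x.2) (transLI x₀.2 ξ))]
  refine (norm_add_le _ _).trans (add_le_add_left (le_of_eq ?_) _)
  rw [← map_sub, LinearIsometry.norm_map]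
  rfl

theorem continuous_lOp_comp {Y : Type*} [TopologicalSpace Y] {f : Y → Pairs n → ℝ} {s : Y → Rn n}
    (hf : Continuous f) (hs : Continuous s) (ξ : HSp n) :
    Continuous fun y => (lOp (f y) (s y) : BB n) ξ :=
  Continuous.comp (g := fun x : (Pairs n → ℝ) × Rn n => (lOp x.1 x.2 : BB n) ξ)
    (f := fun y => (f y, s y)) (continuous_lOp ξ) (hf.prodMk hs)

end LOp

/-! ## Principal torus bundles and the standard setup -/

section Setup

/-- A principal `ℝⁿ/ℤⁿ`-bundle `π : X → Z`, where `X` and `Z` are locally compact Hausdorff and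
`ℝⁿ` acts continuously on `X` through `ℝⁿ/ℤⁿ`: the fibres of `π` are the orbits, all stabilisers
are equal to `ℤⁿ`, and there are continuous local sections. (As `ℝⁿ/ℤⁿ` is compact, the continuous
bijection `V × ℝⁿ/ℤⁿ → π⁻¹(V)` given by a section over an open set `V` is then a
homeomorphism.) -/
structure IsPrincipalTorusBundle (n : ℕ) {X : Type u} {Z : Type v} [TopologicalSpace X]
    [TopologicalSpace Z] [AddAction (Rn n) X] (π : X → Z) : Prop where
  continuous : Continuous π
  fiber : ∀ x y, π x = π y ↔ ∃ s : Rn n, s +ᵥ x = y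
  stabilizer : ∀ (s : Rn n) (x : X), s +ᵥ x = x ↔ ∃ m : Fin n → ℤ, s = latt m
  localSection : ∀ z, ∃ V : Set Z, IsOpen V ∧ z ∈ V ∧ ∃ σ : C(V, X), ∀ y : V, π (σ y) = y

variable {n : ℕ} {X : Type u} {Z : Type v} {I : Type w} [TopologicalSpace X]
  [TopologicalSpace Z] [AddAction (Rn n) X]

/-- The standard setup over a principal `ℝⁿ/ℤⁿ`-bundle `π : X → Z`: a good open cover `U` of `X`
whose image `π(U)` is a good open cover of `Z`, local sections `σ_l : π(U_l) → U_l`, and a Čech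
cochain `s` on `π(U)` with values in `ℝⁿ` such that `s_{lm}(z) · σ_m(z) = σ_l(z)` and
`s_{ll} = 0`. -/
structure StandardSetup (n : ℕ) {X : Type u} {Z : Type v} [TopologicalSpace X]
    [TopologicalSpace Z] [AddAction (Rn n) X] (π : X → Z) (I : Type w) where
  /-- the cover of `X` -/
  U : I → Set X
  bundle : IsPrincipalTorusBundle n π
  goodX : IsGoodCover U
  goodZ : IsGoodCover fun i => π '' U i
  /-- the local sections -/
  σ : ∀ i, C(π '' U i, U i)
  π_σ : ∀ i z, π (σ i z) = z
  /-- the transition cochain -/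
  s : Cech (fun i => π '' U i) 1 (Rn n)
  s_vadd : ∀ l z, s l z +ᵥ (σ (l 1) (proj _ l 1 z) : X) = σ (l 0) (proj _ l 0 z)
  s_diag : ∀ i z, s ![i, i] z = 0

namespace StandardSetup

variable {π : X → Z} (S : StandardSetup n π I)

/-- The good cover `π(U)` of `Z`. -/
abbrev W (i : I) : Set Z := π '' S.U i

theorem exists_int (l : Fin 3 → I) (z : inter S.W l) :
    ∃ m : Fin n → ℤ, cechD 1 S.s l z = latt m := by
  refine (S.bundle.stabilizer _ (S.σ (l 2) (proj _ l 2 z) : X)).1 ?_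
  have h12 : pull S.s l (Fin.succAbove 0) z +ᵥ (S.σ (l 2) (proj _ l 2 z) : X) =
    S.σ (l 1) (proj _ l 1 z) := S.s_vadd _ _
  have h02 : pull S.s l (Fin.succAbove 1) z +ᵥ (S.σ (l 2) (proj _ l 2 z) : X) =
    S.σ (l 0) (proj _ l 0 z) := S.s_vadd _ _
  have h01 : pull S.s l (Fin.succAbove 2) z +ᵥ (S.σ (l 1) (proj _ l 1 z) : X) =
    S.σ (l 0) (proj _ l 0 z) := S.s_vadd _ _
  have e : cechD 1 S.s l z = -pull S.s l (Fin.succAbove 1) z +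
      (pull S.s l (Fin.succAbove 2) z + pull S.s l (Fin.succAbove 0) z) := by
    have e0 : cechD 1 S.s l = ∑ j : Fin 3, ((-1 : ℤ) ^ (j : ℕ)) • pull S.s l j.succAbove := rfl
    rw [e0, Fin.sum_univ_three, ContinuousMap.add_apply, ContinuousMap.add_apply,
      ContinuousMap.smul_apply, ContinuousMap.smul_apply, ContinuousMap.smul_apply]
    change (-1 : ℤ) ^ 0 • _ + (-1 : ℤ) ^ 1 • _ + (-1 : ℤ) ^ 2 • _ = _
    rw [pow_zero, pow_one, one_smul, neg_one_sq, one_smul, neg_one_smul]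
    abel
  rw [e, add_vadd, add_vadd, h12, h01, ← h02, neg_vadd_vadd]

/-- The Čech coboundary `F = ∂̌s`; it takes values in `ℤⁿ`. -/
def F : Cech S.W 2 (Fin n → ℤ) := fun l =>
  ⟨fun z => (S.exists_int l z).choose, continuous_pi fun i => continuous_int_of_cast (by
    have h : (fun z => (((S.exists_int l z).choose i : ℤ) : ℝ)) = fun z => cechD 1 S.s l z i :=
      funext fun z => (congrFun (S.exists_int l z).choose_spec i).symm
    rw [h]
    fun_prop)⟩

theorem latt_F (l : Fin 3 → I) (z : inter S.W l) : latt (S.F l z) = cechD 1 S.s l z :=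
  (S.exists_int l z).choose_spec.symm

theorem F_closed : cechD 2 S.F = 0 := by
  have h := cechD_cechD_one S.s
  have h1 : cechMapPi intToReal continuous_intToReal S.F = cechD 1 S.s := by
    funext l
    exact ContinuousMap.ext fun z => S.latt_F l z
  rw [← h1, ← cechMapPi_cechD] at h
  funext l
  ext z i
  exact Int.cast_injective (α := ℝ)
    ((congrArg (fun f : Cech S.W 3 (Fin n → ℝ) => f l z i) h).trans Int.cast_zero.symm)

end StandardSetup

end Setup

/-! ## Continuous trace algebras and the equivariant Brauer group -/

section Brauer

variable {n : ℕ} {X : Type u} [TopologicalSpace X]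

/-- `A`, with its action of `C_b(X)`, is a (stable) continuous trace C⋆-algebra with spectrum `X`:
it is `C_0(X)`-isomorphic to the algebra `Γ_0(E, X)` of continuous sections vanishing at infinity of
a locally trivial bundle `E` over `X` with fibre `𝒦` and structure group `Aut 𝒦`. The isomorphism
is given by the evaluation maps; a section is represented by its values in the preferred charts.
(An action by isometries is jointly continuous if and only if it is continuous for the point-norm
topology. When `X` is second countable, such an algebra is separable.) -/
def IsContinuousTrace (n : ℕ) (X : Type u) [TopologicalSpace X] (A : Type u)
    [NonUnitalCStarAlgebra A] [Module (X →ᵇ ℂ) A] : Prop :=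
  ∃ (ι : Type u) (E : FiberBundleCore ι X (KK n)),
    (∀ i j x, x ∈ E.baseSet i ∩ E.baseSet j →
      ∃ ψ : KK n ≃⋆ₐ[ℂ] KK n, ∀ T, E.coordChange i j x T = ψ T) ∧
    ∃ ev : A →⋆ₙₐ[ℂ] (X → KK n), Function.Injective ev ∧
      (∀ (f : X →ᵇ ℂ) a x, ev (f • a) x = f x • ev a x) ∧
      Set.range ev = {h | Continuous (fun x => (⟨x, h x⟩ : E.TotalSpace)) ∧
        Tendsto (fun x => ‖h x‖) (cocompact X) (𝓝 0)}

variable [AddAction (Rn n) X] [ContinuousVAdd (Rn n) X]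

/-- The action on `C_b(X)`: `τ_s(f)(x) = f(-s · x)`. -/
def transFun (s : Rn n) (f : X →ᵇ ℂ) : X →ᵇ ℂ :=
  f.compContinuous ⟨fun x => -s +ᵥ x, continuous_const_vadd _⟩

/-- The objects of `𝔅𝔯_{ℝⁿ}(X)`: continuous trace C⋆-algebras with spectrum `X` together with a
strongly continuous action of `ℝⁿ` that preserves the given action on `X`. -/
structure BrObj (n : ℕ) (X : Type u) [TopologicalSpace X] [AddAction (Rn n) X]
    [ContinuousVAdd (Rn n) X] where
  /-- the algebra -/
  A : Type u
  [cstar : NonUnitalCStarAlgebra A]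
  [module : Module (X →ᵇ ℂ) A]
  isContinuousTrace : IsContinuousTrace n X A
  /-- the action of `ℝⁿ` -/
  α : Rn n → A ≃⋆ₐ[ℂ] A
  α_zero : ∀ a, α 0 a = a
  α_add : ∀ s t a, α (s + t) a = α s (α t a)
  α_continuous : ∀ a, Continuous fun s => α s a
  α_smul : ∀ s (f : X →ᵇ ℂ) a, α s (f • a) = transFun s f • α s a

attribute [instance] BrObj.cstar BrObj.module

/-- Two actions of `ℝⁿ` on a C⋆-algebra `A` are exterior equivalent: there is a strictly continuous
map `w` from `ℝⁿ` to the unitary multipliers of `A` with `β_s(a) = w_s α_s(a) w_s⋆` and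
`w_{s+t} = w_s α_s(w_t)`. For a multiplier `m`, `m.fst a = m a` and `m.snd a = a m`; the
extension of `α_s` to multipliers is determined by `α_s(m) α_s(a) = α_s(m a)`. -/
def ExtEquiv {A : Type u} [NonUnitalCStarAlgebra A] (α β : Rn n → A ≃⋆ₐ[ℂ] A) : Prop :=
  ∃ w : Rn n → unitary 𝓜(ℂ, A),
    (∀ a, Continuous fun s => (w s : 𝓜(ℂ, A)).fst a) ∧
    (∀ a, Continuous fun s => (w s : 𝓜(ℂ, A)).snd a) ∧
    (∀ s a, β s a = (star (w s : 𝓜(ℂ, A))).snd ((w s : 𝓜(ℂ, A)).fst (α s a))) ∧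
    (∀ s t a, (w (s + t) : 𝓜(ℂ, A)).fst (α s a) =
      (w s : 𝓜(ℂ, A)).fst (α s ((w t : 𝓜(ℂ, A)).fst a)))

/-- Outer conjugacy: there is a `C_0(X)`-isomorphism `φ : A → B` such that `α` and
`φ⁻¹ ∘ β ∘ φ` are exterior equivalent. -/
def OuterConj (P Q : BrObj n X) : Prop :=
  ∃ φ : P.A ≃⋆ₐ[ℂ] Q.A, (∀ (f : X →ᵇ ℂ) a, φ (f • a) = f • φ a) ∧
    ExtEquiv P.α fun s => (φ.trans (Q.α s)).trans φ.symm

section Multipliers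

variable {A B : Type u} [NonUnitalCStarAlgebra A] [NonUnitalCStarAlgebra B]

theorem starEquiv_norm (φ : A ≃⋆ₐ[ℂ] B) (a : A) : ‖φ a‖ = ‖a‖ := StarAlgEquiv.norm_map φ a

theorem starEquiv_continuous (φ : A ≃⋆ₐ[ℂ] B) : Continuous φ := (StarAlgEquiv.isometry φ).continuous

/-- A ⋆-isomorphism as a continuous linear map. -/
def starEquivL (φ : A ≃⋆ₐ[ℂ] B) : A →L[ℂ] B where
  toFun := φ
  map_add' := map_add φ
  map_smul' := map_smul φ
  cont := starEquiv_continuous φ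

/-- Transport of multipliers along a ⋆-isomorphism. -/
def mapMul (φ : A ≃⋆ₐ[ℂ] B) (m : 𝓜(ℂ, A)) : 𝓜(ℂ, B) where
  fst := (starEquivL φ).comp (m.fst.comp (starEquivL φ.symm))
  snd := (starEquivL φ).comp (m.snd.comp (starEquivL φ.symm))
  central x y := by
    change φ (m.snd (φ.symm x)) * y = x * φ (m.fst (φ.symm y))
    have := congrArg φ (m.central (φ.symm x) (φ.symm y))
    simpa using this

theorem mapMul_fst (φ : A ≃⋆ₐ[ℂ] B) (m : 𝓜(ℂ, A)) (b : B) :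
    (mapMul φ m).fst b = φ (m.fst (φ.symm b)) := rfl

theorem mapMul_snd (φ : A ≃⋆ₐ[ℂ] B) (m : 𝓜(ℂ, A)) (b : B) :
    (mapMul φ m).snd b = φ (m.snd (φ.symm b)) := rfl

theorem mult_ext {m m' : 𝓜(ℂ, A)} (h1 : ∀ a, m.fst a = m'.fst a) (h2 : ∀ a, m.snd a = m'.snd a) :
    m = m' :=
  DoubleCentralizer.ext (𝕜 := ℂ) (A := A) _ _
    (Prod.ext (ContinuousLinearMap.ext h1) (ContinuousLinearMap.ext h2))

theorem mapMul_mul (φ : A ≃⋆ₐ[ℂ] B) (m m' : 𝓜(ℂ, A)) :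
    mapMul φ (m * m') = mapMul φ m * mapMul φ m' :=
  mult_ext (fun b => by simp [mapMul_fst, DoubleCentralizer.mul_fst])
    (fun b => by simp [mapMul_snd, DoubleCentralizer.mul_snd])

theorem mapMul_one (φ : A ≃⋆ₐ[ℂ] B) : mapMul φ (1 : 𝓜(ℂ, A)) = 1 :=
  mult_ext (fun b => by simp [mapMul_fst]) (fun b => by simp [mapMul_snd])

theorem mapMul_star (φ : A ≃⋆ₐ[ℂ] B) (m : 𝓜(ℂ, A)) :
    mapMul φ (star m) = star (mapMul φ m) :=
  mult_ext (fun b => by simp [mapMul_fst, mapMul_snd, map_star])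
    (fun b => by simp [mapMul_fst, mapMul_snd, map_star])

/-- Transport of unitary multipliers along a ⋆-isomorphism. -/
def mapUnitary (φ : A ≃⋆ₐ[ℂ] B) (m : unitary 𝓜(ℂ, A)) : unitary 𝓜(ℂ, B) :=
  ⟨mapMul φ m, by
    rw [Unitary.mem_iff, ← mapMul_star, ← mapMul_mul, ← mapMul_mul,
      Unitary.star_mul_self_of_mem m.2, Unitary.mul_star_self_of_mem m.2, mapMul_one]
    exact ⟨rfl, rfl⟩⟩

theorem mul_cancel_left {x y : A} (h : ∀ c, c * x = c * y) : x = y := by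
  have h1 : star (x - y) * (x - y) = 0 := by rw [mul_sub, h, sub_self]
  exact sub_eq_zero.1 ((CStarRing.star_mul_self_eq_zero_iff _).1 h1)

theorem mul_cancel_right {x y : A} (h : ∀ c, x * c = y * c) : x = y := by
  have h1 : (x - y) * star (x - y) = 0 := by rw [sub_mul, h, sub_self]
  exact sub_eq_zero.1 ((CStarRing.mul_star_self_eq_zero_iff _).1 h1)

theorem fst_mul (m : 𝓜(ℂ, A)) (a b : A) : m.fst (a * b) = m.fst a * b :=
  mul_cancel_left fun c => by
    rw [← m.central, ← mul_assoc, m.central, mul_assoc]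

theorem snd_fst_comm (m k : 𝓜(ℂ, A)) (a : A) : m.snd (k.fst a) = k.fst (m.snd a) :=
  mul_cancel_right fun c => by
    rw [m.central, ← fst_mul, ← fst_mul, m.central]

theorem fst_star_fst {m : 𝓜(ℂ, A)} (hm : m ∈ unitary 𝓜(ℂ, A)) (a : A) :
    (star m).fst (m.fst a) = a := by
  have h : (star m * m).fst a = a := by rw [Unitary.star_mul_self_of_mem hm]; rfl
  exact h

theorem fst_fst_star {m : 𝓜(ℂ, A)} (hm : m ∈ unitary 𝓜(ℂ, A)) (a : A) :
    m.fst ((star m).fst a) = a := by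
  have h : (m * star m).fst a = a := by rw [Unitary.mul_star_self_of_mem hm]; rfl
  exact h

theorem snd_star_snd {m : 𝓜(ℂ, A)} (hm : m ∈ unitary 𝓜(ℂ, A)) (a : A) :
    (star m).snd (m.snd a) = a := by
  have h : (m * star m).snd a = a := by rw [Unitary.mul_star_self_of_mem hm]; rfl
  exact h

theorem snd_snd_star {m : 𝓜(ℂ, A)} (hm : m ∈ unitary 𝓜(ℂ, A)) (a : A) :
    m.snd ((star m).snd a) = a := by
  have h : (star m * m).snd a = a := by rw [Unitary.star_mul_self_of_mem hm]; rfl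
  exact h

theorem norm_unitary_le {m : 𝓜(ℂ, A)} (hm : m ∈ unitary 𝓜(ℂ, A)) : ‖m‖ ≤ 1 := by
  have h : ‖m‖ * ‖m‖ = ‖(1 : 𝓜(ℂ, A))‖ := by
    rw [← CStarRing.norm_star_mul_self, Unitary.star_mul_self_of_mem hm]
  have h1 : ‖(1 : 𝓜(ℂ, A))‖ ≤ 1 := by
    rw [← DoubleCentralizer.norm_fst]
    exact ContinuousLinearMap.norm_id_le
  nlinarith [norm_nonneg m]

theorem continuous_clm_family {Y : Type*} [TopologicalSpace Y] {L : Y → A →L[ℂ] A}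
    (hL : ∀ y, ‖L y‖ ≤ 1) (hc : ∀ a, Continuous fun y => L y a) {b : Y → A} (hb : Continuous b) :
    Continuous fun y => L y (b y) := by
  rw [continuous_iff_continuousAt]
  intro y₀
  rw [ContinuousAt, tendsto_iff_norm_sub_tendsto_zero]
  have h1 := tendsto_iff_norm_sub_tendsto_zero.1 (hb.tendsto y₀)
  have h2 := tendsto_iff_norm_sub_tendsto_zero.1 ((hc (b y₀)).tendsto y₀)
  have h3 := h1.add h2
  rw [add_zero] at h3
  refine squeeze_zero (fun _ => norm_nonneg _) (fun y => ?_) h3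
  rw [← sub_add_sub_cancel _ (L y (b y₀))]
  refine (norm_add_le _ _).trans (add_le_add_left ?_ _)
  rw [← map_sub]
  exact ((L y).le_of_opNorm_le (hL y) _).trans (one_mul _).le

end Multipliers

theorem OuterConj.refl (P : BrObj n X) : OuterConj P P := by
  refine ⟨StarAlgEquiv.refl ℂ P.A, fun _ _ => rfl, fun _ => 1, fun a => continuous_const,
    fun a => continuous_const, fun s a => ?_, fun s t a => rfl⟩
  change P.α s a = (star (1 : 𝓜(ℂ, P.A))).snd (P.α s a)
  rw [star_one]
  rfl

theorem OuterConj.symm {P Q : BrObj n X} (h : OuterConj P Q) : OuterConj Q P := by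
  obtain ⟨φ, hφ, w, h1, h2, h3, h4⟩ := h
  have hw : ∀ s, (w s : 𝓜(ℂ, P.A)) ∈ unitary 𝓜(ℂ, P.A) := fun s => (w s).2
  have key : ∀ s a, Q.α s (φ a) =
      φ ((star (w s : 𝓜(ℂ, P.A))).snd ((w s : 𝓜(ℂ, P.A)).fst (P.α s a))) := by
    intro s a
    rw [← h3]
    simp
  refine ⟨φ.symm, fun f b => ?_, fun s => mapUnitary φ (star (w s)), fun b => ?_, fun b => ?_,
    fun s b => ?_, fun s t b => ?_⟩
  · have h := hφ f (φ.symm b)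
    rw [StarAlgEquiv.apply_symm_apply] at h
    rw [← h, StarAlgEquiv.symm_apply_apply]
  · change Continuous fun s => φ ((star (w s : 𝓜(ℂ, P.A))).fst (φ.symm b))
    simp_rw [DoubleCentralizer.star_fst]
    exact (starEquiv_continuous φ).comp (h2 _).star
  · change Continuous fun s => φ ((star (w s : 𝓜(ℂ, P.A))).snd (φ.symm b))
    simp_rw [DoubleCentralizer.star_snd]
    exact (starEquiv_continuous φ).comp (h1 _).star
  · obtain ⟨a, rfl⟩ := φ.surjective b
    change φ (P.α s (φ.symm (φ a))) = (star (mapMul φ (star (w s : 𝓜(ℂ, P.A))))).snd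
      (φ ((star (w s : 𝓜(ℂ, P.A))).fst (φ.symm (Q.α s (φ a)))))
    rw [← mapMul_star, star_star, mapMul_snd, key]
    simp only [StarAlgEquiv.symm_apply_apply]
    rw [← snd_fst_comm, fst_star_fst (hw s), snd_snd_star (hw s)]
  · obtain ⟨a, rfl⟩ := φ.surjective b
    change φ ((star (w (s + t) : 𝓜(ℂ, P.A))).fst (φ.symm (Q.α s (φ a)))) =
      φ ((star (w s : 𝓜(ℂ, P.A))).fst (φ.symm (Q.α s
        (φ ((star (w t : 𝓜(ℂ, P.A))).fst (φ.symm (φ a)))))))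
    rw [key, key]
    simp only [StarAlgEquiv.symm_apply_apply]
    congr 1
    rw [← snd_fst_comm, ← snd_fst_comm, fst_star_fst (hw s)]
    congr 1
    have := h4 s t ((star (w t : 𝓜(ℂ, P.A))).fst a)
    rw [fst_fst_star (hw t)] at this
    rw [← this, fst_star_fst (hw _)]

theorem OuterConj.trans {P Q R : BrObj n X} (h : OuterConj P Q) (h' : OuterConj Q R) :
    OuterConj P R := by
  obtain ⟨φ, hφ, w, h1, h2, h3, h4⟩ := h
  obtain ⟨ψ, hψ, v, k1, k2, k3, k4⟩ := h'
  have key : ∀ s a, Q.α s (φ a) =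
      φ ((star (w s : 𝓜(ℂ, P.A))).snd ((w s : 𝓜(ℂ, P.A)).fst (P.α s a))) := by
    intro s a
    rw [← h3]
    simp
  have key' : ∀ s b, R.α s (ψ b) =
      ψ ((star (v s : 𝓜(ℂ, Q.A))).snd ((v s : 𝓜(ℂ, Q.A)).fst (Q.α s b))) := by
    intro s b
    rw [← k3]
    simp
  have hw : ∀ s, (w s : 𝓜(ℂ, P.A)) ∈ unitary 𝓜(ℂ, P.A) := fun s => (w s).2
  refine ⟨φ.trans ψ, fun f a => ?_, fun s => mapUnitary φ.symm (v s) * w s, fun a => ?_,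
    fun a => ?_, fun s a => ?_, fun s t a => ?_⟩
  · simp [hφ, hψ]
  · change Continuous fun s =>
      φ.symm ((v s : 𝓜(ℂ, Q.A)).fst (φ ((w s : 𝓜(ℂ, P.A)).fst a)))
    refine (starEquiv_continuous φ.symm).comp (continuous_clm_family (fun s => ?_) k1
      ((starEquiv_continuous φ).comp (h1 a)))
    exact (DoubleCentralizer.norm_fst _).trans_le (norm_unitary_le (v s).2)
  · change Continuous fun s =>
      (w s : 𝓜(ℂ, P.A)).snd (φ.symm ((v s : 𝓜(ℂ, Q.A)).snd (φ a)))
    refine continuous_clm_family (fun s => ?_) h2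
      ((starEquiv_continuous φ.symm).comp (k2 (φ a)))
    exact (DoubleCentralizer.norm_snd _).trans_le (norm_unitary_le (w s).2)
  · change φ.symm (ψ.symm (R.α s (ψ (φ a)))) =
      (star (mapMul φ.symm (v s : 𝓜(ℂ, Q.A)) * (w s : 𝓜(ℂ, P.A)))).snd
        ((mapMul φ.symm (v s : 𝓜(ℂ, Q.A))).fst ((w s : 𝓜(ℂ, P.A)).fst (P.α s a)))
    rw [key', key, star_mul, DoubleCentralizer.mul_snd, ← mapMul_star]
    change _ = (mapMul φ.symm (star (v s : 𝓜(ℂ, Q.A)))).snd ((star (w s : 𝓜(ℂ, P.A))).snd _)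
    rw [snd_fst_comm (star (w s : 𝓜(ℂ, P.A))) (mapMul φ.symm (v s : 𝓜(ℂ, Q.A))), mapMul_fst,
      mapMul_snd]
    simp
  · change φ.symm ((v (s + t) : 𝓜(ℂ, Q.A)).fst (φ ((w (s + t) : 𝓜(ℂ, P.A)).fst (P.α s a)))) =
      φ.symm ((v s : 𝓜(ℂ, Q.A)).fst (φ ((w s : 𝓜(ℂ, P.A)).fst (P.α s
        (φ.symm ((v t : 𝓜(ℂ, Q.A)).fst (φ ((w t : 𝓜(ℂ, P.A)).fst a))))))))
    congr 1
    rw [h4]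
    set c : P.A := (w t : 𝓜(ℂ, P.A)).fst a
    have e : ∀ d : P.A, φ ((w s : 𝓜(ℂ, P.A)).fst (P.α s d)) =
        (mapMul φ (w s : 𝓜(ℂ, P.A))).snd (Q.α s (φ d)) := by
      intro d
      rw [mapMul_snd, key, StarAlgEquiv.symm_apply_apply, snd_snd_star (hw s)]
    rw [e, e, StarAlgEquiv.apply_symm_apply, ← snd_fst_comm, ← snd_fst_comm, k4]

/-- Outer conjugacy as an equivalence relation. -/
def brSetoid (n : ℕ) (X : Type u) [TopologicalSpace X] [AddAction (Rn n) X]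
    [ContinuousVAdd (Rn n) X] : Setoid (BrObj n X) where
  r := OuterConj
  iseqv := ⟨OuterConj.refl, OuterConj.symm, OuterConj.trans⟩

/-- The equivariant Brauer group `Br_{ℝⁿ}(X)` (as a set): `𝔅𝔯_{ℝⁿ}(X)` modulo outer
conjugacy. -/
def Br (n : ℕ) (X : Type u) [TopologicalSpace X] [AddAction (Rn n) X]
    [ContinuousVAdd (Rn n) X] := Quotient (brSetoid n X)

/-- The class `[A, α]` in the equivariant Brauer group. -/
def BrObj.toBr (P : BrObj n X) : Br n X := Quotient.mk (brSetoid n X) P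

end Brauer

/-! ## The map `C(Z, M_n^u(ℝ)) → Br_{ℝⁿ}(X)` -/

section BrMap

variable {n : ℕ} {X : Type u} [TopologicalSpace X]

/-- The pointwise action of `C_b(X)` on `C_0(X, 𝒦)`. -/
def cbSmul (f : X →ᵇ ℂ) (h : C₀(X, KK n)) : C₀(X, KK n) where
  toFun x := f x • h x
  continuous_toFun := by fun_prop
  zero_at_infty' := by
    refine squeeze_zero_norm (a := fun x => ‖f‖ * ‖h x‖) (fun x => ?_) ?_
    · exact (norm_smul_le _ _).trans (by gcongr; exact f.norm_coe_le_norm x)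
    · simpa using (tendsto_zero_iff_norm_tendsto_zero.1 (zero_at_infty h)).const_mul ‖f‖

/-- The pointwise action of `C_b(X)` on `C_0(X, 𝒦)`. -/
abbrev cbModule : Module (X →ᵇ ℂ) C₀(X, KK n) where
  smul := cbSmul
  one_smul h := ZeroAtInftyContinuousMap.ext fun x => one_smul ℂ (h x)
  mul_smul f f' h := ZeroAtInftyContinuousMap.ext fun x => mul_smul (f x) (f' x) (h x)
  smul_zero f := ZeroAtInftyContinuousMap.ext fun x => smul_zero (f x)
  smul_add f h h' := ZeroAtInftyContinuousMap.ext fun x => smul_add (f x) (h x) (h' x)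
  add_smul f f' h := ZeroAtInftyContinuousMap.ext fun x => add_smul (f x) (f' x) (h x)
  zero_smul h := ZeroAtInftyContinuousMap.ext fun x => zero_smul ℂ (h x)

/-- The trivial bundle with fibre `𝒦`. -/
def trivCore (n : ℕ) (X : Type u) [TopologicalSpace X] : FiberBundleCore PUnit.{u + 1} X (KK n) where
  baseSet _ := univ
  isOpen_baseSet _ := isOpen_univ
  indexAt _ := PUnit.unit
  mem_baseSet_at _ := mem_univ _
  coordChange _ _ _ T := T
  coordChange_self _ _ _ _ := rfl
  continuousOn_coordChange _ _ := continuous_snd.continuousOn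
  coordChange_comp _ _ _ _ _ _ := rfl

theorem trivCore_continuous (h : X → KK n) :
    Continuous (fun x => (⟨x, h x⟩ : (trivCore n X).TotalSpace)) ↔ Continuous h := by
  rw [continuous_iff_continuousAt, continuous_iff_continuousAt]
  refine forall_congr' fun x => ?_
  rw [FiberBundle.continuousAt_totalSpace]
  exact ⟨fun hh => hh.2, fun hh => ⟨continuousAt_id, hh⟩⟩

attribute [local instance] cbModule

theorem isContinuousTrace_trivial : IsContinuousTrace n X C₀(X, KK n) := by
  refine ⟨PUnit.{u + 1}, trivCore n X, fun i j x _ => ⟨StarAlgEquiv.refl ℂ _, fun T => rfl⟩,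
    { toFun := fun h => h
      map_smul' := fun c h => rfl
      map_zero' := rfl
      map_add' := fun h h' => rfl
      map_mul' := fun h h' => rfl
      map_star' := fun h => rfl }, fun h h' e => DFunLike.coe_injective e,
    fun f h x => rfl, ?_⟩
  ext h
  simp only [mem_range, mem_ofPred_eq]
  rw [trivCore_continuous, ← tendsto_zero_iff_norm_tendsto_zero]
  constructor
  · rintro ⟨h', rfl⟩
    exact ⟨h'.continuous, zero_at_infty h'⟩
  · rintro ⟨h1, h2⟩
    exact ⟨⟨⟨h, h1⟩, h2⟩, rfl⟩

variable {Z : Type v} [TopologicalSpace Z] [AddAction (Rn n) X] [ContinuousVAdd (Rn n) X]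
  {π : X → Z}

theorem continuous_actFun {Y : Type*} [TopologicalSpace Y] (hπ : Continuous π)
    (g : C(Z, Pairs n → ℝ)) (h : C₀(X, KK n)) {s : Y → Rn n} {x : Y → X} (hs : Continuous s)
    (hx : Continuous x) :
    Continuous fun y => conjK (lOp (g (π (x y))) (s y)) (h (-s y +ᵥ x y)) := by
  have h1 : Continuous fun y => h (-s y +ᵥ x y) := by fun_prop
  have h2 : Continuous fun y => g (π (x y)) := by fun_prop
  exact continuous_conjK (continuous_lOp_comp h2 hs) h1

theorem tendsto_actFun (g : C(Z, Pairs n → ℝ)) (s : Rn n) (h : C₀(X, KK n)) :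
    Tendsto (fun x => conjK (lOp (g (π x)) s) (h (-s +ᵥ x))) (cocompact X) (𝓝 0) := by
  have h1 : Tendsto (fun x : X => -s +ᵥ x) (cocompact X) (cocompact X) :=
    (Homeomorph.vadd (-s)).isClosedEmbedding.tendsto_cocompact
  have h2 := tendsto_zero_iff_norm_tendsto_zero.1 ((zero_at_infty h).comp h1)
  refine tendsto_zero_iff_norm_tendsto_zero.2 (h2.congr fun x => ?_)
  exact (norm_conjK _ _).symm

/-- The automorphism `Ad L_g̃(s) ∘ τ_s` of `C_0(X, 𝒦)`:
`h ↦ (x ↦ L_g̃(s)(x) h(-s · x) L_g̃(s)(x)⋆)`. -/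
def actFun (hπ : Continuous π) (g : C(Z, Pairs n → ℝ)) (s : Rn n) (h : C₀(X, KK n)) :
    C₀(X, KK n) where
  toFun x := conjK (lOp (g (π x)) s) (h (-s +ᵥ x))
  continuous_toFun := continuous_actFun hπ g h continuous_const continuous_id
  zero_at_infty' := tendsto_actFun g s h

theorem actFun_apply (hπ : Continuous π) (g : C(Z, Pairs n → ℝ)) (s : Rn n) (h : C₀(X, KK n))
    (x : X) : actFun hπ g s h x = conjK (lOp (g (π x)) s) (h (-s +ᵥ x)) := rfl

theorem actFun_zero (hπ : Continuous π) (g : C(Z, Pairs n → ℝ)) (h : C₀(X, KK n)) :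
    actFun hπ g 0 h = h :=
  ZeroAtInftyContinuousMap.ext fun x => by
    rw [actFun_apply, lOp_zero, conjK_one, neg_zero, zero_vadd]

theorem actFun_add (hπ : IsPrincipalTorusBundle n π) (g : C(Z, Pairs n → ℝ)) (s t : Rn n)
    (h : C₀(X, KK n)) :
    actFun hπ.continuous g (s + t) h = actFun hπ.continuous g s (actFun hπ.continuous g t h) :=
  ZeroAtInftyContinuousMap.ext fun x => by
    have e : π (-s +ᵥ x) = π x := ((hπ.fiber x _).2 ⟨-s, rfl⟩).symm
    rw [actFun_apply, actFun_apply, actFun_apply, e, conjK_conjK, ← add_vadd, ← neg_add_rev]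
    refine (conjK_eq_of_smul (c := (ee (gTilde (g (π x)) s t) : ℂ)) ?_ (lOp_mul _ s t) _).symm
    have := Circle.normSq_coe (ee (gTilde (g (π x)) s t))
    rw [Complex.star_def, Complex.mul_conj, this, Complex.ofReal_one]

/-- The automorphism `Ad L_g̃(s) ∘ τ_s` of `C_0(X, 𝒦)`. -/
def actEquiv (hπ : IsPrincipalTorusBundle n π) (g : C(Z, Pairs n → ℝ)) (s : Rn n) :
    C₀(X, KK n) ≃⋆ₐ[ℂ] C₀(X, KK n) where
  toFun := actFun hπ.continuous g s
  invFun := actFun hπ.continuous g (-s)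
  left_inv h := by rw [← actFun_add hπ, neg_add_cancel, actFun_zero]
  right_inv h := by rw [← actFun_add hπ, add_neg_cancel, actFun_zero]
  map_mul' h h' := ZeroAtInftyContinuousMap.ext fun x => conjK_mul _ _ _
  map_add' h h' := ZeroAtInftyContinuousMap.ext fun x => conjK_add _ _ _
  map_star' h := ZeroAtInftyContinuousMap.ext fun x => conjK_star _ _
  map_smul' c h := ZeroAtInftyContinuousMap.ext fun x => conjK_smul _ _ _

theorem actEquiv_continuous (hπ : IsPrincipalTorusBundle n π) (g : C(Z, Pairs n → ℝ))
    (h : C₀(X, KK n)) : Continuous fun s => actEquiv hπ g s h := by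
  rw [continuous_iff_continuousAt]
  intro s₀
  rw [ContinuousAt, Metric.tendsto_nhds]
  intro ε hε
  have h0 : ∀ᶠ x in cocompact X, ‖h x‖ < ε / 4 := by
    have := tendsto_zero_iff_norm_tendsto_zero.1 (zero_at_infty h)
    exact this.eventually_lt_const (by positivity)
  obtain ⟨K₀, hK₀, hK₀'⟩ := mem_cocompact.1 h0
  have hK : IsCompact ((fun p : Rn n × X => p.1 +ᵥ p.2) '' (Metric.closedBall s₀ 1 ×ˢ K₀)) :=
    ((isCompact_closedBall s₀ 1).prod hK₀).image (by fun_prop)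
  set K := (fun p : Rn n × X => p.1 +ᵥ p.2) '' (Metric.closedBall s₀ 1 ×ˢ K₀)
  have hj : Continuous fun p : Rn n × X =>
      ‖actFun hπ.continuous g p.1 h p.2 - actFun hπ.continuous g s₀ h p.2‖ :=
    (Continuous.sub (continuous_actFun hπ.continuous g h continuous_fst continuous_snd)
      (by fun_prop)).norm
  have h1 : ∀ᶠ s in 𝓝 s₀, ∀ x ∈ K,
      ‖actFun hπ.continuous g s h x - actFun hπ.continuous g s₀ h x‖ < ε / 2 := by
    refine hK.eventually_forall_of_forall_eventually fun x _ => ?_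
    refine (hj.tendsto (s₀, x)).eventually_lt_const ?_
    simp only [sub_self, norm_zero]
    positivity
  filter_upwards [h1, Metric.closedBall_mem_nhds s₀ one_pos] with s hs hs1
  have hout : ∀ t ∈ Metric.closedBall s₀ 1, ∀ x ∉ K,
      ‖actFun hπ.continuous g t h x‖ < ε / 4 := by
    intro t ht x hx
    rw [actFun_apply, norm_conjK]
    refine hK₀' fun hmem => hx ⟨(t, -t +ᵥ x), ⟨ht, hmem⟩, ?_⟩
    simp
  refine lt_of_le_of_lt ?_ (half_lt_self hε)
  rw [dist_eq_norm, ← ZeroAtInftyContinuousMap.norm_toBCF_eq_norm]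
  refine (BoundedContinuousFunction.norm_le (by positivity)).2 fun x => ?_
  change ‖actFun hπ.continuous g s h x - actFun hπ.continuous g s₀ h x‖ ≤ ε / 2
  by_cases hx : x ∈ K
  · exact (hs x hx).le
  · have a1 := hout s hs1 x hx
    have a2 := hout s₀ (Metric.mem_closedBall_self zero_le_one) x hx
    have a3 := norm_sub_le (actFun hπ.continuous g s h x) (actFun hπ.continuous g s₀ h x)
    linarith

/-- The pair `(C_0(X, 𝒦), Ad L_g̃ ∘ τ)`. -/
def brObj (hπ : IsPrincipalTorusBundle n π) (g : C(Z, Pairs n → ℝ)) : BrObj n X where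
  A := C₀(X, KK n)
  module := cbModule
  isContinuousTrace := isContinuousTrace_trivial
  α := actEquiv hπ g
  α_zero := actFun_zero hπ.continuous g
  α_add := actFun_add hπ g
  α_continuous := actEquiv_continuous hπ g
  α_smul s f h := ZeroAtInftyContinuousMap.ext fun x =>
    conjK_smul (lOp (g (π x)) s) (f (-s +ᵥ x)) (h (-s +ᵥ x))

/-- The map `C(Z, M_n^u(ℝ)) → Br_{ℝⁿ}(X)`, `g ↦ [C_0(X, 𝒦), Ad L_g̃ ∘ τ]`. -/
def brMap (hπ : IsPrincipalTorusBundle n π) (g : C(Z, Pairs n → ℝ)) : Br n X :=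
  (brObj hπ g).toBr

end BrMap

/-! ## The map `Ξ` -/

section Xi

variable {n : ℕ} {X : Type u} [TopologicalSpace X]

/-- The ideal `A|_U = C_0(U) · A` of a `C_0(X)`-algebra: the closed linear span of the elements
`f · a` with `f` vanishing outside of `U`. -/
def restrictTo (A : Type u) [NonUnitalCStarAlgebra A] [Module (X →ᵇ ℂ) A] (U : Set X) : Set A :=
  closure (Submodule.span ℂ {b : A | ∃ (f : X →ᵇ ℂ) (a : A), (∀ x ∉ U, f x = 0) ∧ b = f • a})

/-- A local trivialisation over an open set `U`, that is, a `C_0(U)`-isomorphism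
`A|_U → C_0(U, 𝒦)`. It is recorded through its unique `C_b(X)`-linear extension
`Φ : A → C_b(U, 𝒦)` (so that `Φ(a)(x)` makes sense for all `a ∈ A` and `x ∈ U`), which maps
`A|_U` bijectively onto `C_0(U, 𝒦)`. -/
structure LocalTriv (n : ℕ) {X : Type u} [TopologicalSpace X] (A : Type u)
    [NonUnitalCStarAlgebra A] [Module (X →ᵇ ℂ) A] (U : Set X) where
  /-- the extended trivialisation -/
  Φ : A →⋆ₙₐ[ℂ] (U →ᵇ KK n)
  map_smul : ∀ (f : X →ᵇ ℂ) a x, Φ (f • a) x = f x • Φ a x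
  bijOn : BijOn Φ (restrictTo A U) {h | Tendsto (fun x => ‖h x‖) (cocompact U) (𝓝 0)}

variable {Z : Type v} {I : Type w} [TopologicalSpace Z] [AddAction (Rn n) X]
  [ContinuousVAdd (Rn n) X] {π : X → Z}

/-- The choices in the construction of `Ξ` for a pair `(A, α)`: local trivialisations `Φ_l` over
`U_l`, strongly continuous unitary-valued maps `v_l^i` on `U_l` such that
`Φ_l ∘ α_{e_i} ∘ Φ_l⁻¹ = Ad v_l^i`, and strongly continuous unitary-valued maps `v_{lm}` on
`π(U_l) ∩ π(U_m)` such that `β_{(l(-s_{lm}(z), σ_m(z))m)} = Ad v_{lm}(z)`. Here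
`β_{(l(t, x)m)}` is the automorphism of `𝒦` that maps `T` to `Φ_m(α_t(a))(x)` for any `a` with
`Φ_l(a)(-t · x) = T`; for `t = -s_{lm}(z)` and `x = σ_m(z)` one has `-t · x = σ_l(z)`. -/
structure XiData (S : StandardSetup n π I) (P : BrObj n X) where
  /-- the local trivialisations -/
  triv : ∀ i, LocalTriv n P.A (S.U i)
  /-- the unitaries `v_l^i` -/
  v : ∀ i, Fin n → S.U i → UU n
  v_continuous : ∀ i j (ξ : HSp n), Continuous fun x => (v i j x : BB n) ξ
  v_spec : ∀ i j a x,
    (triv i).Φ (P.α (Pi.single j 1) a) x = conjK (v i j x) ((triv i).Φ a x)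
  /-- the unitaries `v_{lm}` -/
  vv : ∀ l : Fin 2 → I, inter S.W l → UU n
  vv_continuous : ∀ l (ξ : HSp n), Continuous fun z => (vv l z : BB n) ξ
  vv_spec : ∀ l z (T : KK n) (a : P.A),
    (triv (l 0)).Φ a (S.σ (l 0) (proj S.W l 0 z)) = T →
      (triv (l 1)).Φ (P.α (-(S.s l z)) a) (S.σ (l 1) (proj S.W l 1 z)) = conjK (vv l z) T

namespace XiData

variable {S : StandardSetup n π I} {P : BrObj n X} (D : XiData S P)

/-- The ordered product `v_l^m(x) = (v_l^1(x))^{m_1} ⋯ (v_l^n(x))^{m_n}`. -/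
def vpow (i : I) (m : Fin n → ℤ) (x : S.U i) : UU n :=
  (List.ofFn fun j => D.v i j x ^ m j).prod

/-- The dimensionally reduced cochain `φ = (φ²⁰, φ¹¹, φ⁰²)` is the one attached to the choices `D`:
with `v_l^m(z) = v_l^m(σ_l(z))`,
* `φ⁰²_l(z)_{ij} = v_l^j(z) v_l^i(z) v_l^j(z)⋆ v_l^i(z)⋆` for `i < j`,
* `φ¹¹_{lm}(k, z) = v_m^k(z) v_{lm}(z) v_l^k(z)⋆ v_{lm}(z)⋆` for `k ∈ ℤⁿ`,
* `φ²⁰_{lmp}(z) = v_{mp}(z) v_{lm}(z) (v_l^{-F_{lmp}(z)}(z))⋆ v_{lp}(z)⋆`.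
The value `[t]` of a cochain in `ℝ/ℤ` corresponds to the scalar operator `exp(2πit)`. -/
structure IsTriple (φ : DR S.W n UnitAddCircle 0) : Prop where
  two : ∀ (l : Fin 1 → I) (z : inter S.W l) (p : Pairs n),
    let x := S.σ (l 0) (proj S.W l 0 z)
    ((D.v (l 0) p.1.2 x * D.v (l 0) p.1.1 x * star (D.v (l 0) p.1.2 x) *
      star (D.v (l 0) p.1.1 x) : UU n) : BB n) = (ee (φ.2.2 l z p) : ℂ) • 1
  one : ∀ (l : Fin 2 → I) (z : inter S.W l) (k : Fin n → ℤ),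
    ((D.vpow (l 1) k (S.σ (l 1) (proj S.W l 1 z)) * D.vv l z *
      star (D.vpow (l 0) k (S.σ (l 0) (proj S.W l 0 z))) * star (D.vv l z) : UU n) : BB n) =
      (ee (∑ j, k j • φ.2.1 l z j) : ℂ) • 1
  zero : ∀ (l : Fin 3 → I) (z : inter S.W l),
    ((D.vv (l ∘ Fin.succAbove 0) (face S.W l (Fin.succAbove 0) z) *
      D.vv (l ∘ Fin.succAbove 2) (face S.W l (Fin.succAbove 2) z) *
      star (D.vpow (l 0) (-(S.F l z)) (S.σ (l 0) (proj S.W l 0 z))) *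
      star (D.vv (l ∘ Fin.succAbove 1) (face S.W l (Fin.succAbove 1) z)) : UU n) : BB n) =
      (ee (φ.1 l z) : ℂ) • 1

end XiData

/-- `c` is the value of `Ξ` at the class `b` of the equivariant Brauer group: the choices in the
construction of `Ξ` exist for a representative of `b`, and all choices for all representatives of
`b` lead to a cocycle with class `c`. -/
def IsXi (S : StandardSetup n π I) (b : Br n X) (c : DRH S.W UnitAddCircle S.F 0) : Prop :=
  (∃ P : BrObj n X, P.toBr = b ∧ Nonempty (XiData S P)) ∧
    ∀ P : BrObj n X, P.toBr = b → ∀ D : XiData S P,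
      ∃ (φ : DR S.W n UnitAddCircle 0) (h : drD S.F 0 φ = 0), D.IsTriple φ ∧ DRH.mk φ h = c

open Classical in
/-- The map `Ξ : Br_{ℝⁿ}(X) → ℍ²_F(π(U), 𝒮)` that maps `b` to the class `c` with `IsXi S b c`. -/
def Xi (S : StandardSetup n π I) (b : Br n X) : DRH S.W UnitAddCircle S.F 0 :=
  if h : ∃ c, IsXi S b c then h.choose else 0

/-- The connecting homomorphism `ℍ²_F(π(U), 𝒮) → ℍ³_F(π(U), ℤ)` in the standard setup. -/
def StandardSetup.connecting (S : StandardSetup n π I) :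
    DRH S.W UnitAddCircle S.F 0 →+ DRH S.W ℤ S.F 1 :=
  DimRed.connecting S.goodZ S.F_closed

end Xi

end DimRed

end

noncomputable section

namespace DimRed

universe u v w

/-! ## Rank one operators -/

section RankOne

variable {n : ℕ}

/-! The class `Ξ[C_0(X, 𝒦), Ad L_g̃ ∘ τ]` is represented by a circle-valued cocycle with a real lift
that is closed over `ℝ`, not merely modulo `ℤ`. A closed real lift gives a zig-zag ending in the
integral cochain `0`, so the connecting map kills the class.

The lift comes from the relation `L_g̃(s) L_g̃(t) = g̃(s, t) L_g̃(s + t)`. Since `ℤⁿ` acts trivially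
on `X`, one may take restrictions as trivialisations, `v^i = L_g̃(e_i)` and `v_{ab} = L_g̃(-s_{ab})`
(`trivialXiData`). The scalars in the triple are then values of `g̃` at combinations of `s`, `F` and
lattice vectors. Dropping the reduction modulo `ℤ` gives `realCochain`. After the substitution `F =
∂̌s` its closedness is a polynomial identity in the values of `s`, and `∂̌g = 0` because `g` is
globally defined (`drD_realCochain`).

For well-definedness, let `(A, α)` be outer conjugate to the model. A unitary multiplier of `C_0(X,
𝒦)` is a field of unitary operators (`exists_unitary_field`), so `α` becomes conjugation by a field
`V` with `V_s(x) V_t(-s · x) = g̃(s, t) V_{s+t}(x)`, with the same `g̃` as in the model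
(`OuterConj.exists_field`). Along the sections `σ_i` the chosen trivialisations are implemented by
strongly continuous unitaries `u_i`. This uses contractibility of `π(U_i)` to lift a family of
endomorphisms of `𝒦` to unitaries (`exists_strongCont_lift`). The chosen `v^i` and `v_{ab}` are then
the conjugated values of `V` up to continuous phases `a` and `b` (`XiData.exists_phases`). In the
triple the `u_i` cancel, `g̃` contributes `realCochain` modulo `ℤ`, and the phases contribute
exactly `D_F(b, a)` (`XiData.exists_isTriple`). -/

theorem isCompactOperator_rankOne {H : Type*} [NormedAddCommGroup H] [InnerProductSpace ℂ H]
    (ζ ξ : H) : IsCompactOperator (InnerProductSpace.rankOne ℂ ζ ξ) := by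
  rw [InnerProductSpace.rankOne_def']
  -- The operator factors through `ℂ`, and a continuous functional is compact because the closed
  -- unit disc is.
  have h : IsCompactOperator (innerSL ℂ ξ) :=
    ⟨Metric.closedBall 0 1, isCompact_closedBall 0 1,
      (innerSL ℂ ξ).continuous.continuousAt.preimage_mem_nhds (by
        rw [map_zero (innerSL ℂ ξ)]; exact Metric.closedBall_mem_nhds 0 one_pos)⟩
  exact h.clm_comp (ContinuousLinearMap.toSpanSingleton ℂ ζ)

/-- The rank one operator `η ↦ ⟨ξ, η⟩ ζ`. -/
def rk (ζ ξ : HSp n) : KK n :=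
  ⟨InnerProductSpace.rankOne ℂ ζ ξ, isCompactOperator_rankOne ζ ξ⟩

theorem op_rk_apply (ζ ξ η : HSp n) : (rk ζ ξ).op η = inner ℂ ξ η • ζ := rfl

theorem op_injective : Function.Injective (KK.op (n := n)) := Subtype.val_injective

theorem op_mul (S T : KK n) : (S * T).op = S.op * T.op := rfl

theorem op_mul_apply (S T : KK n) (ξ : HSp n) : (S * T).op ξ = S.op (T.op ξ) := rfl

theorem op_add (S T : KK n) : (S + T).op = S.op + T.op := rfl

theorem op_sub (S T : KK n) : (S - T).op = S.op - T.op := rfl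

theorem op_zero : (0 : KK n).op = 0 := rfl

theorem op_smul (c : ℂ) (T : KK n) : (c • T).op = c • T.op := rfl

theorem op_star (T : KK n) : (star T).op = star T.op := rfl

theorem norm_op (T : KK n) : ‖T.op‖ = ‖T‖ := rfl

theorem continuous_op : Continuous (KK.op (n := n)) := continuous_subtype_val

/-- For a fixed unit vector `ξ`, the operators `rk ζ ξ` form a copy of the Hilbert space inside `𝒦`
on which left multiplication is the original action. The reconstructions of unitary operators from
homomorphisms and multipliers all rest on this. -/
theorem mul_rk (T : KK n) (ζ ξ : HSp n) : T * rk ζ ξ = rk (T.op ζ) ξ := by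
  apply op_injective
  ext1 η
  rw [op_mul_apply, op_rk_apply, op_rk_apply, map_smul]

theorem rk_add (ζ ζ' ξ : HSp n) : rk (ζ + ζ') ξ = rk ζ ξ + rk ζ' ξ := by
  apply op_injective
  ext1 η
  rw [op_add, add_apply, op_rk_apply, op_rk_apply, op_rk_apply, smul_add]

theorem rk_smul (c : ℂ) (ζ ξ : HSp n) : rk (c • ζ) ξ = c • rk ζ ξ := by
  apply op_injective
  ext1 η
  rw [op_smul, smul_apply, op_rk_apply, op_rk_apply, smul_comm]

theorem star_rk (ζ ξ : HSp n) : star (rk ζ ξ) = rk ξ ζ := by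
  apply op_injective
  exact InnerProductSpace.adjoint_rankOne ζ ξ

theorem rk_mul_rk (a b c d : HSp n) : rk a b * rk c d = (inner ℂ b c : ℂ) • rk a d := by
  rw [mul_rk, op_rk_apply, rk_smul]

theorem exists_unit_vector (n : ℕ) : ∃ ξ : HSp n, ‖ξ‖ = 1 := by
  have h0 : volume (Metric.ball (0 : Rn n) 1) ≠ 0 :=
    (Metric.measure_ball_pos volume _ one_pos).ne'
  have h1 : volume (Metric.ball (0 : Rn n) 1) ≠ ⊤ := measure_ball_lt_top.ne
  let ξ : HSp n := indicatorConstLp 2 measurableSet_ball h1 (1 : ℂ)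
  have hξ : ‖ξ‖ ≠ 0 := by
    rw [norm_indicatorConstLp (by norm_num) (by norm_num)]
    have : 0 < volume.real (Metric.ball (0 : Rn n) 1) := ENNReal.toReal_pos h0 h1
    rw [norm_one, one_mul]
    positivity
  refine ⟨(‖ξ‖⁻¹ : ℂ) • ξ, ?_⟩
  rw [norm_smul, norm_inv, Complex.norm_real, norm_norm, inv_mul_cancel₀ hξ]

/-- A fixed unit vector. -/
def unitVec (n : ℕ) : HSp n := (exists_unit_vector n).choose

theorem norm_unitVec : ‖unitVec n‖ = 1 := (exists_unit_vector n).choose_spec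

theorem inner_self_of_norm_one {H : Type*} [NormedAddCommGroup H] [InnerProductSpace ℂ H] {ξ : H}
    (h : ‖ξ‖ = 1) : inner ℂ ξ ξ = (1 : ℂ) := by
  rw [inner_self_eq_norm_sq_to_K, h]
  norm_num

/-- A compact operator is a norm limit of operators of finite rank. -/
theorem exists_finset_approx (T : KK n) {ε : ℝ} (hε : 0 < ε) :
    ∃ s : Finset (HSp n), (∀ e ∈ s, ‖e‖ = 1) ∧ ‖T - (∑ e ∈ s, rk e e) * T‖ ≤ ε := by
  have htb : TotallyBounded (T.op '' Metric.closedBall 0 1) :=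
    ((IsCompactOperator.isCompact_closure_image_closedBall (f := T.op.toLinearMap) T.2
      1).totallyBounded).subset subset_closure
  obtain ⟨t, htf, hcov⟩ := Metric.totallyBounded_iff.1 htb ε hε
  -- The span of a finite `ε`-net of the image of the unit ball; the finite set sought is an
  -- orthonormal basis of it.
  let V : Submodule ℂ (HSp n) := Submodule.span ℂ t
  have : FiniteDimensional ℂ V := FiniteDimensional.span_of_finite ℂ htf
  let b := stdOrthonormalBasis ℂ V
  have hinj : Function.Injective fun i => (b i : HSp n) :=
    Subtype.val_injective.comp b.toBasis.injective
  classical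
  refine ⟨Finset.univ.image fun i => (b i : HSp n), ?_, ?_⟩
  · intro e he
    obtain ⟨i, -, rfl⟩ := Finset.mem_image.1 he
    exact b.orthonormal.1 i
  · have hsum : ∀ ξ, (∑ e ∈ Finset.univ.image fun i => (b i : HSp n), rk e e).op ξ =
        V.starProjection ξ := by
      intro ξ
      rw [Finset.sum_image fun i _ j _ h => hinj h]
      have e1 : ∀ s : Finset (Fin (Module.finrank ℂ V)),
          (∑ i ∈ s, rk (b i : HSp n) (b i)).op ξ = ∑ i ∈ s, (rk (b i : HSp n) (b i)).op ξ := by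
        intro s
        induction s using Finset.induction_on with
        | empty => rfl
        | insert i s hi ih =>
          rw [Finset.sum_insert hi, Finset.sum_insert hi, op_add, add_apply, ih]
      rw [e1, b.starProjection_eq_sum_rankOne]
      simp [op_rk_apply]
    rw [← norm_op]
    refine ContinuousLinearMap.opNorm_le_of_unit_norm hε.le fun x hx => ?_
    obtain ⟨c, hc, hxc⟩ := mem_iUnion₂.1 (hcov ⟨x, by simp [hx], rfl⟩)
    rw [Metric.mem_ball, dist_eq_norm] at hxc
    have hcV : V.starProjection c = c :=
      Submodule.starProjection_eq_self_iff.2 (Submodule.subset_span hc)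
    -- The net point `c` is fixed by the projection, so the error is `1 - P` applied to `T x - c`,
    -- and `1 - P` is a contraction.
    have e2 : (T - (∑ e ∈ Finset.univ.image fun i => (b i : HSp n), rk e e) * T).op x =
        (T.op x - c) - V.starProjection (T.op x - c) := by
      rw [op_sub, sub_apply, op_mul_apply, hsum, map_sub, hcV]
      abel
    rw [e2]
    refine le_trans ?_ hxc.le
    have h3 := (Vᗮ).norm_starProjection_apply_le (T.op x - c)
    rwa [Submodule.starProjection_orthogonal'] at h3

/-- A nonzero homomorphism of `𝒦` does not vanish at projections of rank one. -/
theorem map_rk_ne_zero {Θ : KK n →⋆ₙₐ[ℂ] KK n} (hΘ : Function.Surjective Θ) {ξ : HSp n}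
    (hξ : ‖ξ‖ = 1) : Θ (rk ξ ξ) ≠ 0 := by
  intro h0
  -- If one rank one projection is killed then so are all, since each factors through it.
  -- Contractivity and finite rank approximation then give `Θ = 0`, against surjectivity.
  have h1 : ∀ e : HSp n, Θ (rk e e) = 0 := by
    intro e
    have : rk e e = rk e ξ * rk ξ ξ * rk ξ e := by
      rw [rk_mul_rk, inner_self_of_norm_one hξ, one_smul, rk_mul_rk, inner_self_of_norm_one hξ,
        one_smul]
    rw [this, map_mul, map_mul, h0, mul_zero, zero_mul]
  have h2 : ∀ T, Θ T = 0 := by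
    intro T
    refine norm_le_zero_iff.1 (le_of_forall_pos_le_add fun ε hε => ?_)
    obtain ⟨s, -, hs⟩ := exists_finset_approx T hε
    have e : Θ T = Θ (T - (∑ e ∈ s, rk e e) * T) := by
      rw [map_sub, map_mul, map_sum, Finset.sum_congr rfl fun e _ => h1 e, Finset.sum_const_zero,
        zero_mul, sub_zero]
    rw [e, zero_add]
    exact (NonUnitalStarAlgHom.norm_apply_le Θ _).trans hs
  obtain ⟨T, hT⟩ := hΘ (rk ξ ξ)
  rw [h2] at hT
  have h3 := op_rk_apply ξ ξ ξ
  rw [← hT, inner_self_of_norm_one hξ, one_smul] at h3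
  rw [← h3] at hξ
  simp [op_zero] at hξ

/-- A surjective homomorphism of `𝒦` is implemented by a unitary operator. -/
theorem exists_unitary_of_surjective {Θ : KK n →⋆ₙₐ[ℂ] KK n} (hΘ : Function.Surjective Θ)
    {ξ η : HSp n} (hξ : ‖ξ‖ = 1) (hη : ‖η‖ = 1) (h : (Θ (rk ξ ξ)).op η = η) :
    ∃ u : UU n, (∀ ζ, (u : BB n) ζ = (Θ (rk ζ ξ)).op η) ∧ ∀ T, Θ T = conjK u T := by
  -- The representation `Θ` is rebuilt from the vector `η` fixed by `Θ (rk ξ ξ)`. Isometry follows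
  -- from `(rk ζ ξ)⋆ (rk ζ ξ) = ⟨ζ, ζ⟩ rk ξ ξ`.
  let V : HSp n →ₗᵢ[ℂ] HSp n :=
    { toFun := fun ζ => (Θ (rk ζ ξ)).op η
      map_add' := fun ζ ζ' => by rw [rk_add, map_add, op_add, add_apply]
      map_smul' := fun c ζ => by
        rw [rk_smul, map_smul, op_smul, smul_apply, RingHom.id_apply]
      norm_map' := fun ζ => by
        change ‖(Θ (rk ζ ξ)).op η‖ = ‖ζ‖
        have e : (inner ℂ ((Θ (rk ζ ξ)).op η) ((Θ (rk ζ ξ)).op η) : ℂ) = inner ℂ ζ ζ := by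
          rw [← ContinuousLinearMap.adjoint_inner_right, ← ContinuousLinearMap.star_eq_adjoint,
            ← op_star, ← op_mul_apply, ← map_star, star_rk, ← map_mul, rk_mul_rk, map_smul, op_smul,
            smul_apply, h, inner_smul_right, inner_self_of_norm_one hη, mul_one]
        rw [inner_self_eq_norm_sq_to_K, inner_self_eq_norm_sq_to_K] at e
        have e' : ‖(Θ (rk ζ ξ)).op η‖ ^ 2 = ‖ζ‖ ^ 2 := by exact_mod_cast e
        exact (pow_left_inj₀ (norm_nonneg _) (norm_nonneg _) two_ne_zero).1 e' }
  have hV : ∀ ζ, V ζ = (Θ (rk ζ ξ)).op η := fun _ => rfl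
  have hcomm : ∀ T ζ, V (T.op ζ) = (Θ T).op (V ζ) := by
    intro T ζ
    rw [hV, hV, ← op_mul_apply, ← map_mul, mul_rk]
  have hsurj : Function.Surjective V := by
    intro ζ
    -- An operator whose image carries `V ξ` to `ζ`; the intertwining relation then gives `V (T ξ) =
    -- ζ`.
    obtain ⟨T, hT⟩ := hΘ (rk ζ (V ξ))
    refine ⟨T.op ξ, ?_⟩
    rw [hcomm, hT, op_rk_apply, V.inner_map_map, inner_self_of_norm_one hξ, one_smul]
  let u : UU n := Unitary.linearIsometryEquiv.symm (LinearIsometryEquiv.ofSurjective V hsurj)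
  have hu : ∀ ζ, (u : BB n) ζ = V ζ := fun _ => rfl
  refine ⟨u, hu, fun T => op_injective ?_⟩
  have h1 : (Θ T).op * (u : BB n) = u * T.op := by
    ext1 ζ
    exact (hcomm T ζ).symm
  have h2 : (u : BB n) * star (u : BB n) = 1 := Unitary.mul_star_self_of_mem u.2
  rw [op_conjK, ← h1, mul_assoc, h2, mul_one]

end RankOne

/-! ## Strongly continuous families of unitary operators -/

section Strong

variable {n : ℕ} {Y : Type*} [TopologicalSpace Y]

/-- Strong continuity of a family of unitary operators. -/
def StrongCont (u : Y → UU n) : Prop := ∀ ξ, Continuous fun y => (u y : BB n) ξ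

theorem norm_unitary_apply (u : UU n) (ξ : HSp n) : ‖(u : BB n) ξ‖ = ‖ξ‖ :=
  (Unitary.linearIsometryEquiv u).norm_map ξ

/-- Unitary operators are isometric, so moving the vector costs exactly the norm of its
displacement; strong continuity is therefore joint in operator and vector. -/
theorem StrongCont.apply {u : Y → UU n} (hu : StrongCont u) {ξ : Y → HSp n} (hξ : Continuous ξ) :
    Continuous fun y => (u y : BB n) (ξ y) := by
  rw [continuous_iff_continuousAt]
  intro y₀
  rw [ContinuousAt, tendsto_iff_norm_sub_tendsto_zero]
  have h1 := tendsto_iff_norm_sub_tendsto_zero.1 (hξ.tendsto y₀)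
  have h2 := tendsto_iff_norm_sub_tendsto_zero.1 ((hu (ξ y₀)).tendsto y₀)
  have h3 := h1.add h2
  rw [add_zero] at h3
  refine squeeze_zero (fun _ => norm_nonneg _) (fun y => ?_) h3
  rw [← sub_add_sub_cancel _ ((u y : BB n) (ξ y₀)), ← map_sub]
  exact (norm_add_le _ _).trans_eq (by rw [norm_unitary_apply])

theorem StrongCont.mul {u v : Y → UU n} (hu : StrongCont u) (hv : StrongCont v) :
    StrongCont fun y => u y * v y := fun ξ => hu.apply (hv ξ)

theorem unitary_apply_star_apply (u : UU n) (ξ : HSp n) :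
    (u : BB n) (((star u : UU n) : BB n) ξ) = ξ := by
  change ((u * star u : UU n) : BB n) ξ = ξ
  rw [Unitary.mul_star_self]
  rfl

theorem StrongCont.adjoint {u : Y → UU n} (hu : StrongCont u) : StrongCont fun y => star (u y) := by
  intro ξ
  rw [continuous_iff_continuousAt]
  intro y₀
  rw [ContinuousAt, tendsto_iff_norm_sub_tendsto_zero]
  have h2 := tendsto_iff_norm_sub_tendsto_zero.1
    ((hu (((star (u y₀) : UU n) : BB n) ξ)).tendsto y₀)
  -- Applying the isometry `u y` turns `‖u_y⋆ ξ - u_{y₀}⋆ ξ‖` into `‖ξ - u_y u_{y₀}⋆ ξ‖`, which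
  -- tends to zero by strong continuity of `u` itself.
  refine h2.congr fun y => ?_
  rw [← norm_unitary_apply (u y) (((star (u y) : UU n) : BB n) ξ - _), map_sub,
    unitary_apply_star_apply, unitary_apply_star_apply, norm_sub_rev]

theorem StrongCont.comp {Y' : Type*} [TopologicalSpace Y'] {u : Y → UU n} (hu : StrongCont u)
    {f : Y' → Y} (hf : Continuous f) : StrongCont fun y => u (f y) := fun ξ => (hu ξ).comp hf

/-! ### Unitary operators modulo scalars. -/

/-- The angle of a complex number of modulus one. -/
theorem exists_ee_eq {c : ℂ} (hc : ‖c‖ = 1) : ∃ θ : UnitAddCircle, (ee θ : ℂ) = c := by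
  have hc' : c ∈ Submonoid.unitSphere ℂ := mem_sphere_zero_iff_norm.2 hc
  refine ⟨(AddCircle.homeomorphCircle (T := 1) one_ne_zero).symm ⟨c, hc'⟩, ?_⟩
  have := (AddCircle.homeomorphCircle (T := 1) one_ne_zero).apply_symm_apply ⟨c, hc'⟩
  rw [AddCircle.homeomorphCircle_apply] at this
  exact congrArg Subtype.val this

theorem ee_injective : Function.Injective ee := AddCircle.injective_toCircle one_ne_zero

theorem ee_zero : ee 0 = 1 := AddCircle.toCircle_zero

/-- The character `ee` is a homeomorphism onto the unit circle, so continuity of an angle can be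
tested on the complex scalar. -/
theorem continuous_of_ee {θ : Y → UnitAddCircle} (h : Continuous fun y => (ee (θ y) : ℂ)) :
    Continuous θ := by
  have h1 : Continuous fun y => ee (θ y) := continuous_induced_rng.2 h
  have h2 := (AddCircle.homeomorphCircle (T := 1) one_ne_zero).symm.continuous.comp h1
  refine h2.congr fun y => ?_
  rw [Function.comp_apply, Homeomorph.symm_apply_eq, AddCircle.homeomorphCircle_apply]
  rfl

theorem smul_one_injective {c d : ℂ} (h : c • (1 : BB n) = d • 1) : c = d := by
  have h1 := congrArg (fun T : BB n => inner ℂ (unitVec n) (T (unitVec n))) h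
  simp only [smul_apply, one_apply_eq_self, inner_smul_right] at h1
  rwa [inner_self_of_norm_one norm_unitVec, mul_one, mul_one] at h1

/-- A unitary operator that commutes with all compact operators is scalar. -/
theorem exists_ee_smul {u v : UU n} (h : ∀ T, conjK u T = conjK v T) :
    ∃ θ : UnitAddCircle, (u : BB n) = (ee θ : ℂ) • (v : BB n) := by
  let w : UU n := star v * u
  have hw : ∀ T, conjK w T = T := by
    intro T
    rw [← conjK_conjK, h, conjK_conjK, Unitary.star_mul_self, conjK_one]
  have hw' : ∀ T : KK n, (w : BB n) * T.op = T.op * w := by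
    intro T
    have h1 := congrArg (fun S : KK n => S.op * (w : BB n)) (hw T)
    simp only [op_conjK] at h1
    rw [← h1, mul_assoc, Unitary.star_mul_self_of_mem w.2, mul_one]
  set ξ := unitVec n
  have hξ : ‖ξ‖ = 1 := norm_unitVec
  -- Commutation with `rk ζ ξ`, evaluated at `ξ`, shows that `w` multiplies every `ζ` by the same
  -- number `⟨ξ, w ξ⟩`.
  have hs : ∀ ζ, (w : BB n) ζ = (inner ℂ ξ ((w : BB n) ξ) : ℂ) • ζ := by
    intro ζ
    have h1 := congrArg (fun S : BB n => S ξ) (hw' (rk ζ ξ))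
    simp only [mul_apply_eq_comp] at h1
    rwa [op_rk_apply, op_rk_apply, inner_self_of_norm_one hξ, one_smul] at h1
  have hc : ‖(inner ℂ ξ ((w : BB n) ξ) : ℂ)‖ = 1 := by
    have := norm_unitary_apply w ξ
    rwa [hs, norm_smul, hξ, mul_one] at this
  obtain ⟨θ, hθ⟩ := exists_ee_eq hc
  refine ⟨θ, ?_⟩
  ext1 ζ
  have h2 : (u : BB n) ζ = (v : BB n) ((w : BB n) ζ) := by
    change _ = ((v * (star v * u) : UU n) : BB n) ζ
    rw [← mul_assoc, Unitary.mul_star_self, one_mul]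
  rw [h2, hs, map_smul, hθ, smul_apply]

/-- Two strongly continuous families of unitary operators that implement the same automorphisms
of `𝒦` differ by a continuous function with values in `ℝ/ℤ`. -/
theorem exists_phase {u v : Y → UU n} (hu : StrongCont u) (hv : StrongCont v)
    (h : ∀ y T, conjK (u y) T = conjK (v y) T) :
    ∃ θ : C(Y, UnitAddCircle), ∀ y, (u y : BB n) = (ee (θ y) : ℂ) • (v y : BB n) := by
  choose θ hθ using fun y => exists_ee_smul (h y)
  refine ⟨⟨θ, continuous_of_ee ?_⟩, hθ⟩
  -- The phase is a matrix coefficient of two strongly continuous families, which makes the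
  -- pointwise choice of `θ` continuous.
  have h1 : ∀ y, (ee (θ y) : ℂ) = inner ℂ ((v y : BB n) (unitVec n)) ((u y : BB n) (unitVec n)) := by
    intro y
    rw [hθ, smul_apply, inner_smul_right, inner_self_of_norm_one, mul_one]
    rw [norm_unitary_apply, norm_unitVec]
  simp_rw [h1]
  exact (hv _).inner (hu _)

end Strong

/-! ## Sections of projection valued functions -/

section Projections

variable {H : Type*} [NormedAddCommGroup H] [NormedSpace ℂ H] {Y : Type*} [TopologicalSpace Y]

/-- A uniform modulus of continuity in the parameter `t`. -/
theorem exists_step (p : ℝ → Y → H →L[ℂ] H) (hp : Continuous fun x : ℝ × Y => p x.1 x.2) :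
    ∃ δ : Y → ℝ, Continuous δ ∧ (∀ y, 0 < δ y) ∧ ∀ y, ∀ t ∈ Icc (0 : ℝ) 1, ∀ t' ∈ Icc (0 : ℝ) 1,
      |t - t'| < δ y → ‖p t y - p t' y‖ < 1 := by
  -- This function is nowhere zero: off the diagonal the first term is positive, and on it the
  -- second equals `1`. Its minimum over the compact square is therefore positive, and depends
  -- continuously on `y`.
  let f : Y → ℝ × ℝ → ℝ := fun y x => |x.1 - x.2| + max 0 (1 - ‖p x.1 y - p x.2 y‖)
  let K : Set (ℝ × ℝ) := Icc 0 1 ×ˢ Icc 0 1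
  have hK : IsCompact K := isCompact_Icc.prod isCompact_Icc
  have hK0 : K.Nonempty := ⟨(0, 0), ⟨by simp, by simp⟩⟩
  have hf : Continuous ↿f := by
    have h1 : Continuous fun x : Y × ℝ × ℝ => p x.2.1 x.1 :=
      hp.comp (by fun_prop : Continuous fun x : Y × ℝ × ℝ => (x.2.1, x.1))
    have h2 : Continuous fun x : Y × ℝ × ℝ => p x.2.2 x.1 :=
      hp.comp (by fun_prop : Continuous fun x : Y × ℝ × ℝ => (x.2.2, x.1))
    change Continuous fun x : Y × ℝ × ℝ => |x.2.1 - x.2.2| + max 0 (1 - ‖p x.2.1 x.1 - p x.2.2 x.1‖)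
    fun_prop
  have hfy : ∀ y, ContinuousOn (f y) K := fun y =>
    (hf.comp (by fun_prop : Continuous fun x : ℝ × ℝ => (y, x))).continuousOn
  refine ⟨fun y => sInf (f y '' K), hK.continuous_sInf hf, fun y => ?_, fun y t ht t' ht' h => ?_⟩
  · obtain ⟨x, -, hx, -⟩ := hK.exists_sInf_image_eq_and_le hK0 (hfy y)
    refine lt_of_lt_of_eq ?_ hx.symm
    change 0 < |x.1 - x.2| + max 0 (1 - ‖p x.1 y - p x.2 y‖)
    by_cases h : x.1 = x.2
    · rw [h, sub_self, sub_self, norm_zero, abs_zero, sub_zero, zero_add]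
      exact lt_max_of_lt_right one_pos
    · exact add_pos_of_pos_of_nonneg (abs_pos.2 (sub_ne_zero.2 h)) (le_max_left _ _)
  · have h1 : sInf (f y '' K) ≤ f y (t, t') :=
      csInf_le (hK.image_of_continuousOn (hfy y)).bddBelow ⟨(t, t'), ⟨ht, ht'⟩, rfl⟩
    -- At distance at least `1` the second term vanishes, so `|t - t'|` would be a value of `f y`,
    -- hence at least its minimum `δ y`.
    by_contra h2
    have h3 : f y (t, t') = |t - t'| := by
      change |t - t'| + max 0 (1 - ‖p t y - p t' y‖) = _
      rw [max_eq_left (by linarith), add_zero]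
    linarith

/-- A continuous family of nonzero projections over a contractible space admits a continuous
family of unit vectors in the ranges. -/
theorem exists_unit_section [ContractibleSpace Y] {q : Y → H →L[ℂ] H} (hq : Continuous q)
    (hidem : ∀ y, q y * q y = q y) (hne : ∀ y, q y ≠ 0) :
    ∃ η : Y → H, Continuous η ∧ ∀ y, ‖η y‖ = 1 ∧ q y (η y) = η y := by
  obtain ⟨y₀, ⟨G⟩⟩ := (contractible_iff_id_nullhomotopic Y).1 inferInstance
  -- The contraction is reversed, so that the path of projections starts at the constant `q y₀` and
  -- ends at `q y`; clamping extends it to all real times.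
  let p : ℝ → Y → H →L[ℂ] H := fun t y => q (G.symm (projIcc 0 1 zero_le_one t, y))
  have hp : Continuous fun x : ℝ × Y => p x.1 x.2 := by
    refine hq.comp (G.symm.continuous.comp ?_)
    exact (continuous_projIcc.comp continuous_fst).prodMk continuous_snd
  have hp0 : ∀ y, p 0 y = q y₀ := by
    intro y
    change q (G.symm (projIcc 0 1 zero_le_one 0, y)) = _
    rw [projIcc_left]
    exact congrArg q (G.symm.apply_zero y)
  have hp1 : ∀ y, p 1 y = q y := by
    intro y
    change q (G.symm (projIcc 0 1 zero_le_one 1, y)) = _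
    rw [projIcc_right]
    exact congrArg q (G.symm.apply_one y)
  obtain ⟨δ, hδ, hδ0, hstep⟩ := exists_step p hp
  -- Time advances in steps of `δ y / 2`, strictly below the modulus `δ y`, and stops at `1`.
  let τ : ℕ → Y → ℝ := fun k y => min 1 (k * (δ y / 2))
  have hτ : ∀ k, Continuous (τ k) := fun k => by fun_prop
  have hτ0 : ∀ k y, τ k y ∈ Icc (0 : ℝ) 1 := fun k y =>
    ⟨le_min zero_le_one (mul_nonneg (Nat.cast_nonneg _) (half_pos (hδ0 y)).le), min_le_left _ _⟩
  have hττ : ∀ k y, |τ (k + 1) y - τ k y| < δ y := by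
    intro k y
    have h1 := abs_min_sub_min_le_max 1 (((k + 1 : ℕ) : ℝ) * (δ y / 2)) 1 ((k : ℝ) * (δ y / 2))
    have h2 : ((k + 1 : ℕ) : ℝ) * (δ y / 2) - (k : ℝ) * (δ y / 2) = δ y / 2 := by
      push_cast; ring
    rw [h2, sub_self, abs_zero, abs_of_pos (half_pos (hδ0 y)),
      max_eq_right (half_pos (hδ0 y)).le] at h1
    exact h1.trans_lt (half_lt_self (hδ0 y))
  obtain ⟨e, he1, he⟩ : ∃ e, ‖e‖ = 1 ∧ q y₀ e = e := by
    obtain ⟨ζ, hζ⟩ : ∃ ζ, q y₀ ζ ≠ 0 := by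
      by_contra! h
      exact hne y₀ (ContinuousLinearMap.ext h)
    refine ⟨(‖q y₀ ζ‖⁻¹ : ℂ) • q y₀ ζ, ?_, ?_⟩
    · rw [norm_smul, norm_inv, Complex.norm_real, norm_norm, inv_mul_cancel₀ (norm_ne_zero_iff.2 hζ)]
    · rw [map_smul, ← mul_apply_eq_comp, hidem]
  -- A discrete parallel transport: the vector is projected onto the next range and normalised.
  let E : ℕ → Y → H := fun k => Nat.rec (fun _ => e)
    (fun k η y => ((‖p (τ (k + 1) y) y (η y)‖⁻¹ : ℝ) : ℂ) • p (τ (k + 1) y) y (η y)) k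
  have hE0 : ∀ y, E 0 y = e := fun _ => rfl
  have hEs : ∀ k y, E (k + 1) y =
      ((‖p (τ (k + 1) y) y (E k y)‖⁻¹ : ℝ) : ℂ) • p (τ (k + 1) y) y (E k y) := fun _ _ => rfl
  have hpidem : ∀ t y, p t y * p t y = p t y := fun t y => hidem _
  have main : ∀ k, Continuous (E k) ∧ ∀ y, ‖E k y‖ = 1 ∧ p (τ k y) y (E k y) = E k y := by
    intro k
    induction k with
    | zero =>
      refine ⟨continuous_const, fun y => ⟨he1, ?_⟩⟩
      have : τ 0 y = 0 := by
        change min (1 : ℝ) ((0 : ℕ) * _) = 0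
        simp
      rw [this, hp0]
      exact he
    | succ k ih =>
      obtain ⟨hc, h⟩ := ih
      -- A unit vector in the range of one projection cannot be killed by another at norm distance
      -- less than `1`.
      have hne : ∀ y, ‖p (τ (k + 1) y) y (E k y)‖ ≠ 0 := by
        intro y h0
        have h1 := hstep y _ (hτ0 (k + 1) y) _ (hτ0 k y) (hττ k y)
        have h2 := (p (τ (k + 1) y) y - p (τ k y) y).le_opNorm (E k y)
        rw [sub_apply, norm_eq_zero.1 h0, (h y).2, zero_sub, norm_neg, (h y).1] at h2
        linarith
      have hc1 : Continuous fun y => p (τ (k + 1) y) y (E k y) :=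
        (hp.comp ((hτ (k + 1)).prodMk continuous_id)).clm_apply hc
      refine ⟨?_, fun y => ⟨?_, ?_⟩⟩
      · have : Continuous fun y => ((‖p (τ (k + 1) y) y (E k y)‖⁻¹ : ℝ) : ℂ) :=
          Complex.continuous_ofReal.comp (hc1.norm.inv₀ hne)
        exact this.smul hc1
      · rw [hEs, norm_smul, Complex.norm_real, norm_inv, norm_norm, inv_mul_cancel₀ (hne y)]
      · rw [hEs, map_smul, ← mul_apply_eq_comp, hpidem]
  -- Once time `1` is reached, the vector already lies in the range and has norm `1`, so further
  -- steps leave it unchanged.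
  have hstat : ∀ (k : ℕ) y, 1 ≤ (k : ℝ) * (δ y / 2) → E (k + 1) y = E k y ∧ τ k y = 1 := by
    intro k y h
    have h1 : τ k y = 1 := min_eq_left h
    have h2 : τ (k + 1) y = 1 := min_eq_left (h.trans (by
      have := hδ0 y
      gcongr
      exact Nat.le_succ k))
    refine ⟨?_, h1⟩
    rw [hEs, h2, ← h1, ((main k).2 y).2, ((main k).2 y).1]
    simp
  have hstat' : ∀ (k m : ℕ) y, 1 ≤ (k : ℝ) * (δ y / 2) → E (k + m) y = E k y := by
    intro k m y h
    induction m with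
    | zero => rfl
    | succ m ih =>
      rw [← ih, ← add_assoc]
      refine (hstat (k + m) y (h.trans ?_)).1
      have := hδ0 y
      gcongr
      exact Nat.le_add_right k m
  -- Enough steps of length `δ y / 2` to reach time `1`. This number jumps with `y`, but
  -- stationarity makes the endpoint independent of it.
  let N : Y → ℕ := fun y => ⌈2 / δ y⌉₊
  have hN : ∀ y, 1 ≤ (N y : ℝ) * (δ y / 2) := by
    intro y
    have h1 := Nat.le_ceil (2 / δ y)
    have h2 := hδ0 y
    calc (1 : ℝ) = 2 / δ y * (δ y / 2) := by field_simp
      _ ≤ _ := by gcongr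
  have hEN : ∀ (k : ℕ) y, 1 ≤ (k : ℝ) * (δ y / 2) → E (N y) y = E k y := by
    intro k y h
    rcases le_total k (N y) with h1 | h1
    · obtain ⟨m, hm⟩ := Nat.exists_eq_add_of_le h1
      rw [hm, hstat' k m y h]
    · obtain ⟨m, hm⟩ := Nat.exists_eq_add_of_le h1
      rw [hm, hstat' (N y) m y (hN y)]
  refine ⟨fun y => E (N y) y, ?_, fun y => ⟨((main _).2 y).1, ?_⟩⟩
  · rw [continuous_iff_continuousAt]
    intro y₁
    -- Near `y₁` one fixed number `k` of steps suffices, so the section agrees there with the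
    -- continuous function `E k`.
    obtain ⟨k, hk⟩ := exists_nat_gt (2 / δ y₁)
    have h1 : ∀ᶠ y in 𝓝 y₁, 2 / δ y < k :=
      (((continuous_const.div hδ fun y => (hδ0 y).ne').tendsto y₁).eventually_lt_const hk)
    refine ((main k).1.continuousAt (x := y₁)).congr ?_
    filter_upwards [h1] with y hy
    refine (hEN k y ?_).symm
    have h2 := hδ0 y
    calc (1 : ℝ) = 2 / δ y * (δ y / 2) := by field_simp
      _ ≤ _ := by gcongr
  · have := ((main (N y)).2 y).2
    rwa [(hstat (N y) y (hN y)).2, hp1] at this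

end Projections

/-! ### Lifting families of endomorphisms of `𝒦` to unitary operators. -/

/-- A point-norm continuous family of surjective homomorphisms of `𝒦` over a contractible space is
implemented by a strongly continuous family of unitary operators. -/
theorem exists_strongCont_lift {n : ℕ} {Y : Type*} [TopologicalSpace Y] [ContractibleSpace Y]
    {Θ : Y → KK n →⋆ₙₐ[ℂ] KK n} (hs : ∀ y, Function.Surjective (Θ y))
    (hc : ∀ T, Continuous fun y => Θ y T) :
    ∃ u : Y → UU n, StrongCont u ∧ ∀ y T, Θ y T = conjK (u y) T := by
  set ξ := unitVec n
  have hξ : ‖ξ‖ = 1 := norm_unitVec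
  -- Point-norm continuity makes `Θ_y (rk ξ ξ)` a norm continuous family of nonzero projections. A
  -- continuous unit section `η` of the ranges feeds the formula `u_y ζ = Θ_y (rk ζ ξ) η_y`, in
  -- which strong continuity is visible.
  obtain ⟨η, hη, h⟩ := exists_unit_section (q := fun y => (Θ y (rk ξ ξ)).op)
    (continuous_op.comp (hc _)) (fun y => by
      rw [← op_mul, ← map_mul, rk_mul_rk, inner_self_of_norm_one hξ, one_smul])
    (fun y h => map_rk_ne_zero (hs y) hξ (op_injective h))
  choose u hu1 hu2 using fun y => exists_unitary_of_surjective (hs y) hξ (h y).1 (h y).2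
  refine ⟨u, fun ζ => ?_, hu2⟩
  simp_rw [hu1]
  exact (continuous_op.comp (hc _)).clm_apply hη

/-! ## Fibres of `C_0(X, 𝒦)` -/

section Fibres

variable {n : ℕ} {X : Type u} [TopologicalSpace X]

theorem c0_norm_le {h : C₀(X, KK n)} {C : ℝ} (hC : 0 ≤ C) (hh : ∀ x, ‖h x‖ ≤ C) : ‖h‖ ≤ C := by
  rw [← ZeroAtInftyContinuousMap.norm_toBCF_eq_norm]
  exact (BoundedContinuousFunction.norm_le hC).2 hh

theorem continuous_c0_eval {Y : Type*} [TopologicalSpace Y] {h : Y → C₀(X, KK n)} {x : Y → X}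
    (hh : Continuous h) (hx : Continuous x) : Continuous fun y => h y (x y) := by
  have h1 : Continuous fun y => (h y).toBCF :=
    ZeroAtInftyContinuousMap.isometry_toBCF.continuous.comp hh
  exact h1.eval hx

/-- The scalar function can be shifted to a right factor, with which left multiplication by `m`
commutes. -/
theorem fst_cbSmul (m : 𝓜(ℂ, C₀(X, KK n))) (f : X →ᵇ ℂ) (h : C₀(X, KK n)) :
    m.fst (cbSmul f h) = cbSmul f (m.fst h) := by
  refine mul_cancel_right fun k => ?_
  have e1 : cbSmul f h * k = h * cbSmul f k := ZeroAtInftyContinuousMap.ext fun x => by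
    change (f x • h x) * k x = h x * (f x • k x)
    rw [smul_mul_assoc, mul_smul_comm]
  have e2 : cbSmul f (m.fst h) * k = m.fst h * cbSmul f k := ZeroAtInftyContinuousMap.ext fun x => by
    change (f x • m.fst h x) * k x = m.fst h x * (f x • k x)
    rw [smul_mul_assoc, mul_smul_comm]
  rw [← fst_mul, e1, e2, fst_mul]

variable [T2Space X] [LocallyCompactSpace X]

/-- Bump functions. -/
theorem exists_bump (x₀ : X) {N : Set X} (hN : N ∈ 𝓝 x₀) :
    ∃ f : X →ᵇ ℂ, HasCompactSupport f ∧ (∀ᶠ x in 𝓝 x₀, f x = 1) ∧ (∀ x ∉ N, f x = 0) ∧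
      ∀ x, ‖f x‖ ≤ 1 := by
  obtain ⟨K, hK, hKN, -⟩ := local_compact_nhds hN
  -- The second, smaller compact neighbourhood makes the bump equal to `1` near `x₀` and not only at
  -- it; locally constant sections depend on this.
  obtain ⟨K', hK', hK'K, hK'c⟩ := local_compact_nhds (interior_mem_nhds.2 hK)
  obtain ⟨f, hf1, hf2, hf3, hf4⟩ := exists_continuous_one_zero_of_isCompact hK'c
    (isOpen_interior (s := K)).isClosed_compl (disjoint_compl_right_iff_subset.2 hK'K)
  have hn : ∀ x, ‖((f x : ℝ) : ℂ)‖ ≤ 1 := fun x => by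
    rw [Complex.norm_real, Real.norm_eq_abs, abs_of_nonneg (hf4 x).1]
    exact (hf4 x).2
  refine ⟨BoundedContinuousFunction.ofNormedAddCommGroup (fun x => ((f x : ℝ) : ℂ)) (by fun_prop)
    1 hn, ?_, ?_, fun x hx => ?_, hn⟩
  · exact hf3.comp_left (g := fun t : ℝ => (t : ℂ)) Complex.ofReal_zero
  · filter_upwards [hK'] with x hx
    change ((f x : ℝ) : ℂ) = 1
    rw [hf1 hx]
    simp
  · change ((f x : ℝ) : ℂ) = 0
    rw [hf2 (fun h => hx (hKN (interior_subset h)))]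
    simp

/-- Sections that are constant near a point. -/
theorem exists_eventually_eq (x₀ : X) (T : KK n) :
    ∃ h : C₀(X, KK n), ∀ᶠ x in 𝓝 x₀, h x = T := by
  obtain ⟨f, hf, hf1, -, -⟩ := exists_bump x₀ (univ_mem (f := 𝓝 x₀))
  have hs : HasCompactSupport fun x => f x • T := hf.smul_right
  refine ⟨⟨⟨fun x => f x • T, by fun_prop⟩, hs.is_zero_at_infty⟩, ?_⟩
  filter_upwards [hf1] with x hx
  change f x • T = T
  rw [hx, one_smul]

theorem exists_apply_eq (x₀ : X) (T : KK n) : ∃ h : C₀(X, KK n), h x₀ = T := by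
  obtain ⟨h, hh⟩ := exists_eventually_eq x₀ T
  exact ⟨h, hh.self_of_nhds⟩

/-- A `C_b(X)`-linear functional at `x` only depends on the value at `x`. -/
theorem eq_of_apply_eq {E : Type*} [NormedAddCommGroup E] [NormedSpace ℂ E] {x : X}
    (L : C₀(X, KK n) →+ E) (hL : ∀ h, ‖L h‖ ≤ ‖h‖) (hL' : ∀ f h, L (cbSmul f h) = f x • L h)
    {h h' : C₀(X, KK n)} (e : h x = h' x) : L h = L h' := by
  rw [← sub_eq_zero, ← map_sub]
  have e0 : (h - h') x = 0 := by
    rw [ZeroAtInftyContinuousMap.sub_apply, e, sub_self]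
  set k := h - h'
  refine norm_le_zero_iff.1 (le_of_forall_pos_le_add fun ε hε => ?_)
  have hN : {y | ‖k y‖ < ε} ∈ 𝓝 x :=
    (k.continuous.norm.tendsto x).eventually_lt_const (by
      change ‖k x‖ < ε
      rwa [e0, norm_zero])
  -- Multiplying `k` by a bump with value `1` at `x`, supported where `‖k‖ < ε`, does not change `L
  -- k` and makes the norm at most `ε`.
  obtain ⟨f, -, hf1, hf2, hf3⟩ := exists_bump x hN
  have h1 := hL' f k
  rw [hf1.self_of_nhds, one_smul] at h1
  rw [← h1, zero_add]
  refine (hL _).trans (c0_norm_le hε.le fun y => ?_)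
  change ‖f y • k y‖ ≤ ε
  by_cases hy : y ∈ {y | ‖k y‖ < ε}
  · rw [norm_smul]
    calc _ ≤ 1 * ‖k y‖ := by gcongr; exact hf3 y
      _ ≤ ε := by rw [one_mul]; exact le_of_lt hy
  · rw [hf2 y hy, zero_smul, norm_zero]
    exact hε.le

/-- A `C_b(X)`-linear homomorphism from `C_0(X, 𝒦)` to a fibre factors through the evaluation. -/
theorem exists_fibre_hom (Ψ : C₀(X, KK n) →⋆ₙₐ[ℂ] KK n) (x : X)
    (hΨ : ∀ f h, Ψ (cbSmul f h) = f x • Ψ h) :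
    ∃ Θ : KK n →⋆ₙₐ[ℂ] KK n, ∀ h, Ψ h = Θ (h x) := by
  have key : ∀ h h' : C₀(X, KK n), h x = h' x → Ψ h = Ψ h' := fun h h' e =>
    eq_of_apply_eq (Ψ : C₀(X, KK n) →+ KK n) (fun h => NonUnitalStarAlgHom.norm_apply_le Ψ h) hΨ e
  -- The sections `b T` are arbitrary; `key` makes `Ψ (b T)` independent of them, whence the
  -- algebraic identities.
  choose b hb using fun T : KK n => exists_apply_eq x T
  refine ⟨{ toFun := fun T => Ψ (b T)
            map_smul' := fun c T => ?_
            map_zero' := ?_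
            map_add' := fun S T => ?_
            map_mul' := fun S T => ?_
            map_star' := fun T => ?_ }, fun h => key _ _ (hb _).symm⟩
  · rw [MonoidHom.id_apply, ← map_smul]
    refine key _ _ ?_
    rw [hb, ZeroAtInftyContinuousMap.smul_apply, hb]
  · refine (key _ _ ?_).trans (map_zero Ψ)
    rw [hb, ZeroAtInftyContinuousMap.zero_apply]
  · rw [← map_add]
    refine key _ _ ?_
    rw [hb, ZeroAtInftyContinuousMap.add_apply, hb, hb]
  · rw [← map_mul]
    refine key _ _ ?_
    rw [hb, ZeroAtInftyContinuousMap.mul_apply, hb, hb]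
  · rw [← map_star]
    refine key _ _ ?_
    rw [hb, ZeroAtInftyContinuousMap.star_apply, hb]

/-! ### Unitary multipliers of `C_0(X, 𝒦)` as fields of unitary operators. -/

/-- Left multiplication by a unitary multiplier is contractive and `C_b(X)`-linear, so it acts fibre
by fibre. -/
theorem fst_apply_eq {m : 𝓜(ℂ, C₀(X, KK n))} (hm : m ∈ unitary 𝓜(ℂ, C₀(X, KK n))) {x : X}
    {h h' : C₀(X, KK n)} (e : h x = h' x) : m.fst h x = m.fst h' x := by
  let L : C₀(X, KK n) →+ KK n :=
    { toFun := fun h => m.fst h x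
      map_zero' := by rw [map_zero]; rfl
      map_add' := fun h h' => by rw [map_add]; rfl }
  refine eq_of_apply_eq L (fun h => ?_) (fun f h => ?_) e
  · have h1 : ‖m.fst h x‖ ≤ ‖m.fst h‖ := by
      rw [← ZeroAtInftyContinuousMap.norm_toBCF_eq_norm]
      exact (m.fst h).toBCF.norm_coe_le_norm x
    have h2 := m.fst.le_of_opNorm_le
      ((DoubleCentralizer.norm_fst m).trans_le (norm_unitary_le hm)) h
    rw [one_mul] at h2
    exact h1.trans h2
  · change m.fst (cbSmul f h) x = f x • m.fst h x
    rw [fst_cbSmul]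
    rfl

/-- A unitary multiplier of `C_0(X, 𝒦)` is a field of unitary operators. -/
theorem exists_unitary_field {m : 𝓜(ℂ, C₀(X, KK n))} (hm : m ∈ unitary 𝓜(ℂ, C₀(X, KK n))) :
    ∃ W : X → UU n, ∀ h x, (m.fst h x).op = (W x : BB n) * (h x).op ∧
      (m.snd h x).op = (h x).op * (W x : BB n) := by
  suffices H : ∀ x, ∃ W : UU n, ∀ h, (m.fst h x).op = (W : BB n) * (h x).op ∧
      (m.snd h x).op = (h x).op * (W : BB n) by
    choose W hW using H
    exact ⟨W, fun h x => hW x h⟩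
  intro x
  set ξ := unitVec n
  have hξ : ‖ξ‖ = 1 := norm_unitVec
  choose b hb using fun ζ : HSp n => exists_apply_eq x (rk ζ ξ)
  -- This is `(m h)⋆ (m h) = h⋆ h`; evaluated at `x` on the sections `b ζ`, it says that `M`
  -- preserves norms.
  have hnorm : ∀ h : C₀(X, KK n), star (m.fst h) * m.fst h = star h * h := by
    intro h
    have h1 := (star m).central (star h) (m.fst h)
    rwa [fst_star_fst hm, DoubleCentralizer.star_snd, star_star] at h1
  let M : HSp n →ₗᵢ[ℂ] HSp n :=
    { toFun := fun ζ => (m.fst (b ζ) x).op ξ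
      map_add' := fun ζ ζ' => by
        rw [← add_apply, ← op_add, ← ZeroAtInftyContinuousMap.add_apply, ← map_add]
        rw [fst_apply_eq hm (h := b (ζ + ζ')) (h' := b ζ + b ζ')]
        rw [ZeroAtInftyContinuousMap.add_apply, hb, hb, hb, rk_add]
      map_smul' := fun c ζ => by
        rw [RingHom.id_apply, ← smul_apply, ← op_smul, ← ZeroAtInftyContinuousMap.smul_apply,
          ← map_smul]
        rw [fst_apply_eq hm (h := b (c • ζ)) (h' := c • b ζ)]
        rw [ZeroAtInftyContinuousMap.smul_apply, hb, hb, rk_smul]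
      norm_map' := fun ζ => by
        change ‖(m.fst (b ζ) x).op ξ‖ = ‖ζ‖
        have e0 : star (m.fst (b ζ) x) * m.fst (b ζ) x = star (b ζ x) * b ζ x :=
          congrArg (fun h : C₀(X, KK n) => h x) (hnorm (b ζ))
        have e : (inner ℂ ((m.fst (b ζ) x).op ξ) ((m.fst (b ζ) x).op ξ) : ℂ) = inner ℂ ζ ζ := by
          rw [← ContinuousLinearMap.adjoint_inner_right, ← ContinuousLinearMap.star_eq_adjoint,
            ← op_star, ← op_mul_apply, e0, hb, star_rk, rk_mul_rk, op_smul, smul_apply,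
            op_rk_apply, inner_smul_right, inner_smul_right, inner_self_of_norm_one hξ, mul_one,
            mul_one]
        rw [inner_self_eq_norm_sq_to_K, inner_self_eq_norm_sq_to_K] at e
        have e' : ‖(m.fst (b ζ) x).op ξ‖ ^ 2 = ‖ζ‖ ^ 2 := by exact_mod_cast e
        exact (pow_left_inj₀ (norm_nonneg _) (norm_nonneg _) two_ne_zero).1 e' }
  have hM : ∀ ζ, M ζ = (m.fst (b ζ) x).op ξ := fun _ => rfl
  have hMT : ∀ (h : C₀(X, KK n)) ζ, (m.fst h x).op ζ = M ((h x).op ζ) := by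
    intro h ζ
    have e1 : m.fst (h * b ζ) x = m.fst h x * b ζ x := by rw [fst_mul]; rfl
    have e2 : m.fst (h * b ζ) x = m.fst (b ((h x).op ζ)) x := by
      refine fst_apply_eq hm ?_
      rw [ZeroAtInftyContinuousMap.mul_apply, hb, hb, mul_rk]
    rw [hM, ← e2, e1, hb, op_mul_apply, op_rk_apply, inner_self_of_norm_one hξ, one_smul]
  have hsurj : Function.Surjective M := by
    intro ζ
    -- The inverse of the fibre operator comes from the adjoint multiplier.
    refine ⟨((star m).fst (b ζ) x).op ξ, ?_⟩
    rw [← hMT, fst_fst_star hm, hb, op_rk_apply, inner_self_of_norm_one hξ, one_smul]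
  let u : UU n := Unitary.linearIsometryEquiv.symm (LinearIsometryEquiv.ofSurjective M hsurj)
  have hu : ∀ ζ, (u : BB n) ζ = M ζ := fun _ => rfl
  refine ⟨u, fun h => ⟨?_, ?_⟩⟩
  · ext1 ζ
    exact hMT h ζ
  · ext1 ζ
    -- The centrality relation `(h m) k = h (m k)` transfers the formula for left multiplication to
    -- right multiplication.
    have e1 : m.snd h x * b ζ x = h x * m.fst (b ζ) x :=
      congrArg (fun h : C₀(X, KK n) => h x) (m.central h (b ζ))
    have e2 := congrArg (fun T : KK n => T.op ξ) e1
    simp only [op_mul_apply] at e2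
    rw [hb, op_rk_apply, inner_self_of_norm_one hξ, one_smul] at e2
    exact e2

/-- A strictly continuous family of unitary multipliers is a strongly continuous family of unitary
operators. -/
theorem strongCont_field {S : Type*} [TopologicalSpace S] {m : S → 𝓜(ℂ, C₀(X, KK n))}
    (hm : ∀ h, Continuous fun s => (m s).fst h) {W : S → X → UU n}
    (hW : ∀ s h x, ((m s).fst h x).op = (W s x : BB n) * (h x).op) :
    StrongCont fun p : S × X => W p.1 p.2 := by
  intro ζ
  rw [continuous_iff_continuousAt]
  rintro ⟨s₀, x₀⟩
  -- With a section equal to `rk ζ e` near `x₀`, for the fixed unit vector `e`, the vector `W ζ` is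
  -- `(m h)(x) e` nearby, a jointly continuous expression.
  obtain ⟨h, hh⟩ := exists_eventually_eq x₀ (rk ζ (unitVec n))
  have h1 : Continuous fun p : S × X => ((m p.1).fst h p.2).op (unitVec n) :=
    (continuous_op.comp (continuous_c0_eval ((hm h).comp continuous_fst) continuous_snd)).clm_apply
      continuous_const
  refine h1.continuousAt.congr ?_
  have h2 : ∀ᶠ p : S × X in 𝓝 (s₀, x₀), h p.2 = rk ζ (unitVec n) :=
    (continuous_snd.tendsto (s₀, x₀)).eventually hh
  filter_upwards [h2] with p hp
  rw [hW, hp, mul_apply_eq_comp, op_rk_apply, inner_self_of_norm_one norm_unitVec, one_smul]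

end Fibres

/-! ## Lattice vectors -/

section Lattice

variable {n : ℕ} {X : Type u} {Z : Type v} [TopologicalSpace X] [TopologicalSpace Z]
  [AddAction (Rn n) X] {π : X → Z}

theorem latt_single (j : Fin n) (k : ℤ) : latt (Pi.single j k) = Pi.single j (k : ℝ) := by
  funext i
  rcases eq_or_ne i j with rfl | h
  · simp [latt]
  · simp [latt, h]

theorem latt_vadd (hπ : IsPrincipalTorusBundle n π) (m : Fin n → ℤ) (x : X) : latt m +ᵥ x = x :=
  (hπ.stabilizer _ x).2 ⟨m, rfl⟩

theorem latt_neg (m : Fin n → ℤ) : latt (-m) = -latt m := by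
  funext i; simp [latt]

theorem actFun_apply_of_eq [ContinuousVAdd (Rn n) X] (hπ : Continuous π) (g : C(Z, Pairs n → ℝ)) {s : Rn n}
    (h : C₀(X, KK n)) {x y : X} {z : Z} (e : -s +ᵥ x = y) (hz : π x = z) :
    actFun hπ g s h x = conjK (lOp (g z) s) (h y) := by
  rw [actFun_apply, e, hz]

end Lattice

/-! ## The choices for the trivial algebra -/

section Trivial

variable {n : ℕ} {X : Type u} [TopologicalSpace X]

/-- Restriction of functions to a subset. -/
def restrictHom (U : Set X) : C₀(X, KK n) →⋆ₙₐ[ℂ] (U →ᵇ KK n) where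
  toFun h := h.toBCF.compContinuous ⟨Subtype.val, continuous_subtype_val⟩
  map_smul' _ _ := rfl
  map_zero' := rfl
  map_add' _ _ := rfl
  map_mul' _ _ := rfl
  map_star' _ := rfl

attribute [local instance] cbModule

/-- A continuous function with values in `[0, 1]` that is close to `1` where `h` is not small. -/
def normCutoff (h : C₀(X, KK n)) (m : ℝ) (hm : 0 ≤ m) : X →ᵇ ℂ :=
  BoundedContinuousFunction.ofNormedAddCommGroup (fun x => ((min 1 (m * ‖h x‖) : ℝ) : ℂ))
    (by fun_prop) 1 fun x => by
      rw [Complex.norm_real, Real.norm_eq_abs, abs_of_nonneg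
        (le_min zero_le_one (mul_nonneg hm (norm_nonneg _)))]
      exact min_le_left _ _

/-- Vanishing off `U` is a closed linear condition. Conversely, the cutoff `min 1 (2‖h‖/ε)` is built
from `h` and so vanishes off `U` too. It equals `1` where `‖h‖ ≥ ε/2`, so multiplying `h` by it
changes `h` by at most `ε/2`. -/
theorem mem_restrictTo {U : Set X} {h : C₀(X, KK n)} :
    h ∈ restrictTo C₀(X, KK n) U ↔ ∀ x ∉ U, h x = 0 := by
  constructor
  · intro hh x hx
    have hcl : IsClosed {h : C₀(X, KK n) | h x = 0} :=
      isClosed_eq (continuous_c0_eval continuous_id continuous_const) continuous_const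
    refine closure_minimal (fun k hk => ?_) hcl hh
    refine Submodule.span_induction (p := fun k _ => k x = 0) ?_ rfl ?_ ?_ hk
    · rintro _ ⟨f, a, hf, rfl⟩
      change f x • a x = 0
      rw [hf x hx, zero_smul]
    · intro a b _ _ ha hb
      rw [ZeroAtInftyContinuousMap.add_apply, ha, hb, add_zero]
    · intro c a _ ha
      rw [ZeroAtInftyContinuousMap.smul_apply, ha, smul_zero]
  · intro hh
    refine Metric.mem_closure_iff.2 fun ε hε => ?_
    have hm : 0 < 2 / ε := by positivity
    refine ⟨normCutoff h (2 / ε) hm.le • h, Submodule.subset_span ⟨_, h, fun x hx => ?_, rfl⟩, ?_⟩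
    · change ((min 1 (2 / ε * ‖h x‖) : ℝ) : ℂ) = 0
      rw [hh x hx, norm_zero, mul_zero, min_eq_right zero_le_one, Complex.ofReal_zero]
    · rw [dist_eq_norm]
      refine lt_of_le_of_lt (c0_norm_le (half_pos hε).le fun x => ?_) (half_lt_self hε)
      change ‖h x - ((min 1 (2 / ε * ‖h x‖) : ℝ) : ℂ) • h x‖ ≤ ε / 2
      rcases le_total 1 (2 / ε * ‖h x‖) with h1 | h1
      · rw [min_eq_left h1, Complex.ofReal_one, one_smul, sub_self, norm_zero]
        positivity
      · rw [min_eq_right h1]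
        have h2 : h x - ((2 / ε * ‖h x‖ : ℝ) : ℂ) • h x = ((1 - 2 / ε * ‖h x‖ : ℝ) : ℂ) • h x := by
          rw [Complex.ofReal_sub, sub_smul, Complex.ofReal_one, one_smul]
        have h3 : 0 ≤ 2 / ε * ‖h x‖ := by positivity
        rw [h2, norm_smul, Complex.norm_real, Real.norm_eq_abs, abs_of_nonneg (by linarith)]
        have h4 : ‖h x‖ ≤ ε / 2 := by
          have : ‖h x‖ = ε / 2 * (2 / ε * ‖h x‖) := by field_simp
          rw [this]
          exact mul_le_of_le_one_right (half_pos hε).le h1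
        calc _ ≤ 1 * ‖h x‖ := by gcongr; linarith
          _ ≤ ε / 2 := by rwa [one_mul]

/-- The superlevel sets `{‖h‖ ≥ ε}` are compact in `X` and contained in `U`, hence compact in `U`.
-/
theorem tendsto_norm_restrict {U : Set X} (h : C₀(X, KK n)) (hh : ∀ x ∉ U, h x = 0) :
    Tendsto (fun x : U => ‖h x‖) (cocompact U) (𝓝 0) := by
  rw [Metric.tendsto_nhds]
  intro ε hε
  have h1 : ∀ᶠ x in cocompact X, ‖h x‖ < ε :=
    (tendsto_zero_iff_norm_tendsto_zero.1 (zero_at_infty h)).eventually_lt_const hε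
  obtain ⟨K, hK, hK'⟩ := mem_cocompact.1 h1
  have hK2 : IsCompact {x | ε ≤ ‖h x‖} := by
    refine hK.of_isClosed_subset (isClosed_le continuous_const h.continuous.norm) fun x hx => ?_
    by_contra hxK
    exact absurd (show ‖h x‖ < ε from hK' hxK) (not_lt.2 hx)
  have hsub : {x | ε ≤ ‖h x‖} ⊆ U := by
    intro x hx
    by_contra hxU
    have : ε ≤ ‖h x‖ := hx
    rw [hh x hxU, norm_zero] at this
    linarith
  refine mem_cocompact.2 ⟨Subtype.val ⁻¹' {x | ε ≤ ‖h x‖}, ?_, fun x hx => ?_⟩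
  · rw [Topology.IsEmbedding.subtypeVal.isCompact_iff, Subtype.image_preimage_coe,
      inter_eq_right.2 hsub]
    exact hK2
  · change dist ‖h x‖ 0 < ε
    rw [Real.dist_0_eq_abs, abs_norm]
    exact not_le.1 hx

variable [T2Space X]

/-- Extension by zero of a function that vanishes at infinity on an open subset. -/
theorem exists_extension {U : Set X} (hU : IsOpen U) (k : U →ᵇ KK n)
    (hk : Tendsto (fun x => ‖k x‖) (cocompact U) (𝓝 0)) :
    ∃ h : C₀(X, KK n), (∀ x : U, h x = k x) ∧ ∀ x ∉ U, h x = 0 := by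
  classical
  let f : X → KK n := fun x => if hx : x ∈ U then k ⟨x, hx⟩ else 0
  have hf : ∀ x : U, f x = k x := fun x => dif_pos x.2
  have hf0 : ∀ x ∉ U, f x = 0 := fun x hx => dif_neg hx
  have hK : ∀ ε > 0, ∃ K : Set X, IsCompact K ∧ K ⊆ U ∧ ∀ x ∉ K, ‖f x‖ < ε := by
    intro ε hε
    obtain ⟨K, hK, hK'⟩ := mem_cocompact.1 (hk.eventually_lt_const hε)
    refine ⟨Subtype.val '' K, hK.image continuous_subtype_val, Subtype.coe_image_subset _ _,
      fun x hx => ?_⟩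
    by_cases hxU : x ∈ U
    · rw [hf ⟨x, hxU⟩]
      exact hK' fun h => hx ⟨_, h, rfl⟩
    · rwa [hf0 x hxU, norm_zero]
  have hcont : Continuous f := by
    rw [continuous_iff_continuousAt]
    intro x
    by_cases hx : x ∈ U
    · have h1 : ContinuousOn f U := by
        rw [continuousOn_iff_continuous_domRestrict]
        exact k.continuous.congr fun x => (hf x).symm
      exact h1.continuousAt (hU.mem_nhds hx)
    -- Off `U` continuity uses that the compact sets of `hK` are closed in the Hausdorff space `X`
    -- and avoid `x`.
    · rw [ContinuousAt, hf0 x hx, Metric.tendsto_nhds]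
      intro ε hε
      obtain ⟨K, hK1, hK2, hK3⟩ := hK ε hε
      filter_upwards [hK1.isClosed.isOpen_compl.mem_nhds fun h => hx (hK2 h)] with y hy
      rw [dist_zero_right]
      exact hK3 y hy
  refine ⟨⟨⟨f, hcont⟩, ?_⟩, hf, hf0⟩
  rw [Metric.tendsto_nhds]
  intro ε hε
  obtain ⟨K, hK1, -, hK3⟩ := hK ε hε
  filter_upwards [hK1.compl_mem_cocompact] with y hy
  rw [dist_zero_right]
  exact hK3 y hy

/-- The local trivialisation of `C_0(X, 𝒦)` given by restriction to an open subset. -/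
def restrictTriv (n : ℕ) {U : Set X} (hU : IsOpen U) : LocalTriv n C₀(X, KK n) U where
  Φ := restrictHom U
  map_smul _ _ _ := rfl
  bijOn := by
    refine ⟨fun h hh => tendsto_norm_restrict h (mem_restrictTo.1 hh), fun h hh h' hh' e => ?_,
      fun k hk => ?_⟩
    · refine ZeroAtInftyContinuousMap.ext fun x => ?_
      by_cases hx : x ∈ U
      · exact congrArg (fun f : U →ᵇ KK n => f ⟨x, hx⟩) e
      · rw [mem_restrictTo.1 hh x hx, mem_restrictTo.1 hh' x hx]
    · obtain ⟨h, h1, h2⟩ := exists_extension hU k hk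
      exact ⟨h, mem_restrictTo.2 h2, BoundedContinuousFunction.ext fun x => h1 x⟩

variable {Z : Type v} {I : Type w} [TopologicalSpace Z] [AddAction (Rn n) X]
  [ContinuousVAdd (Rn n) X] {π : X → Z}

/-- The choices for the pair `(C_0(X, 𝒦), Ad L_g̃ ∘ τ)`. -/
def trivialXiData (S : StandardSetup n π I) (g : C(Z, Pairs n → ℝ)) :
    XiData S (brObj S.bundle g) where
  triv i := restrictTriv n (S.goodX.isOpen i)
  v i j x := lOp (g (π x)) (Pi.single j 1)
  v_continuous i j ξ := continuous_lOp_comp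
    (g.continuous.comp (S.bundle.continuous.comp continuous_subtype_val)) continuous_const ξ
  v_spec i j a x := by
    -- Basis vectors lie in the stabiliser, so translation disappears and `α_{e_j}` is pure
    -- conjugation.
    have e : -(Pi.single j 1 : Rn n) +ᵥ (x : X) = x := by
      have := latt_vadd S.bundle (-Pi.single j 1) (x : X)
      rwa [latt_neg, latt_single, Int.cast_one] at this
    exact actFun_apply_of_eq S.bundle.continuous g a e rfl
  vv l z := lOp (g z) (-(S.s l z))
  vv_continuous l ξ := continuous_lOp_comp (g.continuous.comp continuous_subtype_val)
    (S.s l).continuous.neg ξ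
  vv_spec l z T a h := by
    have e : - -(S.s l z) +ᵥ (S.σ (l 1) (proj S.W l 1 z) : X) = S.σ (l 0) (proj S.W l 0 z) := by
      rw [neg_neg]; exact S.s_vadd l z
    exact (actFun_apply_of_eq S.bundle.continuous g a e (S.π_σ _ _)).trans (congrArg _ h)

end Trivial

/-! ## Systems outer conjugate to `(C_0(X, 𝒦), Ad L_g̃ ∘ τ)` -/

section Outer

variable {n : ℕ} {X : Type u} {Z : Type v} [TopologicalSpace X] [TopologicalSpace Z]
  [T2Space X] [LocallyCompactSpace X] [AddAction (Rn n) X] [ContinuousVAdd (Rn n) X] {π : X → Z}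

theorem gTilde_ee_smul_lOp (g : Pairs n → ℝ) (s t : Rn n) :
    (ee (gTilde g s t) : ℂ) • (lOp g (s + t) : BB n) = (lOp g s : BB n) * (lOp g t : BB n) :=
  (lOp_mul g s t).symm

/-- An operator is determined by its products with compact operators. -/
theorem eq_of_mul_op_eq {A B : BB n} (h : ∀ T : KK n, A * T.op = B * T.op) : A = B := by
  ext1 ζ
  have h1 := congrArg (fun S : BB n => S (unitVec n)) (h (rk ζ (unitVec n)))
  simpa only [mul_apply_eq_comp, op_rk_apply, inner_self_of_norm_one norm_unitVec,
    one_smul] using h1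

/-- An action that is exterior equivalent to `Ad L_g̃ ∘ τ` is given by a strongly continuous field
of unitary operators that is multiplicative up to the cocycle `g̃`. -/
theorem exists_field_of_extEquiv (hπ : IsPrincipalTorusBundle n π) (g : C(Z, Pairs n → ℝ))
    {β : Rn n → C₀(X, KK n) ≃⋆ₐ[ℂ] C₀(X, KK n)} (h : ExtEquiv (actEquiv hπ g) β) :
    ∃ V : Rn n → X → UU n, StrongCont (fun p : Rn n × X => V p.1 p.2) ∧
      (∀ s h x, β s h x = conjK (V s x) (h (-s +ᵥ x))) ∧
      ∀ s t x, (V s x : BB n) * (V t (-s +ᵥ x) : BB n) =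
        (ee (gTilde (g (π x)) s t) : ℂ) • (V (s + t) x : BB n) := by
  obtain ⟨w, h1, -, h3, h4⟩ := h
  choose W hW1 hW2 using fun s => exists_unitary_field (w s).2
  have hWstar : ∀ s (k : C₀(X, KK n)) x, ((star (w s : 𝓜(ℂ, C₀(X, KK n)))).snd k x).op =
      (k x).op * star (W s x : BB n) := by
    intro s k x
    rw [DoubleCentralizer.star_snd, ZeroAtInftyContinuousMap.star_apply, op_star, hW1, star_mul,
      ZeroAtInftyContinuousMap.star_apply, op_star, star_star]
  -- The field is `V_s = W_s L_g̃(s)`, where `W` is the field of the multiplier cocycle `w`.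
  refine ⟨fun s x => W s x * lOp (g (π x)) s, ?_, fun s h x => op_injective ?_, fun s t x => ?_⟩
  · refine (strongCont_field h1 hW1).mul (fun ξ => continuous_lOp_comp ?_ continuous_fst ξ)
    exact g.continuous.comp (hπ.continuous.comp continuous_snd)
  · rw [h3, hWstar, hW1]
    change (W s x : BB n) * (actFun hπ.continuous g s h x).op * star (W s x : BB n) = _
    rw [actFun_apply, ← op_conjK, conjK_conjK]
  · have e : π (-s +ᵥ x) = π x := ((hπ.fiber x _).2 ⟨-s, rfl⟩).symm
    -- The fibre form of `w_{s+t} = w_s α_s(w_t)`. It may be tested against every compact `T`, since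
    -- the value of a section at `-s · x` is arbitrary.
    have e1 : (W (s + t) x : BB n) * (lOp (g (π x)) s : BB n) =
        (W s x : BB n) * (lOp (g (π x)) s : BB n) * (W t (-s +ᵥ x) : BB n) := by
      refine eq_of_mul_op_eq fun T => ?_
      obtain ⟨k, hk⟩ := exists_apply_eq (-s +ᵥ x) T
      have e2 := congrArg (fun k : C₀(X, KK n) => (k x).op) (h4 s t k)
      simp only [hW1] at e2
      change (W (s + t) x : BB n) * (actFun hπ.continuous g s k x).op =
        (W s x : BB n) * (actFun hπ.continuous g s ((w t : 𝓜(ℂ, C₀(X, KK n))).fst k) x).op at e2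
      rw [actFun_apply, actFun_apply, op_conjK, op_conjK, hW1, hk] at e2
      have e3 := congrArg (fun S : BB n => S * (lOp (g (π x)) s : BB n)) e2
      simp only [mul_assoc, Unitary.star_mul_self_of_mem (lOp (g (π x)) s).2, mul_one] at e3
      simpa only [mul_assoc] using e3
    change (W s x : BB n) * (lOp (g (π x)) s : BB n) *
      ((W t (-s +ᵥ x) : BB n) * (lOp (g (π (-s +ᵥ x))) t : BB n)) =
      _ • ((W (s + t) x : BB n) * (lOp (g (π x)) (s + t) : BB n))
    rw [e, ← mul_smul_comm, gTilde_ee_smul_lOp, ← mul_assoc, ← mul_assoc, e1]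

attribute [local instance] cbModule

/-- This extracts what the computation of `Ξ` needs from a representative: its action is conjugation
by a field whose projective defect is the same `g̃` as in the model. Exterior equivalence changes
the field but not the defect. -/
theorem OuterConj.exists_field (hπ : IsPrincipalTorusBundle n π) (g : C(Z, Pairs n → ℝ))
    {P : BrObj n X} (h : OuterConj (brObj hπ g) P) :
    ∃ (ψ : C₀(X, KK n) ≃⋆ₐ[ℂ] P.A) (V : Rn n → X → UU n),
      (∀ f h, ψ (cbSmul f h) = f • ψ h) ∧ StrongCont (fun p : Rn n × X => V p.1 p.2) ∧
      (∀ s h x, ψ.symm (P.α s (ψ h)) x = conjK (V s x) (h (-s +ᵥ x))) ∧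
      ∀ s t x, (V s x : BB n) * (V t (-s +ᵥ x) : BB n) =
        (ee (gTilde (g (π x)) s t) : ℂ) • (V (s + t) x : BB n) := by
  obtain ⟨ψ, hψ, hext⟩ := h
  -- The isomorphism is retyped on `C₀(X, 𝒦)`, which is the algebra of `brObj` by definition.
  let ψ' : C₀(X, KK n) ≃⋆ₐ[ℂ] P.A := ψ
  obtain ⟨V, hV1, hV2, hV3⟩ := exists_field_of_extEquiv hπ g
    (β := fun s => (ψ'.trans (P.α s)).trans ψ'.symm) hext
  exact ⟨ψ', V, hψ, hV1, hV2, hV3⟩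

variable {I : Type w} {S : StandardSetup n π I} {P : BrObj n X}

/-- The local trivialisations of an algebra isomorphic to `C_0(X, 𝒦)`, along the sections `σ_i`,
are implemented by unitary operators. -/
theorem XiData.exists_unitaries (D : XiData S P) (ψ : C₀(X, KK n) ≃⋆ₐ[ℂ] P.A)
    (hψ : ∀ f h, ψ (cbSmul f h) = f • ψ h) (i : I) :
    ∃ u : S.W i → UU n, StrongCont u ∧
      ∀ z h, (D.triv i).Φ (ψ h) (S.σ i z) = conjK (u z) (h (S.σ i z)) := by
  have hfib : ∀ x : S.U i, ∃ Θ : KK n →⋆ₙₐ[ℂ] KK n, ∀ h : C₀(X, KK n),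
      (D.triv i).Φ (ψ h) x = Θ (h x) := by
    intro x
    let Ψ : C₀(X, KK n) →⋆ₙₐ[ℂ] KK n :=
      { toFun := fun h => (D.triv i).Φ (ψ h) x
        map_smul' := fun c h => by rw [map_smul, map_smul]; rfl
        map_zero' := by rw [map_zero, map_zero]; rfl
        map_add' := fun h h' => by rw [map_add, map_add]; rfl
        map_mul' := fun h h' => by rw [map_mul, map_mul]; rfl
        map_star' := fun h => by rw [map_star, map_star]; rfl }
    exact exists_fibre_hom Ψ x fun f h => by
      change (D.triv i).Φ (ψ (cbSmul f h)) x = _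
      rw [hψ, (D.triv i).map_smul]
      rfl
  choose Θ hΘ using hfib
  have : LocallyCompactSpace (S.U i) := (S.goodX.isOpen i).locallyCompactSpace
  -- The trivialisation reaches all of `C_0(U_i, 𝒦)`, whose elements take every value at `x`.
  have hsurj : ∀ x, Function.Surjective (Θ x) := by
    intro x T
    obtain ⟨k, hk⟩ := exists_apply_eq x T
    obtain ⟨a, -, ha⟩ := (D.triv i).bijOn.surjOn
      (show k.toBCF ∈ {h : S.U i →ᵇ KK n | Tendsto (fun x => ‖h x‖) (cocompact (S.U i)) (𝓝 0)} from
        tendsto_zero_iff_norm_tendsto_zero.1 (zero_at_infty k))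
    refine ⟨ψ.symm a x, ?_⟩
    rw [← hΘ, StarAlgEquiv.apply_symm_apply, ha]
    exact hk
  -- Against a section equal to `T` near `x`, the family `Θ` coincides locally with one continuous
  -- function `Φ(ψ h)`.
  have hcont : ∀ T, Continuous fun x => Θ x T := by
    intro T
    rw [continuous_iff_continuousAt]
    intro x
    obtain ⟨h, hh⟩ := exists_eventually_eq (x : X) T
    refine ((D.triv i).Φ (ψ h)).continuous.continuousAt.congr ?_
    filter_upwards [continuous_subtype_val.continuousAt.eventually hh] with y hy
    rw [hΘ, hy]
  -- Contractibility is only available for nonempty intersections; over the empty set any family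
  -- will do.
  rcases isEmpty_or_nonempty (S.W i) with hemp | hne
  · exact ⟨fun _ => 1, fun ξ => continuous_const, fun z => isEmptyElim z⟩
  · obtain ⟨z₀⟩ := hne
    have hi : inter S.W ![i] = S.W i := by
      ext z
      simp [inter]
    have hcontr := S.goodZ.contractible 0 ![i]
    change (inter S.W ![i]).Nonempty → ContractibleSpace (inter S.W ![i]) at hcontr
    rw [hi] at hcontr
    have := hcontr ⟨z₀, z₀.2⟩
    -- Only values along `σ_i` enter the triple, so the lift is needed over `π(U_i)` and not over
    -- all of `U_i`.
    obtain ⟨u, hu, hu'⟩ := exists_strongCont_lift (Θ := fun z : S.W i => Θ (S.σ i z))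
      (fun z => hsurj _) (fun T => (hcont T).comp (S.σ i).continuous)
    exact ⟨u, hu, fun z h => by rw [hΘ, hu']⟩

/-- The unitary operators in the construction of `Ξ` in terms of a field `V`, up to phases. -/
theorem XiData.exists_phases (D : XiData S P) (ψ : C₀(X, KK n) ≃⋆ₐ[ℂ] P.A)
    {V : Rn n → X → UU n} (hV : StrongCont fun p : Rn n × X => V p.1 p.2)
    (hα : ∀ s h x, ψ.symm (P.α s (ψ h)) x = conjK (V s x) (h (-s +ᵥ x)))
    {u : ∀ i, S.W i → UU n} (hu : ∀ i, StrongCont (u i))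
    (hψu : ∀ i z h, (D.triv i).Φ (ψ h) (S.σ i z) = conjK (u i z) (h (S.σ i z))) :
    ∃ (a : ∀ i, Fin n → C(S.W i, UnitAddCircle)) (b : Cech S.W 1 UnitAddCircle),
      (∀ i j z, (D.v i j (S.σ i z) : BB n) = (ee (a i j z) : ℂ) •
        ((u i z * V (Pi.single j 1) (S.σ i z) * star (u i z) : UU n) : BB n)) ∧
      ∀ l z, (D.vv l z : BB n) = (ee (b l z) : ℂ) •
        ((u (l 1) (proj S.W l 1 z) * V (-(S.s l z)) (S.σ (l 1) (proj S.W l 1 z)) *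
          star (u (l 0) (proj S.W l 0 z)) : UU n) : BB n) := by
  -- Every `T` is a value of the trivialisation at `σ_i(z)`, so the defining relations of `v^i` and
  -- `v_{ab}` can be tested on all compact operators.
  have hsec : ∀ i z (T : KK n), ∃ h : C₀(X, KK n), h (S.σ i z) = conjK (star (u i z)) T ∧
      (D.triv i).Φ (ψ h) (S.σ i z) = T := by
    intro i z T
    obtain ⟨h, hh⟩ := exists_apply_eq (S.σ i z : X) (conjK (star (u i z)) T)
    refine ⟨h, hh, ?_⟩
    rw [hψu, hh, conjK_conjK, Unitary.mul_star_self, conjK_one]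
  have hact : ∀ i z s h, (D.triv i).Φ (P.α s (ψ h)) (S.σ i z) =
      conjK (u i z * V s (S.σ i z)) (h (-s +ᵥ (S.σ i z : X))) := by
    intro i z s h
    rw [← conjK_conjK, ← hα, ← hψu, StarAlgEquiv.apply_symm_apply]
  have hv : ∀ i j, ∃ a : C(S.W i, UnitAddCircle), ∀ z, (D.v i j (S.σ i z) : BB n) =
      (ee (a z) : ℂ) • ((u i z * V (Pi.single j 1) (S.σ i z) * star (u i z) : UU n) : BB n) := by
    intro i j
    -- The chosen unitary and the transported value of `V` implement the same automorphism of `𝒦`,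
    -- so they differ by a continuous phase.
    refine exists_phase (u := fun z => D.v i j (S.σ i z)) ?_ ?_ fun z T => ?_
    · exact StrongCont.comp (u := D.v i j) (D.v_continuous i j) (S.σ i).continuous
    · refine ((hu i).mul ?_).mul (hu i).adjoint
      exact StrongCont.comp (f := fun z : S.W i => ((Pi.single j 1 : Rn n), (S.σ i z : X))) hV
        (by fun_prop)
    · obtain ⟨h, hh, hT⟩ := hsec i z T
      have e : -(Pi.single j 1 : Rn n) +ᵥ (S.σ i z : X) = S.σ i z := by
        have := latt_vadd S.bundle (-Pi.single j 1) (S.σ i z : X)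
        rwa [latt_neg, latt_single, Int.cast_one] at this
      have h1 := D.v_spec i j (ψ h) (S.σ i z)
      rw [hact, hT, e, hh, conjK_conjK] at h1
      exact h1.symm
  have hvv : ∀ l, ∃ b : C(inter S.W l, UnitAddCircle), ∀ z, (D.vv l z : BB n) =
      (ee (b z) : ℂ) • ((u (l 1) (proj S.W l 1 z) * V (-(S.s l z)) (S.σ (l 1) (proj S.W l 1 z)) *
          star (u (l 0) (proj S.W l 0 z)) : UU n) : BB n) := by
    intro l
    refine exists_phase (u := D.vv l) (D.vv_continuous l) ?_ fun z T => ?_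
    · refine ((StrongCont.comp (hu (l 1)) (proj S.W l 1).continuous).mul ?_).mul
        (StrongCont.comp (hu (l 0)) (proj S.W l 0).continuous).adjoint
      exact StrongCont.comp
        (f := fun z : inter S.W l => (-(S.s l z), (S.σ (l 1) (proj S.W l 1 z) : X))) hV
        (by fun_prop)
    · obtain ⟨h, hh, hT⟩ := hsec (l 0) (proj S.W l 0 z) T
      -- Acting by `-s_{ab}` means evaluating at `s_{ab} · σ_b = σ_a`, which is why the source
      -- unitary is `u_a`.
      have e : - -(S.s l z) +ᵥ (S.σ (l 1) (proj S.W l 1 z) : X) = S.σ (l 0) (proj S.W l 0 z) := by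
        rw [neg_neg]; exact S.s_vadd l z
      have h1 := D.vv_spec l z T (ψ h) hT
      rw [hact, e, hh, conjK_conjK] at h1
      exact h1.symm
  choose a ha using hv
  choose b hb using hvv
  exact ⟨a, b, ha, hb⟩

end Outer

/-! ## The explicit real cocycle -/

section RealCocycle

variable {n : ℕ} {X : Type u} {Z : Type v} {I : Type w} [TopologicalSpace X] [TopologicalSpace Z]
  [AddAction (Rn n) X] {π : X → Z} (S : StandardSetup n π I) (g : C(Z, Pairs n → ℝ))

/-- The real cochain that lifts the value of `Ξ` at `[C_0(X, 𝒦), Ad L_g̃ ∘ τ]`: with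
`B(x, y) = ∑_{i<j} g_ij x_i y_j`, its components are `B(s₀₁, s₁₂) - B(F₀₁₂, s₀₂)`,
`- g ∪₁ s` and `g`. -/
def realCochain : DR S.W n ℝ 0 :=
  (fun l => ⟨fun z => ∑ p : Pairs n, g z p *
      (pull S.s l (Fin.succAbove 2) z p.1.1 * pull S.s l (Fin.succAbove 0) z p.1.2 -
        cechD 1 S.s l z p.1.1 * pull S.s l (Fin.succAbove 1) z p.1.2), by fun_prop⟩,
    fun l => ⟨fun z j => -∑ p : Pairs n, g z p *
      (S.s l z p.1.1 * (Pi.single j 1 : Rn n) p.1.2 -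
        (Pi.single j 1 : Rn n) p.1.1 * S.s l z p.1.2), by fun_prop⟩,
    fun l => ⟨fun z => g z, by fun_prop⟩)

variable {S g}

theorem cval_realCochain_zero {z : Z} {a b c : I} (ha : z ∈ S.W a) (hb : z ∈ S.W b)
    (hc : z ∈ S.W c) :
    cval (realCochain S g).1 ![a, b, c] z = ∑ p : Pairs n, g z p *
      (cval S.s ![a, b] z p.1.1 * cval S.s ![b, c] z p.1.2 -
        (cval S.s ![b, c] z p.1.1 - cval S.s ![a, c] z p.1.1 + cval S.s ![a, b] z p.1.1) *
          cval S.s ![a, c] z p.1.2) := by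
  rw [cval_of_mem _ _ (mem_inter_three ha hb hc)]
  simp only [realCochain, ContinuousMap.coe_mk, apply_eq_cval (cechD 1 S.s), pull_eq_cval,
    cval_cechD_one S.s ha hb hc]
  rw [cval_two _ (![a, b, c] ∘ _), cval_two _ (![a, b, c] ∘ _), cval_two _ (![a, b, c] ∘ _)]
  rfl

theorem cval_realCochain_one {z : Z} {a b : I} (ha : z ∈ S.W a) (hb : z ∈ S.W b) (j : Fin n) :
    cval (realCochain S g).2.1 ![a, b] z j = -∑ p : Pairs n, g z p *
      (cval S.s ![a, b] z p.1.1 * (Pi.single j 1 : Rn n) p.1.2 -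
        (Pi.single j 1 : Rn n) p.1.1 * cval S.s ![a, b] z p.1.2) := by
  rw [cval_of_mem _ _ (mem_inter_two ha hb)]
  simp only [realCochain, ContinuousMap.coe_mk, apply_eq_cval S.s]

theorem cval_realCochain_two {z : Z} {a : I} (ha : z ∈ S.W a) :
    cval (realCochain S g).2.2 ![a] z = g z := by
  have h : z ∈ inter S.W ![a] := mem_iInter.2 fun j => by fin_cases j; exact ha
  rw [cval_of_mem _ _ h]
  rfl

theorem cval_F_cast {z : Z} {a b c : I} (ha : z ∈ S.W a) (hb : z ∈ S.W b) (hc : z ∈ S.W c)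
    (i : Fin n) : (cval S.F ![a, b, c] z i : ℝ) =
      cval S.s ![b, c] z i - cval S.s ![a, c] z i + cval S.s ![a, b] z i := by
  have h := cval_cechD_one S.s ha hb hc
  rw [cval_of_mem _ _ (mem_inter_three ha hb hc), ← S.latt_F] at h
  rw [cval_of_mem _ _ (mem_inter_three ha hb hc)]
  exact congrFun h i

theorem single_cast (j q : Fin n) :
    (((Pi.single j 1 : Fin n → ℤ) q : ℤ) : ℝ) = (Pi.single j 1 : Rn n) q := by
  rcases eq_or_ne q j with rfl | h
  · simp
  · simp [h]

theorem sum_mul_single (x y : Fin n → ℝ) (h : Pairs n → ℝ) :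
    ∑ r, x r * ∑ p : Pairs n, h p * (y p.1.1 * (Pi.single r 1 : Rn n) p.1.2 -
      (Pi.single r 1 : Rn n) p.1.1 * y p.1.2) =
    ∑ p : Pairs n, h p * (y p.1.1 * x p.1.2 - x p.1.1 * y p.1.2) := by
  have := sum_single_mul x y h
  simp only [single_cast] at this
  simpa only [mul_comm] using this

/-- With `F` replaced by `∂̌s`, the first two components vanish separately for each pair `i < j` as
polynomial identities in the values of `s`. The third is `∂̌g`, zero for a globally defined `g`. No
reduction modulo `ℤ` intervenes; this is what makes the connecting map vanish. -/
theorem drD_realCochain : drD S.F 0 (realCochain S g) = 0 := by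
  refine Prod.ext ?_ (Prod.ext ?_ ?_)
  · change cechD 2 (realCochain S g).1 + (-1 : ℤ) ^ 3 • cupVec S.F 1 (realCochain S g).2.1
      + (-1 : ℤ) ^ 3 • cupTwo (steenrodC S.F) 0 (realCochain S g).2.2 = 0
    refine cech_ext_four fun a b c d z ha hb hc hd => ?_
    simp only [cval_add, cval_zsmul, cval_zero]
    simp only [cval_cechD_two _ ha hb hc hd, cval_cupVec_one _ _ ha hb hc hd, cval_cupTwo_zero _ _ ha hb hc hd,
      cval_steenrodC _ ha hb hc hd, cval_realCochain_zero, cval_realCochain_one,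
      cval_realCochain_two, ha, hb, hc, hd, zsmul_eq_mul, Int.cast_sub, Int.cast_mul,
      cval_F_cast, mul_neg, Finset.sum_neg_distrib]
    -- The term `φ¹¹ ∪₁ F` sums over basis vectors; contracting it to a sum over pairs lets all
    -- three terms be compared summand by summand.
    rw [sum_mul_single (fun r => cval S.s ![c, d] z r - cval S.s ![b, d] z r + cval S.s ![b, c] z r)
      (fun r => cval S.s ![a, b] z r)]
    simp only [Finset.mul_sum, ← Finset.sum_neg_distrib, ← Finset.sum_sub_distrib,
      ← Finset.sum_add_distrib]
    refine Finset.sum_eq_zero fun p _ => ?_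
    push_cast
    ring
  · change cechD 1 (realCochain S g).2.1 + (-1 : ℤ) ^ 2 • cupMat S.F 0 (realCochain S g).2.2 = 0
    refine cech_ext_three fun a b c z ha hb hc => funext fun j => ?_
    simp only [cval_add, cval_zsmul, cval_zero, Pi.add_apply, Pi.smul_apply, Pi.zero_apply]
    simp only [cval_cechD_one _ ha hb hc, Pi.add_apply, Pi.sub_apply, cval_cupMat_zero _ _ ha hb hc,
      cval_realCochain_one, cval_realCochain_two, ha, hb, hc, zsmul_eq_mul, Int.cast_sub,
      Int.cast_mul, cval_F_cast, single_cast]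
    simp only [Finset.mul_sum, ← Finset.sum_neg_distrib, ← Finset.sum_sub_distrib,
      ← Finset.sum_add_distrib]
    refine Finset.sum_eq_zero fun p _ => ?_
    push_cast
    ring
  · change cechD 0 (realCochain S g).2.2 = 0
    funext l
    ext z p
    have hl : ![l 0, l 1] = l := by ext j; fin_cases j <;> rfl
    have h0 := inter_subset S.W l 0 z.2
    have h1 := inter_subset S.W l 1 z.2
    have h := cval_cechD_zero (realCochain S g).2.2 h0 h1
    rw [cval_realCochain_two h0, cval_realCochain_two h1, sub_self, hl] at h
    rw [apply_eq_cval, h]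
    rfl

theorem drD_drRT_realCochain (g : C(Z, Pairs n → ℝ)) :
    drD S.F 0 (drRT (realCochain S g)) = 0 := by
  rw [drRT, ← drMap_drD, drD_realCochain, map_zero]

/-- Circle-valued cochains lift to real ones over the good cover, so `D_F² = 0` is inherited from
real coefficients. -/
theorem drD_drD1_circle (η : DR1 S.W n UnitAddCircle) : drD S.F 0 (drD1 S.F η) = 0 := by
  obtain ⟨ζ, hζ⟩ := exists_dr1_lift S.goodZ (F := S.F) η
  rw [← hζ, drRT, ← drMap_drD, drD_drD1 S.F_closed, map_zero]

end RealCocycle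

/-! ## Unitary operators up to phases -/

section Twist

variable {n : ℕ}

/-- The scalar unitary operator `exp(2πiθ)`. -/
def sc (θ : UnitAddCircle) : UU n :=
  ⟨(ee θ : ℂ) • 1, by
    have h : star (ee θ : ℂ) * (ee θ : ℂ) = 1 := by
      rw [Complex.star_def, ← Complex.normSq_eq_conj_mul_self, Circle.normSq_coe,
        Complex.ofReal_one]
    rw [Unitary.mem_iff, star_smul, star_one, smul_mul_smul_comm, smul_mul_smul_comm, h,
      mul_comm (ee θ : ℂ), h, one_mul, one_smul]
    exact ⟨rfl, rfl⟩⟩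

theorem coe_sc (θ : UnitAddCircle) : ((sc θ : UU n) : BB n) = (ee θ : ℂ) • 1 := rfl

theorem coe_sc_mul (θ : UnitAddCircle) (u : UU n) :
    ((sc θ * u : UU n) : BB n) = (ee θ : ℂ) • (u : BB n) := by
  change (ee θ : ℂ) • (1 : BB n) * (u : BB n) = _
  rw [smul_mul_assoc, one_mul]

theorem eq_sc_mul {θ : UnitAddCircle} {u v : UU n} (h : (u : BB n) = (ee θ : ℂ) • (v : BB n)) :
    u = sc θ * v := Subtype.ext (by rw [h, coe_sc_mul])

theorem sc_add (θ φ : UnitAddCircle) : (sc (θ + φ) : UU n) = sc θ * sc φ := by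
  apply Subtype.ext
  rw [coe_sc_mul, coe_sc, coe_sc, ee_add, Circle.coe_mul, smul_smul]

theorem mul_sc (θ : UnitAddCircle) (u : UU n) : u * sc θ = sc θ * u := by
  apply Subtype.ext
  rw [coe_sc_mul]
  change (u : BB n) * ((ee θ : ℂ) • (1 : BB n)) = _
  rw [mul_smul_comm, mul_one]

theorem sc_zero : (sc 0 : UU n) = 1 := by
  apply Subtype.ext
  rw [coe_sc, ee_zero, Circle.coe_one, one_smul]
  rfl

/-- The operator `exp(2πia) u₂ V u₁⋆`. -/
def tw (u₂ : UU n) (a : UnitAddCircle) (V u₁ : UU n) : UU n := sc a * (u₂ * V * star u₁)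

/-- The intermediate unitaries `u₂⋆ u₂` cancel and scalars are central. Products of transported
operators thus become additions in `ℝ/ℤ`. -/
theorem tw_mul_tw {u₃ u₂ u₁ V V' V'' : UU n} {a b θ : UnitAddCircle} (h : V * V' = sc θ * V'') :
    tw u₃ a V u₂ * tw u₂ b V' u₁ = tw u₃ (a + b + θ) V'' u₁ := by
  calc sc a * (u₃ * V * star u₂) * (sc b * (u₂ * V' * star u₁))
      = sc a * (u₃ * V * star u₂ * sc b) * (u₂ * V' * star u₁) := by simp only [mul_assoc]
    _ = sc a * sc b * (u₃ * (V * ((star u₂ * u₂) * V')) * star u₁) := by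
        rw [mul_sc b (u₃ * V * star u₂)]; simp only [mul_assoc]
    _ = sc a * sc b * (u₃ * sc θ * V'' * star u₁) := by
        rw [Unitary.star_mul_self, one_mul, h, ← mul_assoc u₃]
    _ = _ := by
        rw [mul_sc θ u₃, tw, sc_add, sc_add]; simp only [mul_assoc]

theorem sc_mul_tw (θ a : UnitAddCircle) (u₂ V u₁ : UU n) :
    sc θ * tw u₂ a V u₁ = tw u₂ (θ + a) V u₁ := by
  rw [tw, tw, sc_add]
  simp only [mul_assoc]

/-- `A B = exp(2πiθ) D C` as an equation for `A B C⋆ D⋆`. -/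
theorem coe_mul_star_eq {A B C D : UU n} {θ : UnitAddCircle} (h : A * B = sc θ * (D * C)) :
    ((A * B * star C * star D : UU n) : BB n) = (ee θ : ℂ) • 1 := by
  have h1 : A * B * star C * star D = sc θ := by
    rw [h]
    calc sc θ * (D * C) * star C * star D = sc θ * (D * (C * star C) * star D) := by
          simp only [mul_assoc]
      _ = _ := by rw [Unitary.mul_star_self, mul_one, Unitary.mul_star_self, mul_one]
  rw [h1, coe_sc]

/-- The truncation of a vector to its first `m` entries. -/
def trunc (m : ℕ) (k : Fin n → ℤ) (j : Fin n) : ℤ := if (j : ℕ) < m then k j else 0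

/-- In `g̃(s, t)` the first index belongs to `t` and the larger one to `s`. With `t` concentrated at
`m` and `s` below `m` no pair contributes, so appending the next factor to the ordered product
creates no phase. -/
theorem gTilde_trunc_single (g : Pairs n → ℝ) (k : Fin n → ℤ) (m : ℕ) (hm : m < n) (c : ℤ) :
    gTilde g (latt (trunc m k)) (latt (Pi.single ⟨m, hm⟩ c)) = 0 := by
  have h : (∑ p : Pairs n, g p * latt (Pi.single ⟨m, hm⟩ c) p.1.1 *
      latt (trunc m k) p.1.2 : ℝ) = 0 := by
    refine Finset.sum_eq_zero fun p _ => ?_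
    by_cases hp : p.1.1 = ⟨m, hm⟩
    · have h1 : ¬ ((p.1.2 : ℕ) < m) := by
        have h2 : (p.1.1 : ℕ) < (p.1.2 : ℕ) := p.2
        rw [hp] at h2
        exact not_lt.2 h2.le
      simp [latt, trunc, h1]
    · simp [latt, hp]
  rw [gTilde, h, AddCircle.coe_zero]

/-- A strictly upper triangular form has no diagonal terms, so powers of a single `v^j` acquire no
cocycle phase. -/
theorem gTilde_single_single (g : Pairs n → ℝ) (j : Fin n) (c d : ℤ) :
    gTilde g (latt (Pi.single j c)) (latt (Pi.single j d)) = 0 := by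
  have h : (∑ p : Pairs n, g p * latt (Pi.single j d) p.1.1 * latt (Pi.single j c) p.1.2 : ℝ) = 0 := by
    refine Finset.sum_eq_zero fun p _ => ?_
    by_cases hp : p.1.1 = j
    · have h1 : p.1.2 ≠ j := by
        rw [← hp]
        exact (ne_of_lt p.2).symm
      simp [latt, h1]
    · simp [latt, hp]
  rw [gTilde, h, AddCircle.coe_zero]

theorem latt_add (k m : Fin n → ℤ) : latt (k + m) = latt k + latt m := by
  funext i; simp [latt]

theorem trunc_succ (k : Fin n → ℤ) (m : ℕ) (hm : m < n) :
    trunc (m + 1) k = trunc m k + Pi.single ⟨m, hm⟩ (k ⟨m, hm⟩) := by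
  funext j
  by_cases hj : j = ⟨m, hm⟩
  · subst hj
    simp [trunc]
  · have h1 : (j : ℕ) ≠ m := fun h => hj (Fin.ext h)
    have h2 : ((j : ℕ) < m + 1) ↔ ((j : ℕ) < m) := by omega
    simp [trunc, hj, h2]

/-- Ordered products of powers of operators `exp(2πia_j) u V(e_j) u⋆` for a field `V` of unitary
operators on `ℤⁿ` that is multiplicative up to the cocycle `g̃`. -/
theorem prod_zpow_tw (g : Pairs n → ℝ) {V : Rn n → UU n}
    (hV : ∀ k m : Fin n → ℤ, V (latt k) * V (latt m) =
      sc (gTilde g (latt k) (latt m)) * V (latt (k + m)))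
    (u : UU n) (a : Fin n → UnitAddCircle) (k : Fin n → ℤ) {v : Fin n → UU n}
    (hv : ∀ j, v j = tw u (a j) (V (latt (Pi.single j 1))) u) :
    (List.ofFn fun j => v j ^ k j).prod = tw u (∑ j, k j • a j) (V (latt k)) u := by
  have hpow : ∀ j (m : ℤ), v j ^ m = tw u (m • a j) (V (latt (Pi.single j m))) u := by
    intro j m
    -- Writing the powers as a homomorphism from `ℤ` treats negative exponents together with
    -- positive ones.
    let f : Multiplicative ℤ →* UU n := MonoidHom.mk'
      (fun m => tw u (m.toAdd • a j) (V (latt (Pi.single j m.toAdd))) u) (by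
        intro c d
        have h := hV (Pi.single j c.toAdd) (Pi.single j d.toAdd)
        rw [gTilde_single_single] at h
        rw [tw_mul_tw h, add_zero, toAdd_mul, add_smul, Pi.single_add])
    have h1 : f (Multiplicative.ofAdd 1) = v j := by
      rw [hv]
      change tw u ((1 : ℤ) • a j) _ u = _
      rw [one_smul]
      rfl
    have h2 : f (Multiplicative.ofAdd m) = f (Multiplicative.ofAdd 1) ^ m := by
      rw [← map_zpow, ← ofAdd_zsmul, smul_eq_mul, mul_one]
    rw [← h1, ← h2]
    rfl
  have hV0 : V (latt (0 : Fin n → ℤ)) = 1 := by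
    have h := hV 0 0
    have h0 : gTilde g (latt (0 : Fin n → ℤ)) (latt 0) = 0 := by simp [gTilde, latt]
    rw [h0, sc_zero, one_mul, add_zero] at h
    exact mul_eq_left.1 h
  -- Induction on the length of the initial segment of the ordered product; `trunc m k` is the
  -- lattice vector accumulated so far.
  have main : ∀ m (hm : m ≤ n), (List.ofFn fun j : Fin m => v (j.castLE hm) ^ k (j.castLE hm)).prod =
      tw u (∑ j : Fin m, k (j.castLE hm) • a (j.castLE hm)) (V (latt (trunc m k))) u := by
    intro m
    induction m with
    | zero =>
      intro hm
      have : trunc 0 k = 0 := by funext j; simp [trunc]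
      rw [this, hV0]
      simp [tw, sc_zero]
    | succ m ih =>
      intro hm
      have h := hV (trunc m k) (Pi.single ⟨m, hm⟩ (k ⟨m, hm⟩))
      rw [gTilde_trunc_single, ← trunc_succ] at h
      rw [List.ofFn_succ', List.concat_eq_append, List.prod_append, List.prod_singleton,
        Fin.sum_univ_castSucc]
      change (List.ofFn fun j : Fin m => v (j.castLE (Nat.le_of_succ_le hm)) ^
        k (j.castLE (Nat.le_of_succ_le hm))).prod * v ⟨m, hm⟩ ^ k ⟨m, hm⟩ = _
      rw [ih, hpow, tw_mul_tw h, add_zero]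
      rfl
  have htr : trunc n k = k := by funext j; simp [trunc]
  have := main n le_rfl
  rw [htr] at this
  exact this

end Twist

/-! ## The value of `Ξ` -/

section Value

variable {n : ℕ}

theorem gTilde_eq (g : Pairs n → ℝ) (s t : Rn n) :
    gTilde g s t = realToCircle (∑ p : Pairs n, g p * t p.1.1 * s p.1.2) := rfl

/-- Only the pair `p` itself contributes. In the opposite order nothing does, so the commutator of
the operators for `e_j` and `e_i` is the phase `g_{ij}`. -/
theorem gTilde_single_of_lt (g : Pairs n → ℝ) (p : Pairs n) :
    gTilde g (Pi.single p.1.2 1) (Pi.single p.1.1 1) = realToCircle (g p) := by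
  rw [gTilde_eq, Finset.sum_eq_single p]
  · simp
  · intro q _ hq
    by_cases h1 : q.1.1 = p.1.1
    · have h2 : q.1.2 ≠ p.1.2 := fun h2 => hq (Subtype.ext (Prod.ext h1 h2))
      simp [h2]
    · simp [h1]
  · intro h
    exact absurd (Finset.mem_univ p) h

theorem gTilde_single_of_gt (g : Pairs n → ℝ) (p : Pairs n) :
    gTilde g (Pi.single p.1.1 1) (Pi.single p.1.2 1) = 0 := by
  rw [gTilde_eq, Finset.sum_eq_zero, map_zero]
  intro q _
  by_cases h1 : q.1.1 = p.1.2
  · have h2 : q.1.2 ≠ p.1.1 := by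
      intro h2
      have h3 := q.2
      rw [h1, h2] at h3
      exact lt_asymm h3 p.2
    simp [h2]
  · simp [h1]

variable {Z : Type v} [TopologicalSpace Z] {I : Type w} {W : I → Set Z} {A : Type*}
  [TopologicalSpace A] [AddCommGroup A] [IsTopologicalAddGroup A]

theorem cechD_zero_apply (φ : Cech W 0 A) (l : Fin 2 → I) (z : inter W l) :
    cechD 0 φ l z = pull φ l (Fin.succAbove 0) z - pull φ l (Fin.succAbove 1) z := by
  have e0 : cechD 0 φ l = ∑ j : Fin 2, ((-1 : ℤ) ^ (j : ℕ)) • pull φ l j.succAbove := rfl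
  rw [e0, Fin.sum_univ_two, ContinuousMap.add_apply, ContinuousMap.smul_apply,
    ContinuousMap.smul_apply]
  change (-1 : ℤ) ^ 0 • _ + (-1 : ℤ) ^ 1 • _ = _
  rw [pow_zero, pow_one, one_smul, neg_one_smul, sub_eq_add_neg]

theorem cechD_one_apply (φ : Cech W 1 A) (l : Fin 3 → I) (z : inter W l) :
    cechD 1 φ l z = pull φ l (Fin.succAbove 0) z - pull φ l (Fin.succAbove 1) z +
      pull φ l (Fin.succAbove 2) z := by
  have e0 : cechD 1 φ l = ∑ j : Fin 3, ((-1 : ℤ) ^ (j : ℕ)) • pull φ l j.succAbove := rfl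
  rw [e0, Fin.sum_univ_three, ContinuousMap.add_apply, ContinuousMap.add_apply,
    ContinuousMap.smul_apply, ContinuousMap.smul_apply, ContinuousMap.smul_apply]
  change (-1 : ℤ) ^ 0 • _ + (-1 : ℤ) ^ 1 • _ + (-1 : ℤ) ^ 2 • _ = _
  rw [pow_zero, pow_one, one_smul, neg_one_sq, one_smul, neg_one_smul, sub_eq_add_neg]

theorem cupVec_zero_apply (F : Cech W 2 (Fin n → ℤ)) (φ : Cech W 0 (Fin n → A)) (l : Fin 3 → I)
    (z : inter W l) :
    cupVec F 0 φ l z = ∑ i, F l z i • pull φ l (frontFace 0 2) z i := by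
  have e : pull F l (backFace 0 2) z = F l z := by
    have hl : l ∘ backFace 0 2 = l := by funext j; fin_cases j <;> rfl
    rw [pull_eq_cval, apply_eq_cval, hl]
  change ∑ i, pull F l (backFace 0 2) z i • pull φ l (frontFace 0 2) z i = _
  rw [e]

variable {X : Type u} [TopologicalSpace X] [T2Space X] [LocallyCompactSpace X]
  [AddAction (Rn n) X] [ContinuousVAdd (Rn n) X] {π : X → Z} {S : StandardSetup n π I}
  {P : BrObj n X}

/-- All choices for all systems outer conjugate to `(C_0(X, 𝒦), Ad L_g̃ ∘ τ)` lead to the class of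
the reduction modulo `ℤ` of the explicit real cocycle. -/
theorem XiData.exists_isTriple (D : XiData S P) {g : C(Z, Pairs n → ℝ)}
    (h : OuterConj (brObj S.bundle g) P) :
    ∃ η : DR1 S.W n UnitAddCircle, D.IsTriple (drRT (realCochain S g) + drD1 S.F η) := by
  obtain ⟨ψ, V, hψ, hV, hα, hmul⟩ := h.exists_field S.bundle g
  choose u hu hψu using D.exists_unitaries ψ hψ
  obtain ⟨a, b, ha, hb⟩ := D.exists_phases ψ hV hα hu hψu
  -- The moved point and the base point are kept as separate variables, so that the relations
  -- between the sections can be inserted directly.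
  have hVmul : ∀ (s t : Rn n) (x y : X) (z : Z), -s +ᵥ x = y → π x = z →
      V s x * V t y = sc (gTilde (g z) s t) * V (s + t) x := by
    rintro s t x _ _ rfl rfl
    exact eq_sc_mul (hmul s t x)
  -- Lattice vectors fix every point, so over each `z` the field restricts to a projective
  -- representation of `ℤⁿ`.
  have hVlatt : ∀ i z (k m : Fin n → ℤ), V (latt k) (S.σ i z) * V (latt m) (S.σ i z) =
      sc (gTilde (g z) (latt k) (latt m)) * V (latt (k + m)) (S.σ i z) := by
    intro i z k m
    rw [latt_add]
    refine hVmul _ _ _ _ _ ?_ (S.π_σ i z)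
    rw [← latt_neg, latt_vadd S.bundle]
  have hv : ∀ i j z, D.v i j (S.σ i z) =
      tw (u i z) (a i j z) (V (latt (Pi.single j 1)) (S.σ i z)) (u i z) := by
    intro i j z
    rw [latt_single, Int.cast_one]
    exact eq_sc_mul (ha i j z)
  have hvpow : ∀ i k z, D.vpow i k (S.σ i z) =
      tw (u i z) (∑ j, k j • a i j z) (V (latt k) (S.σ i z)) (u i z) := by
    intro i k z
    exact prod_zpow_tw (g z) (V := fun s => V s (S.σ i z)) (hVlatt i z) _ _ k fun j => hv i j z
  have hvv : ∀ l z, D.vv l z = tw (u (l 1) (proj S.W l 1 z)) (b l z)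
      (V (-(S.s l z)) (S.σ (l 1) (proj S.W l 1 z))) (u (l 0) (proj S.W l 0 z)) :=
    fun l z => eq_sc_mul (hb l z)
  -- The phases of the `v^i` form a 0-cochain; together with the phases `b` of the `v_{ab}` they
  -- give the correcting 1-cochain.
  let a' : Cech S.W 0 (Fin n → UnitAddCircle) := fun l =>
    ⟨fun z j => a (l 0) j (proj S.W l 0 z), by fun_prop⟩
  refine ⟨(b, a'), ?_, ?_, ?_⟩
  · intro l z p x
    have e : (drRT (realCochain S g) + drD1 S.F (b, a')).2.2 l z p = realToCircle (g z p) + 0 := rfl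
    rw [e, add_zero]
    refine coe_mul_star_eq ?_
    -- The phases of `v^i` and `v^j` occur in both orders and cancel, so `φ⁰²` is unaffected by the
    -- choices.
    rw [hv, hv, tw_mul_tw (hVlatt _ _ _ _), tw_mul_tw (hVlatt _ _ _ _), sc_mul_tw]
    have e1 := gTilde_single_of_lt (g z) p
    have e2 := gTilde_single_of_gt (g z) p
    rw [add_comm (Pi.single p.1.1 1 : Fin n → ℤ)]
    congr 1
    rw [latt_single, latt_single, Int.cast_one]
    change _ + _ + gTilde (g z) _ _ = _ + (_ + _ + gTilde (g z) _ _)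
    rw [e1, e2]
    abel
  · intro l z k
    refine coe_mul_star_eq ?_
    rw [hvpow, hvpow, hvv]
    have h1 := hVmul (latt k) (-(S.s l z)) (S.σ (l 1) (proj S.W l 1 z))
      (S.σ (l 1) (proj S.W l 1 z)) z (by rw [← latt_neg, latt_vadd S.bundle]) (S.π_σ _ _)
    -- Both orders lead to the group element `k - s_{ab}`, so only the antisymmetrised `g̃` and the
    -- difference of the phases of `v^k` remain; the phase of `v_{ab}` cancels.
    have h2 := hVmul (-(S.s l z)) (latt k) (S.σ (l 1) (proj S.W l 1 z))
      (S.σ (l 0) (proj S.W l 0 z)) z (by rw [neg_neg]; exact S.s_vadd l z) (S.π_σ _ _)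
    rw [tw_mul_tw h1, tw_mul_tw h2, sc_mul_tw, add_comm (latt k)]
    congr 1
    have e : ∀ j, (drRT (realCochain S g) + drD1 S.F (b, a')).2.1 l z j =
        realToCircle ((realCochain S g).2.1 l z j) +
          (a (l 1) j (proj S.W l 1 z) - a (l 0) j (proj S.W l 0 z)) := by
      intro j
      have e0 := congrFun (cechD_zero_apply a' l z) j
      change realToCircle _ + cechD 0 a' l z j = _
      rw [e0]
      rfl
    have e3 : ∑ j, k j • realToCircle ((realCochain S g).2.1 l z j) =
        gTilde (g z) (latt k) (-(S.s l z)) - gTilde (g z) (-(S.s l z)) (latt k) := by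
      have e4 : ∑ j, (k j : ℝ) * (realCochain S g).2.1 l z j =
          -∑ p : Pairs n, g z p * (S.s l z p.1.1 * k p.1.2 - k p.1.1 * S.s l z p.1.2) := by
        rw [← sum_mul_single (fun j => (k j : ℝ)) (S.s l z), ← Finset.sum_neg_distrib]
        refine Finset.sum_congr rfl fun j _ => ?_
        rw [← mul_neg]
        rfl
      rw [gTilde_eq, gTilde_eq, ← map_sub, ← Finset.sum_sub_distrib]
      simp_rw [← map_zsmul, zsmul_eq_mul]
      rw [← map_sum, e4, ← Finset.sum_neg_distrib]
      congr 1
      refine Finset.sum_congr rfl fun p _ => ?_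
      simp only [latt, Pi.neg_apply]
      ring
    simp_rw [e, smul_add, smul_sub, Finset.sum_add_distrib, Finset.sum_sub_distrib]
    rw [e3]
    abel
  · intro l z
    refine coe_mul_star_eq ?_
    have e12 : D.vv (l ∘ Fin.succAbove 0) (face S.W l (Fin.succAbove 0) z) =
        tw (u (l 2) (proj S.W l 2 z)) (pull b l (Fin.succAbove 0) z)
          (V (-(pull S.s l (Fin.succAbove 0) z)) (S.σ (l 2) (proj S.W l 2 z)))
          (u (l 1) (proj S.W l 1 z)) := hvv _ _
    have e02 : D.vv (l ∘ Fin.succAbove 1) (face S.W l (Fin.succAbove 1) z) =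
        tw (u (l 2) (proj S.W l 2 z)) (pull b l (Fin.succAbove 1) z)
          (V (-(pull S.s l (Fin.succAbove 1) z)) (S.σ (l 2) (proj S.W l 2 z)))
          (u (l 0) (proj S.W l 0 z)) := hvv _ _
    have e01 : D.vv (l ∘ Fin.succAbove 2) (face S.W l (Fin.succAbove 2) z) =
        tw (u (l 1) (proj S.W l 1 z)) (pull b l (Fin.succAbove 2) z)
          (V (-(pull S.s l (Fin.succAbove 2) z)) (S.σ (l 1) (proj S.W l 1 z)))
          (u (l 0) (proj S.W l 0 z)) := hvv _ _
    have s12 : - -(pull S.s l (Fin.succAbove 0) z) +ᵥ (S.σ (l 2) (proj S.W l 2 z) : X) =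
        S.σ (l 1) (proj S.W l 1 z) := by rw [neg_neg]; exact S.s_vadd _ _
    have s02 : - -(pull S.s l (Fin.succAbove 1) z) +ᵥ (S.σ (l 2) (proj S.W l 2 z) : X) =
        S.σ (l 0) (proj S.W l 0 z) := by rw [neg_neg]; exact S.s_vadd _ _
    have h1 := hVmul _ (-(pull S.s l (Fin.succAbove 2) z)) _ _ z s12 (S.π_σ _ _)
    have h2 := hVmul _ (latt (-(S.F l z))) _ _ z s02 (S.π_σ _ _)
    have hF := S.latt_F l z
    have hF' := hF
    rw [cechD_one_apply] at hF'
    -- Since `F = ∂̌s`, the products `v_{bc} v_{ab}` and `v_{ac} v_a^{-F}` involve the same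
    -- translation and can differ only by a phase.
    have hsum : -(pull S.s l (Fin.succAbove 0) z) + -(pull S.s l (Fin.succAbove 2) z) =
        -(pull S.s l (Fin.succAbove 1) z) + latt (-(S.F l z)) := by
      rw [latt_neg, hF']
      abel
    rw [e12, e02, e01, hvpow, tw_mul_tw h1, tw_mul_tw h2, sc_mul_tw, hsum]
    congr 1
    have e : (drRT (realCochain S g) + drD1 S.F (b, a')).1 l z =
        realToCircle ((realCochain S g).1 l z) + (pull b l (Fin.succAbove 0) z -
          pull b l (Fin.succAbove 1) z + pull b l (Fin.succAbove 2) z +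
          ∑ j, S.F l z j • a (l 0) j (proj S.W l 0 z)) := by
      change realToCircle _ + (cechD 1 b l z + cupVec S.F 0 a' l z) = _
      rw [cechD_one_apply, cupVec_zero_apply]
      rfl
    have e3 : realToCircle ((realCochain S g).1 l z) =
        gTilde (g z) (-(pull S.s l (Fin.succAbove 0) z)) (-(pull S.s l (Fin.succAbove 2) z)) -
          gTilde (g z) (-(pull S.s l (Fin.succAbove 1) z)) (latt (-(S.F l z))) := by
      rw [gTilde_eq, gTilde_eq, ← map_sub, ← Finset.sum_sub_distrib]
      congr 1
      refine Finset.sum_congr rfl fun p _ => ?_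
      rw [← hF, latt_neg]
      simp only [Pi.neg_apply]
      ring
    -- The exponent `-F` on the other side of the equation turns the phase of `v_a^{-F}` into `+ a
    -- ∪₁ F`, the sign in `D_F(b, a)`.
    rw [e, e3]
    simp_rw [Pi.neg_apply, neg_smul, Finset.sum_neg_distrib]
    abel

end Value

/-! ## The class -/

section Class

variable {n : ℕ} {X : Type u} {Z : Type v} {I : Type w} [TopologicalSpace X] [TopologicalSpace Z]
  [AddAction (Rn n) X] [ContinuousVAdd (Rn n) X] {π : X → Z} {S : StandardSetup n π I}

/-- The scalars determine their angles because `ee` is injective and the Hilbert space is nonzero;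
the components of `φ¹¹` are read off at the basis vectors. -/
theorem XiData.IsTriple.unique {P : BrObj n X} {D : XiData S P} {φ φ' : DR S.W n UnitAddCircle 0}
    (h : D.IsTriple φ) (h' : D.IsTriple φ') : φ = φ' := by
  have hinj : ∀ {θ θ' : UnitAddCircle}, (ee θ : ℂ) • (1 : BB n) = (ee θ' : ℂ) • 1 → θ = θ' :=
    fun e => ee_injective (Subtype.ext (smul_one_injective e))
  refine Prod.ext ?_ (Prod.ext ?_ ?_)
  · funext l; ext z
    exact hinj ((h.zero l z).symm.trans (h'.zero l z))
  · funext l; ext z j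
    have := hinj ((h.one l z (Pi.single j 1)).symm.trans (h'.one l z (Pi.single j 1)))
    simpa [Pi.single_apply, ite_smul] using this
  · funext l; ext z p
    exact hinj ((h.two l z p).symm.trans (h'.two l z p))

/-- A representative with choices exists by definition, and its single triple represents both
classes. This identifies the class selected by `Xi` with the explicit one. -/
theorem IsXi.unique {b : Br n X} {c c' : DRH S.W UnitAddCircle S.F 0} (h : IsXi S b c)
    (h' : IsXi S b c') : c = c' := by
  obtain ⟨⟨P, hP, ⟨D⟩⟩, h1⟩ := h
  obtain ⟨φ, hφ, h2, rfl⟩ := h1 P hP D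
  obtain ⟨φ', hφ', h3, rfl⟩ := h'.2 P hP D
  obtain rfl := h2.unique h3
  rfl

variable [T2Space X] [LocallyCompactSpace X]

theorem isXi_brMap (g : C(Z, Pairs n → ℝ)) :
    IsXi S (brMap S.bundle g) (DRH.mk (drRT (realCochain S g)) (drD_drRT_realCochain g)) := by
  refine ⟨⟨_, rfl, ⟨trivialXiData S g⟩⟩, fun P hP D => ?_⟩
  have hout : OuterConj (brObj S.bundle g) P := (Quotient.exact hP).symm
  obtain ⟨η, hη⟩ := D.exists_isTriple hout
  refine ⟨_, by rw [map_add, drD_drRT_realCochain, drD_drD1_circle, add_zero], hη, ?_⟩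
  refine QuotientAddGroup.eq.2 ?_
  change -(drRT (realCochain S g) + drD1 S.F η) + drRT (realCochain S g) ∈ (drD1 S.F).range
  -- Changing the representative and the choices moves the cocycle by `D_F η`, so the class is the
  -- same.
  exact ⟨-η, by rw [map_neg]; abel⟩

theorem isXi_xi (g : C(Z, Pairs n → ℝ)) :
    IsXi S (brMap S.bundle g) (Xi S (brMap S.bundle g)) := by
  have h : ∃ c, IsXi S (brMap S.bundle g) c := ⟨_, isXi_brMap g⟩
  rw [Xi, dif_pos h]
  exact h.choose_spec

/-- `realCochain` is a closed real lift of the representing cocycle, so `0` is an admissible end of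
the zig-zag. -/
theorem connecting_xi (g : C(Z, Pairs n → ℝ)) :
    S.connecting (Xi S (brMap S.bundle g)) = 0 := by
  rw [(isXi_xi g).unique (isXi_brMap (S := S) g), StandardSetup.connecting,
    connecting_mk S.goodZ S.F_closed _ (χ := 0)
      ⟨realCochain S g, rfl, by rw [map_zero, drD_realCochain]⟩]
  exact (QuotientAddGroup.eq_zero_iff _).2 (zero_mem _)

end Class

end DimRed

end

/-! ### The main theorem. -/

theorem lemma4p6 {n : ℕ} (hn : 1 ≤ n) {X Z I : Type*}
    [TopologicalSpace X] [T2Space X] [LocallyCompactSpace X] [SecondCountableTopology X]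
    [TopologicalSpace Z] [T2Space Z] [LocallyCompactSpace Z] [SecondCountableTopology Z]
    [AddAction (DimRed.Rn n) X] [ContinuousVAdd (DimRed.Rn n) X] {π : X → Z}
    (S : DimRed.StandardSetup n π I) :
    (∀ g : C(Z, DimRed.Pairs n → ℝ),
      DimRed.IsXi S (DimRed.brMap S.bundle g) (DimRed.Xi S (DimRed.brMap S.bundle g))) ∧
    ∀ g : C(Z, DimRed.Pairs n → ℝ),
      S.connecting (DimRed.Xi S (DimRed.brMap S.bundle g)) = 0 :=
  ⟨fun g => DimRed.isXi_xi g, fun g => DimRed.connecting_xi g⟩
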